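/- Let $N\ge 3$ and $1<q<2<s<\infty$, and put $2^*=\frac{2N}{N-2}$ and $q_0=\frac{2N}{2N-q(N-2)}$. Let $D^{1,2}(\mathbb{R}^N)$ be the space of all $u\in L^{2^*}(\mathbb{R}^N)$ with weak gradient $\nabla u\in L^2(\mathbb{R}^N)$. Assume $(k)$ $k\in L^{q_0}(\mathbb{R}^N)\cap L^\infty(\mathbb{R}^N)$, $k\ge 0$ and $k\not\equiv 0$; $(h)$ $h\in L^1(\mathbb{R}^N)\cap L^\infty(\mathbb{R}^N)$ and $h\ge 0$. Then the problem $$-\Delta u-u\Delta(u^2)=k(x)|u|^{q-2}u-h(x)|u|^{s-2}u,\qquad u\in D^{1,2}(\mathbb{R}^N),$$ has a weak solution $u$ with $u\ge 0$ almost everywhere and $J(u)<0$, where $$J(u)=\frac12\int_{\mathbb{R}^N}(1+2u^2)|\nabla u|^2\,dx-\frac1q\int_{\mathbb{R}^N}k|u|^q\,dx+\frac1s\int_{\mathbb{R}^N}h|u|^s\,dx .$$ Here $u\in D^{1,2}(\mathbb{R}^N)$ is a weak solution if the three integrals in $J(u)$ converge and, for every $\varphi\in C_0^\infty(\mathbb{R}^N)$,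 the three integrals in $J(u+t\varphi)$ converge for all $t\in\mathbb{R}$, $\left.\frac{d}{dt}\right|_{t=0}J(u+t\varphi)=0$, and, written out with convergent integrals, $$\int_{\mathbb{R}^N}\Big((1+2u^2)\nabla u\cdot\nabla\varphi+2u|\nabla u|^2\varphi\Big)dx=\int_{\mathbb{R}^N}\Big(k|u|^{q-2}u-h|u|^{s-2}u\Big)\varphi\,dx .$$ -/

import Mathlib

open MeasureTheory
open scoped ContDiff

noncomputable section

namespace QuasilinearSchrodinger

/-- Real test functions: the elements of `C_0^∞(ℝ^N)`. -/
def IsTestFunction {N : ℕ} (φ : EuclideanSpace ℝ (Fin N) → ℝ) : Prop :=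
  ContDiff ℝ ∞ φ ∧ HasCompactSupport φ

/-- `G` is a weak (distributional) gradient of `u` on `ℝ^N`. -/
structure HasWeakGradient {N : ℕ} (u : EuclideanSpace ℝ (Fin N) → ℝ)
    (G : EuclideanSpace ℝ (Fin N) → EuclideanSpace ℝ (Fin N)) : Prop where
  locallyIntegrable : LocallyIntegrable u volume
  locallyIntegrable_grad : LocallyIntegrable G volume
  integral_eq : ∀ φ : EuclideanSpace ℝ (Fin N) → ℝ, IsTestFunction φ → ∀ i : Fin N,
    ∫ x, u x * fderiv ℝ φ x (EuclideanSpace.single i 1) = -∫ x, G x i * φ x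

open Classical in
/-- The weak gradient `∇u`. It is unique up to null sets when it exists; a function without a weak
gradient gets the value `0`, and every use below comes with the existence of a weak gradient. -/
def weakGrad {N : ℕ} (u : EuclideanSpace ℝ (Fin N) → ℝ) :
    EuclideanSpace ℝ (Fin N) → EuclideanSpace ℝ (Fin N) :=
  if hu : ∃ G, HasWeakGradient u G then hu.choose else 0

/-- The critical Sobolev exponent `2^* = 2N/(N-2)`. -/
def critExp (N : ℕ) : ℝ := 2 * N / ((N : ℝ) - 2)

/-- The exponent `p_0 = 2N/(2N - p(N-2))`. -/
def conjExp (N : ℕ) (p : ℝ) : ℝ := 2 * N / (2 * N - p * ((N : ℝ) - 2))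

/-- Membership in `D^{1,2}(ℝ^N)` for `N ≥ 3`: the functions in `L^{2^*}` whose weak gradient exists
and lies in `L^2`. -/
structure MemD12 {N : ℕ} (u : EuclideanSpace ℝ (Fin N) → ℝ) : Prop where
  memLp : MemLp u (ENNReal.ofReal (critExp N)) volume
  exists_grad : ∃ G, HasWeakGradient u G
  memLp_grad : MemLp (weakGrad u) 2 volume

/-- The energy functional
`J(u) = 1/2 ∫ (1 + 2u²)|∇u|² - 1/q ∫ k|u|^q + 1/s ∫ h|u|^s`. -/
def energy {N : ℕ} (k h : EuclideanSpace ℝ (Fin N) → ℝ) (q s : ℝ)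
    (u : EuclideanSpace ℝ (Fin N) → ℝ) : ℝ :=
  1 / 2 * (∫ x, (1 + 2 * u x ^ 2) * ‖weakGrad u x‖ ^ 2)
    - 1 / q * (∫ x, k x * |u x| ^ q)
    + 1 / s * (∫ x, h x * |u x| ^ s)

/-- `u` lies in the part of `D^{1,2}(ℝ^N)` on which `J` is well defined: the three integrals in
`J(u)` converge. -/
structure HasFiniteEnergy {N : ℕ} (k h : EuclideanSpace ℝ (Fin N) → ℝ) (q s : ℝ)
    (u : EuclideanSpace ℝ (Fin N) → ℝ) : Prop where
  memD12 : MemD12 u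
  integrable_grad : Integrable (fun x => (1 + 2 * u x ^ 2) * ‖weakGrad u x‖ ^ 2) volume
  integrable_k : Integrable (fun x => k x * |u x| ^ q) volume
  integrable_h : Integrable (fun x => h x * |u x| ^ s) volume

/-- `u` is a weak solution of `-Δu - uΔ(u²) = k|u|^{q-2}u - h|u|^{s-2}u`, `u ∈ D^{1,2}(ℝ^N)`:
`u` has finite energy, `d/dt J(u + tφ) = 0` at `t = 0` for every test function `φ` (with
`J(u + tφ)` finite for all `t`), and, written out, the equation holds when it is tested
against `φ`, all the integrals being convergent. -/
structure IsWeakSolution {N : ℕ} (k h : EuclideanSpace ℝ (Fin N) → ℝ) (q s : ℝ)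
    (u : EuclideanSpace ℝ (Fin N) → ℝ) : Prop where
  finiteEnergy : HasFiniteEnergy k h q s u
  finiteEnergy_add : ∀ φ : EuclideanSpace ℝ (Fin N) → ℝ, IsTestFunction φ → ∀ t : ℝ,
    HasFiniteEnergy k h q s (fun x => u x + t * φ x)
  firstVariation : ∀ φ : EuclideanSpace ℝ (Fin N) → ℝ, IsTestFunction φ →
    HasDerivAt (fun t : ℝ => energy k h q s (fun x => u x + t * φ x)) 0 0
  integrable_left : ∀ φ : EuclideanSpace ℝ (Fin N) → ℝ, IsTestFunction φ →
    Integrable (fun x => (1 + 2 * u x ^ 2) * inner ℝ (weakGrad u x) (gradient φ x)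
      + 2 * u x * ‖weakGrad u x‖ ^ 2 * φ x) volume
  integrable_right : ∀ φ : EuclideanSpace ℝ (Fin N) → ℝ, IsTestFunction φ →
    Integrable (fun x => (k x * (|u x| ^ (q - 2) * u x) - h x * (|u x| ^ (s - 2) * u x)) * φ x)
      volume
  weakForm : ∀ φ : EuclideanSpace ℝ (Fin N) → ℝ, IsTestFunction φ →
    ∫ x, ((1 + 2 * u x ^ 2) * inner ℝ (weakGrad u x) (gradient φ x)
      + 2 * u x * ‖weakGrad u x‖ ^ 2 * φ x)
    = ∫ x, (k x * (|u x| ^ (q - 2) * u x) - h x * (|u x| ^ (s - 2) * u x)) * φ x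

end QuasilinearSchrodinger

end

/-! The energy is convex as a functional of ρ = u². Formally |∇u|² = |∇ρ|²/(4ρ) is jointly convex in
(ρ, ∇ρ), u²|∇u|² = |∇ρ|²/4 is quadratic, and -kρ^{q/2} and hρ^{s/2} are convex because q < 2 < s.
The quadratic term makes the convexity quantitative: for w = √((u²+v²)/2), J(w) lies below the mean
of J(u) and J(v) by at least 1/16 ∫ |∇(u²) - ∇(v²)|² (`lipEnergy_midpoint`). This replaces every
compactness argument.

J is minimised over compactly supported Lipschitz functions, a class closed under this midpoint and
under adding test functions. Hölder (k ∈ L^{q₀}) and Sobolev bound ∫ k|u|^q by a multiple of ‖∇u‖₂^q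
with q < 2, so J is coercive; J(tφ) for small t shows that the infimum m is negative. Along a
minimising sequence un the midpoint inequality makes ∇(un²) Cauchy in L², and Sobolev applied to un²
- ul² makes un² Cauchy in L^{2*}; with geometric rates both converge almost everywhere
(`exists_minimizingLimit`).

Let u and W be the limits of un and ∇(un²). Fatou applied to |∇un| = |∇(un²)|/(2un) shows that
W/(2u) is in L² and that W = 0 a.e. on {u = 0}; this quotient is the weak gradient of u
(`hasWeakGradient`). The k-term converges and the other terms are lower semicontinuous, hence J(u) ≤
m < 0 (`energy_le`).

The limit u need not belong to the Lipschitz class, so the equation is obtained from the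
approximants: m ≤ J(un + tφ) is expanded in t with a quadratic remainder uniform in n, and then n →
∞ (`exists_variation_nonneg`). In the delicate term 2un|∇un|²φ = φ ∇(un²)·∇un one factor converges
strongly. Since s may be supercritical, only the differences |un + tφ|^s - |un|^s are passed to the
limit in the h-term. The resulting inequality holds for both signs of t and yields the
Euler-Lagrange equation (`gradientVariation_eq_integral`). -/

noncomputable section

open Filter Topology
open scoped ENNReal NNReal

namespace QuasilinearSchrodinger

/-! ### Limit theorems for integrals. -/

section Convergence

variable {α : Type*} [MeasurableSpace α] {μ : Measure α}

/-- A pointwise limit of functions dominated by `ε g n + G` with `∫ g n` bounded is integrable. -/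
theorem integrable_of_ae_tendsto_of_integral_le {f g : ℕ → α → ℝ} {F G : α → ℝ} {M : ℝ}
    (hf : ∀ n, AEStronglyMeasurable (f n) μ)
    (hlim : ∀ᵐ x ∂μ, Tendsto (fun n => f n x) atTop (𝓝 (F x)))
    (hg : ∀ n, Integrable (g n) μ) (hM : ∀ n, ∫ x, g n x ∂μ ≤ M) (hG : Integrable G μ)
    (hb : ∀ n, ∀ᵐ x ∂μ, |f n x| ≤ g n x + G x) : Integrable F μ := by
  refine ⟨aestronglyMeasurable_of_tendsto_ae atTop hf hlim, ?_⟩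
  have h1 : ∫⁻ x, ‖F x‖ₑ ∂μ ≤ liminf (fun n => ∫⁻ x, ‖f n x‖ₑ ∂μ) atTop := by
    calc ∫⁻ x, ‖F x‖ₑ ∂μ = ∫⁻ x, liminf (fun n => ‖f n x‖ₑ) atTop ∂μ := by
          refine lintegral_congr_ae ?_
          filter_upwards [hlim] with x hx
          exact (hx.enorm.liminf_eq).symm
      _ ≤ _ := lintegral_liminf_le' fun n => (hf n).enorm
  have h2 : ∀ n, ∫⁻ x, ‖f n x‖ₑ ∂μ ≤ ENNReal.ofReal (M + ∫ x, G x ∂μ) := by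
    intro n
    have hi : Integrable (f n) μ := ((hg n).add hG).mono' (hf n) (hb n)
    rw [← ofReal_integral_norm_eq_lintegral_enorm hi]
    refine ENNReal.ofReal_le_ofReal ?_
    calc ∫ x, ‖f n x‖ ∂μ ≤ ∫ x, g n x + G x ∂μ :=
          integral_mono_ae hi.norm ((hg n).add hG) (hb n)
      _ = ∫ x, g n x ∂μ + ∫ x, G x ∂μ := integral_add (hg n) hG
      _ ≤ _ := by gcongr; exact hM n
  refine lt_of_le_of_lt (h1.trans ?_) (ENNReal.ofReal_lt_top (r := M + ∫ x, G x ∂μ))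
  exact (liminf_le_liminf (Eventually.of_forall h2)).trans (by simp)

/-- A variant of Vitali's convergence theorem. -/
theorem tendsto_integral_of_forall_eps {f g : ℕ → α → ℝ} {F : α → ℝ} {M : ℝ}
    (hf : ∀ n, AEStronglyMeasurable (f n) μ)
    (hlim : ∀ᵐ x ∂μ, Tendsto (fun n => f n x) atTop (𝓝 (F x)))
    (hg : ∀ n, Integrable (g n) μ) (hg0 : ∀ n, ∀ᵐ x ∂μ, 0 ≤ g n x)
    (hM : ∀ n, ∫ x, g n x ∂μ ≤ M)
    (hb : ∀ ε : ℝ, 0 < ε → ∃ G : α → ℝ, Integrable G μ ∧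
      ∀ n, ∀ᵐ x ∂μ, |f n x| ≤ ε * g n x + G x) :
    Integrable F μ ∧ Tendsto (fun n => ∫ x, f n x ∂μ) atTop (𝓝 (∫ x, F x ∂μ)) := by
  have hF : Integrable F μ := by
    obtain ⟨G, hG, hGb⟩ := hb 1 one_pos
    refine integrable_of_ae_tendsto_of_integral_le hf hlim hg hM hG fun n => ?_
    simpa using hGb n
  have hfi : ∀ n, Integrable (f n) μ := fun n => by
    obtain ⟨G, hG, hGb⟩ := hb 1 one_pos
    exact (((hg n).const_mul 1).add hG).mono' (hf n) (hGb n)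
  refine ⟨hF, ?_⟩
  rw [Metric.tendsto_atTop]
  intro δ hδ
  -- Chosen so that ε(|M| + 1) = δ/2. The part of |f n - F| exceeding ε g n is dominated by |G| +
  -- |F| and tends to 0; the rest has integral at most δ/2.
  set ε : ℝ := δ / (2 * (|M| + 1)) with hε
  have hε0 : 0 < ε := by positivity
  obtain ⟨G, hG, hGb⟩ := hb ε hε0
  have hhi : ∀ n, Integrable (fun x => max (|f n x - F x| - ε * g n x) 0) μ := fun n =>
    (((hfi n).sub hF).abs.sub ((hg n).const_mul ε)).sup (integrable_zero _ _ _)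
  have hh : Tendsto (fun n => ∫ x, max (|f n x - F x| - ε * g n x) 0 ∂μ) atTop
      (𝓝 (∫ _, (0 : ℝ) ∂μ)) := by
    refine tendsto_integral_of_dominated_convergence (fun x => |G x| + |F x|)
      (fun n => (hhi n).aestronglyMeasurable) (hG.abs.add hF.abs) (fun n => ?_) ?_
    · filter_upwards [hGb n] with x hx
      rw [Real.norm_eq_abs, abs_of_nonneg (le_max_right _ _)]
      refine max_le ?_ (by positivity)
      have := abs_sub (f n x) (F x)
      have := le_abs_self (G x)
      linarith
    · filter_upwards [hlim, ae_all_iff.2 hg0] with x hx hx2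
      have h0 : Tendsto (fun n => |f n x - F x|) atTop (𝓝 0) := by
        simpa using (hx.sub_const (F x)).abs
      refine squeeze_zero (fun n => le_max_right _ _) (fun n => ?_) h0
      exact max_le (by nlinarith [hx2 n, mul_nonneg hε0.le (hx2 n)]) (abs_nonneg _)
  rw [integral_zero] at hh
  obtain ⟨n₀, hn₀⟩ := (Metric.tendsto_atTop.1 hh) (δ / 2) (by positivity)
  refine ⟨n₀, fun n hn => ?_⟩
  have h1 := hn₀ n hn
  rw [Real.dist_eq, sub_zero] at h1
  have h2 := (le_abs_self _).trans_lt h1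
  rw [Real.dist_eq, ← integral_sub (hfi n) hF]
  calc |∫ x, f n x - F x ∂μ| ≤ ∫ x, |f n x - F x| ∂μ := abs_integral_le_integral_abs
    _ ≤ ∫ x, ε * g n x + max (|f n x - F x| - ε * g n x) 0 ∂μ := by
        refine integral_mono ((hfi n).sub hF).abs (((hg n).const_mul ε).add (hhi n)) fun x => ?_
        have := le_max_left (|f n x - F x| - ε * g n x) 0
        simp only at this ⊢
        linarith
    _ = ε * ∫ x, g n x ∂μ + ∫ x, max (|f n x - F x| - ε * g n x) 0 ∂μ := by
        rw [integral_add ((hg n).const_mul ε) (hhi n), integral_const_mul]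
    _ < ε * (|M| + 1) + δ / 2 := by
        refine add_lt_add_of_le_of_lt ?_ h2
        refine mul_le_mul_of_nonneg_left ?_ hε0.le
        linarith [hM n, le_abs_self M]
    _ = δ := by rw [hε]; field_simp; ring

/-- Fatou's lemma for real integrals. -/
theorem integral_le_of_ae_tendsto {f : ℕ → α → ℝ} {F : α → ℝ} {c : ℕ → ℝ} {L : ℝ}
    (hf : ∀ n, Integrable (f n) μ) (hf0 : ∀ n, ∀ᵐ x ∂μ, 0 ≤ f n x)
    (hlim : ∀ᵐ x ∂μ, Tendsto (fun n => f n x) atTop (𝓝 (F x)))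
    (hc : ∀ n, ∫ x, f n x ∂μ ≤ c n) (hL : Tendsto c atTop (𝓝 L)) :
    Integrable F μ ∧ ∫ x, F x ∂μ ≤ L := by
  obtain ⟨M, hM⟩ := hL.bddAbove_range
  have hF : Integrable F μ := by
    refine integrable_of_ae_tendsto_of_integral_le (fun n => (hf n).aestronglyMeasurable) hlim hf
      (M := M) (fun n => (hc n).trans (hM ⟨n, rfl⟩)) (integrable_zero _ _ _) fun n => ?_
    filter_upwards [hf0 n] with x hx
    simp [abs_of_nonneg hx]
  refine ⟨hF, ?_⟩
  have hF0 : 0 ≤ᵐ[μ] F := by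
    filter_upwards [hlim, ae_all_iff.2 hf0] with x hx hx2
    exact ge_of_tendsto' hx hx2
  have hL0 : 0 ≤ L := ge_of_tendsto' hL fun n => (integral_nonneg_of_ae (hf0 n)).trans (hc n)
  rw [← ENNReal.ofReal_le_ofReal_iff hL0, ofReal_integral_eq_lintegral_ofReal hF hF0]
  calc ∫⁻ x, ENNReal.ofReal (F x) ∂μ
      = ∫⁻ x, liminf (fun n => ENNReal.ofReal (f n x)) atTop ∂μ := by
        refine lintegral_congr_ae ?_
        filter_upwards [hlim] with x hx
        exact ((ENNReal.tendsto_ofReal hx).liminf_eq).symm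
    _ ≤ liminf (fun n => ∫⁻ x, ENNReal.ofReal (f n x) ∂μ) atTop :=
        lintegral_liminf_le' fun n => (hf n).aestronglyMeasurable.aemeasurable.ennreal_ofReal
    _ ≤ liminf (fun n => ENNReal.ofReal (c n)) atTop := by
        refine liminf_le_liminf (Eventually.of_forall fun n => ?_)
        rw [← ofReal_integral_eq_lintegral_ofReal (hf n) (hf0 n)]
        exact ENNReal.ofReal_le_ofReal (hc n)
    _ = ENNReal.ofReal L := (ENNReal.tendsto_ofReal hL).liminf_eq

/-- If `|f n| ≤ ε g n + C r n` with `∫ g n` bounded and `∫ r n → 0`, then `∫ f n → 0`. -/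
theorem tendsto_integral_zero_of_forall_eps {f g r : ℕ → α → ℝ} {M : ℝ}
    (hg : ∀ n, Integrable (g n) μ) (hM : ∀ n, ∫ x, g n x ∂μ ≤ M)
    (hr : ∀ n, Integrable (r n) μ) (hr0 : Tendsto (fun n => ∫ x, r n x ∂μ) atTop (𝓝 0))
    (hb : ∀ ε : ℝ, 0 < ε → ∃ C : ℝ, ∀ n, ∀ᵐ x ∂μ, |f n x| ≤ ε * g n x + C * r n x) :
    Tendsto (fun n => ∫ x, f n x ∂μ) atTop (𝓝 0) := by
  rw [Metric.tendsto_atTop]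
  intro δ hδ
  set ε : ℝ := δ / (2 * (|M| + 1)) with hε
  have hε0 : 0 < ε := by positivity
  obtain ⟨C, hC⟩ := hb ε hε0
  have hCr : Tendsto (fun n => C * ∫ x, r n x ∂μ) atTop (𝓝 0) := by
    simpa using hr0.const_mul C
  obtain ⟨n₀, hn₀⟩ := (Metric.tendsto_atTop.1 hCr) (δ / 2) (by positivity)
  refine ⟨n₀, fun n hn => ?_⟩
  have h1 := hn₀ n hn
  rw [Real.dist_eq, sub_zero] at h1
  have h2 := (le_abs_self _).trans_lt h1
  rw [Real.dist_eq, sub_zero]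
  calc |∫ x, f n x ∂μ| ≤ ∫ x, ε * g n x + C * r n x ∂μ :=
        norm_integral_le_of_norm_le (f := f n)
          (((hg n).const_mul ε).add ((hr n).const_mul C)) (hC n)
    _ = ε * ∫ x, g n x ∂μ + C * ∫ x, r n x ∂μ := by
        rw [integral_add ((hg n).const_mul ε) ((hr n).const_mul C), integral_const_mul,
          integral_const_mul]
    _ < ε * (|M| + 1) + δ / 2 := by
        refine add_lt_add_of_le_of_lt ?_ h2
        refine mul_le_mul_of_nonneg_left ?_ hε0.le
        linarith [hM n, le_abs_self M]
    _ = δ := by rw [hε]; field_simp; ring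

end Convergence

/-! ### Elementary inequalities for powers. -/

/-- Young's inequality with a small weight on the higher power. -/
theorem exists_rpow_mul_le {a p ε : ℝ} (ha : 0 < a) (hap : a < p) (hε : 0 < ε) :
    ∃ C : ℝ, 0 ≤ C ∧ ∀ x z : ℝ, 0 ≤ x → 0 ≤ z →
      x ^ a * z ≤ ε * x ^ p + C * z ^ (p / (p - a)) := by
  have hpa : 0 < p - a := by linarith
  refine ⟨(ε⁻¹) ^ (a / (p - a)), by positivity, fun x z hx hz => ?_⟩
  -- If z ≤ ε x^(p-a), the first term alone suffices. Otherwise x is bounded by a power of z/ε, and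
  -- the second term suffices, which dictates the constant.
  rcases le_total z (ε * x ^ (p - a)) with h | h
  · have h1 : x ^ a * z ≤ x ^ a * (ε * x ^ (p - a)) := by gcongr
    have h2 : x ^ a * x ^ (p - a) = x ^ p := by
      rw [← Real.rpow_add_of_nonneg hx ha.le hpa.le]; ring_nf
    have h3 : 0 ≤ (ε⁻¹) ^ (a / (p - a)) * z ^ (p / (p - a)) := by positivity
    nlinarith
  · have h0 : x ^ (p - a) ≤ ε⁻¹ * z := by
      rw [inv_mul_eq_div, le_div_iff₀ hε]; linarith
    have h1 : x ^ a ≤ (ε⁻¹ * z) ^ (a / (p - a)) := by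
      calc x ^ a = (x ^ (p - a)) ^ (a / (p - a)) := by
            rw [← Real.rpow_mul hx]; congr 1; field_simp
        _ ≤ _ := Real.rpow_le_rpow (by positivity) h0 (by positivity)
    have h2 : x ^ a * z ≤ (ε⁻¹) ^ (a / (p - a)) * z ^ (p / (p - a)) := by
      calc x ^ a * z ≤ (ε⁻¹ * z) ^ (a / (p - a)) * z := by gcongr
        _ = (ε⁻¹) ^ (a / (p - a)) * (z ^ (a / (p - a)) * z ^ (1 : ℝ)) := by
            rw [Real.mul_rpow (by positivity) hz, Real.rpow_one]; ring
        _ = _ := by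
            rw [← Real.rpow_add_of_nonneg hz (by positivity) zero_le_one]
            congr 2; field_simp; ring
    have h3 : 0 ≤ ε * x ^ p := by positivity
    linarith

/-- Mean value inequality for |x|^p on [-R, R] with R = |a| + |b|, an interval containing both a and
a + b. -/
theorem abs_abs_rpow_sub_abs_rpow_le {p : ℝ} (hp : 1 < p) (a b : ℝ) :
    |(|a + b| ^ p - |a| ^ p)| ≤ p * (|a| + |b|) ^ (p - 1) * |b| := by
  set R := |a| + |b| with hR
  have h := Convex.norm_image_sub_le_of_norm_hasDerivWithin_le (f := fun x : ℝ => |x| ^ p)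
    (f' := fun x => p * |x| ^ (p - 2) * x) (s := Set.Icc (-R) R) (C := p * R ^ (p - 1))
    (x := a) (y := a + b)
    (fun x _ => (hasDerivAt_abs_rpow x hp).hasDerivWithinAt) (fun x hx => ?_) (convex_Icc _ _)
    (abs_le.1 (by rw [hR]; linarith [abs_nonneg b])) (abs_le.1 (abs_add_le a b))
  · simpa using h
  · have hx' : |x| ≤ R := abs_le.2 hx
    rcases eq_or_ne x 0 with rfl | h0
    · have : 0 ≤ R := by positivity
      simp only [mul_zero, norm_zero]; positivity
    · have hx0 : 0 < |x| := abs_pos.2 h0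
      rw [Real.norm_eq_abs, abs_mul, abs_mul, abs_of_pos (by linarith : 0 < p), mul_assoc,
        abs_of_nonneg (by positivity : 0 ≤ |x| ^ (p - 2))]
      have : |x| ^ (p - 2) * |x| = |x| ^ (p - 1) := by
        rw [← Real.rpow_add_one hx0.ne']; ring_nf
      rw [this]
      have := Real.rpow_le_rpow hx0.le hx' (by linarith : 0 ≤ p - 1)
      gcongr

theorem add_rpow_le_two_rpow_mul {p x y : ℝ} (hp : 0 ≤ p) (hx : 0 ≤ x) (hy : 0 ≤ y) :
    (x + y) ^ p ≤ 2 ^ p * (x ^ p + y ^ p) := by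
  have h1 : (x + y) ^ p ≤ (2 * max x y) ^ p := by
    refine Real.rpow_le_rpow (by positivity) ?_ hp
    linarith [le_max_left x y, le_max_right x y]
  rw [Real.mul_rpow (by norm_num) (by positivity)] at h1
  refine h1.trans ?_
  have hx' : 0 ≤ x ^ p := by positivity
  have hy' : 0 ≤ y ^ p := by positivity
  rcases le_total x y with h | h
  · rw [max_eq_right h]; gcongr; linarith
  · rw [max_eq_left h]; gcongr; linarith

/-- The elementary inequality behind the Brezis-Lieb lemma. -/
theorem exists_abs_rpow_sub_le {p ε : ℝ} (hp : 1 < p) (hε : 0 < ε) :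
    ∃ C : ℝ, 0 ≤ C ∧ ∀ a b : ℝ, |(|a + b| ^ p - |a| ^ p)| ≤ ε * |a| ^ p + C * |b| ^ p := by
  have hc : 0 < p * 2 ^ (p - 1) := by positivity
  -- Young for |a|^(p-1)|b|, whose dual exponent is p; the small weight is divided by the prefactor
  -- p 2^(p-1) that reappears at the end.
  obtain ⟨C, hC0, hC⟩ := exists_rpow_mul_le (a := p - 1) (p := p) (by linarith) (by linarith)
    (div_pos hε hc)
  refine ⟨p * 2 ^ (p - 1) * (C + 1), by positivity, fun a b => ?_⟩
  refine (abs_abs_rpow_sub_abs_rpow_le hp a b).trans ?_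
  have h1 := add_rpow_le_two_rpow_mul (p := p - 1) (by linarith) (abs_nonneg a) (abs_nonneg b)
  have h2 := hC |a| |b| (abs_nonneg a) (abs_nonneg b)
  rw [show p / (p - (p - 1)) = p by ring_nf] at h2
  have h3 : |b| ^ (p - 1) * |b| = |b| ^ p := by
    conv_lhs => rw [← Real.rpow_one |b|, ← Real.rpow_mul (abs_nonneg b)]
    rw [← Real.rpow_add_of_nonneg (abs_nonneg b) (by linarith) zero_le_one]
    ring_nf
  calc p * (|a| + |b|) ^ (p - 1) * |b|
      ≤ p * (2 ^ (p - 1) * (|a| ^ (p - 1) + |b| ^ (p - 1))) * |b| := by gcongr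
    _ = p * 2 ^ (p - 1) * (|a| ^ (p - 1) * |b| + |b| ^ (p - 1) * |b|) := by ring
    _ ≤ p * 2 ^ (p - 1) * (ε / (p * 2 ^ (p - 1)) * |a| ^ p + C * |b| ^ p + |b| ^ p) := by
        rw [h3]; gcongr
    _ = _ := by field_simp; ring

/-! ### Compactly supported Lipschitz functions. -/

variable {N : ℕ}

/-- Compactly supported Lipschitz functions. -/
structure IsLipC (u : EuclideanSpace ℝ (Fin N) → ℝ) : Prop where
  lip : ∃ C, LipschitzWith C u
  compact : HasCompactSupport u

theorem measurable_gradient (u : EuclideanSpace ℝ (Fin N) → ℝ) : Measurable (gradient u) :=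
  ((InnerProductSpace.toDual ℝ _).symm.continuous.measurable).comp (measurable_fderiv ℝ u)

theorem norm_gradient (u : EuclideanSpace ℝ (Fin N) → ℝ) (x) :
    ‖gradient u x‖ = ‖fderiv ℝ u x‖ := by
  simp [gradient]

theorem gradient_apply (u : EuclideanSpace ℝ (Fin N) → ℝ) (x) (i : Fin N) :
    gradient u x i = fderiv ℝ u x (EuclideanSpace.single i 1) := by
  have h : fderiv ℝ u x = InnerProductSpace.toDual ℝ _ (gradient u x) := by simp [gradient]
  have h2 := congrArg (fun f => f (EuclideanSpace.single i 1)) h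
  simp only [InnerProductSpace.toDual_apply_apply, EuclideanSpace.inner_single_right] at h2
  simpa using h2.symm

theorem gradient_eq_zero_of_notMem {u : EuclideanSpace ℝ (Fin N) → ℝ} {x}
    (hx : x ∉ tsupport u) : gradient u x = 0 := by
  have : fderiv ℝ u x = 0 := by
    by_contra h
    exact hx (support_fderiv_subset ℝ h)
  simp [gradient, this]

theorem ae_differentiableAt {u : EuclideanSpace ℝ (Fin N) → ℝ} (h : ∃ C, LipschitzWith C u) :
    ∀ᵐ x, DifferentiableAt ℝ u x := by
  obtain ⟨C, hC⟩ := h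
  exact hC.ae_differentiableAt

theorem IsTestFunction.isLipC {φ : EuclideanSpace ℝ (Fin N) → ℝ} (h : IsTestFunction φ) :
    IsLipC φ :=
  ⟨ContDiff.lipschitzWith_of_hasCompactSupport h.2 h.1 (by simp), h.2⟩

/-- The product of a bounded function with a continuous function, vanishing at `0`, of a bounded
measurable map with compact support is integrable. -/
theorem integrable_mul_comp {V : Type*} [NormedAddCommGroup V] [ProperSpace V] [MeasurableSpace V]
    [BorelSpace V] [SecondCountableTopology V] {k : EuclideanSpace ℝ (Fin N) → ℝ}
    (hk : MemLp k ⊤ volume)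
    {v : EuclideanSpace ℝ (Fin N) → V} (hv : Measurable v) {R : ℝ} (hR : ∀ x, ‖v x‖ ≤ R)
    {K : Set (EuclideanSpace ℝ (Fin N))} (hK : IsCompact K) (h0 : ∀ x ∉ K, v x = 0)
    {F : V → ℝ} (hF : Continuous F) (hF0 : F 0 = 0) :
    Integrable (fun x => k x * F (v x)) volume := by
  obtain ⟨C, hC⟩ := (isCompact_closedBall (0 : V) R).exists_bound_of_continuousOn hF.continuousOn
  have h1 : Integrable (fun x => F (v x)) volume := by
    have : IntegrableOn (fun x => F (v x)) K volume := by
      refine Measure.integrableOn_of_bounded (M := C) hK.measure_lt_top.ne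
        (hF.measurable.comp hv).aestronglyMeasurable ?_
      exact Eventually.of_forall fun x => hC _ (by simpa using hR x)
    refine this.integrable_of_forall_notMem_eq_zero fun x hx => ?_
    rw [h0 x hx, hF0]
  exact h1.smul_of_top_right hk

/-- The square roots are moduli of complex numbers, so this is the reverse triangle inequality. -/
theorem abs_sqrt_add_sq_sub_le (a b c d : ℝ) :
    |√(a ^ 2 + b ^ 2) - √(c ^ 2 + d ^ 2)| ≤ |a - c| + |b - d| := by
  have h : ∀ x y : ℝ, √(x ^ 2 + y ^ 2) = ‖(⟨x, y⟩ : ℂ)‖ := fun x y => by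
    rw [Complex.norm_def, Complex.normSq_mk]; ring_nf
  rw [h, h]
  refine (abs_norm_sub_norm_le _ _).trans ((Complex.norm_le_abs_re_add_abs_im _).trans ?_)
  simp

theorem abs_sqrt_sub_sqrt_le (a b c d : ℝ) :
    |√((a ^ 2 + b ^ 2) / 2) - √((c ^ 2 + d ^ 2) / 2)| ≤ |a - c| + |b - d| := by
  rw [Real.sqrt_div (by positivity), Real.sqrt_div (by positivity), ← sub_div, abs_div,
    abs_of_pos (by positivity : 0 < √(2 : ℝ))]
  refine (div_le_self (abs_nonneg _) ?_).trans (abs_sqrt_add_sq_sub_le a b c d)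
  exact Real.one_le_sqrt.2 (by norm_num)

namespace IsLipC

variable {u φ : EuclideanSpace ℝ (Fin N) → ℝ}

theorem continuous (hu : IsLipC u) : Continuous u := hu.lip.choose_spec.continuous

theorem exists_bound (hu : IsLipC u) : ∃ M : ℝ, 0 ≤ M ∧ ∀ x, |u x| ≤ M := by
  obtain ⟨M, hM⟩ := hu.compact.exists_bound_of_continuous hu.continuous
  exact ⟨M, (norm_nonneg _).trans (hM 0), hM⟩

theorem exists_gradient_bound (hu : IsLipC u) : ∃ M : ℝ, 0 ≤ M ∧ ∀ x, ‖gradient u x‖ ≤ M := by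
  obtain ⟨C, hC⟩ := hu.lip
  refine ⟨C, C.2, fun x => ?_⟩
  rw [norm_gradient]
  exact norm_fderiv_le_of_lipschitz ℝ hC

/-- All four arguments are bounded and vanish outside a compact set, so the composition with F is
bounded with compact support. This one statement supplies the integrability of nearly every
integrand built from Lipschitz functions. -/
theorem integrable_mul_comp (hu : IsLipC u) (hφ : IsLipC φ)
    {k : EuclideanSpace ℝ (Fin N) → ℝ} (hk : MemLp k ⊤ volume)
    {F : ℝ → EuclideanSpace ℝ (Fin N) → ℝ → EuclideanSpace ℝ (Fin N) → ℝ}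
    (hF : Continuous fun p : ℝ × EuclideanSpace ℝ (Fin N) × ℝ × EuclideanSpace ℝ (Fin N) =>
      F p.1 p.2.1 p.2.2.1 p.2.2.2) (hF0 : F 0 0 0 0 = 0) :
    Integrable (fun x => k x * F (u x) (gradient u x) (φ x) (gradient φ x)) volume := by
  obtain ⟨A, hA0, hA⟩ := hu.exists_bound
  obtain ⟨B, hB0, hB⟩ := hu.exists_gradient_bound
  obtain ⟨C, hC0, hC⟩ := hφ.exists_bound
  obtain ⟨D, hD0, hD⟩ := hφ.exists_gradient_bound
  refine QuasilinearSchrodinger.integrable_mul_comp hk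
    (v := fun x => (u x, gradient u x, φ x, gradient φ x)) (R := A + B + C + D)
    (K := tsupport u ∪ tsupport φ) ?_ (fun x => ?_) (IsCompact.union hu.compact hφ.compact)
    (fun x hx => ?_) hF hF0
  · exact hu.continuous.measurable.prodMk ((measurable_gradient u).prodMk
      (hφ.continuous.measurable.prodMk (measurable_gradient φ)))
  · have h1 := hA x
    have h2 := hB x
    have h3 := hC x
    have h4 := hD x
    simp only [Prod.norm_mk, Real.norm_eq_abs, sup_le_iff]
    refine ⟨by linarith, by linarith, by linarith, by linarith⟩
  · rw [Set.mem_union, not_or] at hx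
    simp [image_eq_zero_of_notMem_tsupport hx.1, image_eq_zero_of_notMem_tsupport hx.2,
      gradient_eq_zero_of_notMem hx.1, gradient_eq_zero_of_notMem hx.2]

theorem integrable_comp (hu : IsLipC u) (hφ : IsLipC φ)
    {F : ℝ → EuclideanSpace ℝ (Fin N) → ℝ → EuclideanSpace ℝ (Fin N) → ℝ}
    (hF : Continuous fun p : ℝ × EuclideanSpace ℝ (Fin N) × ℝ × EuclideanSpace ℝ (Fin N) =>
      F p.1 p.2.1 p.2.2.1 p.2.2.2) (hF0 : F 0 0 0 0 = 0) :
    Integrable (fun x => F (u x) (gradient u x) (φ x) (gradient φ x)) volume := by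
  simpa using hu.integrable_mul_comp hφ (memLp_top_const (1 : ℝ)) hF hF0

theorem add_const_mul (hu : IsLipC u) (hφ : IsLipC φ) (t : ℝ) :
    IsLipC fun x => u x + t * φ x := by
  obtain ⟨A, hA⟩ := hu.lip
  obtain ⟨B, hB⟩ := hφ.lip
  refine ⟨⟨A + ‖t‖₊ * B, hA.add ?_⟩, hu.compact.add (hφ.compact.mul_left (f := fun _ => t))⟩
  exact (lipschitzWith_smul t).comp hB

theorem sq (hu : IsLipC u) : IsLipC fun x => u x ^ 2 := by
  obtain ⟨A, hA⟩ := hu.lip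
  obtain ⟨M, hM0, hM⟩ := hu.exists_bound
  refine ⟨⟨(2 * M).toNNReal * A, LipschitzWith.of_dist_le_mul fun x y => ?_⟩,
    hu.compact.comp_left (g := fun t : ℝ => t ^ 2) (by simp)⟩
  have h1 := hA.dist_le_mul x y
  rw [Real.dist_eq] at h1 ⊢
  have h2 : |u x + u y| ≤ 2 * M := (abs_add_le _ _).trans (by linarith [hM x, hM y])
  rw [sq_sub_sq, abs_mul, NNReal.coe_mul, Real.coe_toNNReal _ (by positivity), mul_assoc]
  gcongr

/-- The midpoint in the variable u² stays in the class; this lets the infimum be compared with the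
energy of the midpoint. -/
theorem sqrt_add_sq_div_two {v : EuclideanSpace ℝ (Fin N) → ℝ} (hu : IsLipC u) (hv : IsLipC v) :
    IsLipC fun x => √((u x ^ 2 + v x ^ 2) / 2) := by
  obtain ⟨A, hA⟩ := hu.lip
  obtain ⟨B, hB⟩ := hv.lip
  refine ⟨⟨A + B, LipschitzWith.of_dist_le_mul fun x y => ?_⟩, ?_⟩
  · refine (abs_sqrt_sub_sqrt_le _ _ _ _).trans ?_
    have h1 := hA.dist_le_mul x y
    have h2 := hB.dist_le_mul x y
    rw [Real.dist_eq] at h1 h2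
    push_cast
    linarith
  · refine (hu.compact.comp_left (g := fun t : ℝ => |t|) (by simp)).add
      (hv.compact.comp_left (g := fun t : ℝ => |t|) (by simp)) |>.mono fun x hx => ?_
    rw [Function.mem_support] at hx ⊢
    contrapose! hx
    have h1 : |u x| + |v x| = 0 := hx
    have h2 : u x = 0 := abs_eq_zero.1 (by linarith [abs_nonneg (u x), abs_nonneg (v x)])
    have h3 : v x = 0 := abs_eq_zero.1 (by linarith [abs_nonneg (u x), abs_nonneg (v x)])
    simp [h2, h3]

end IsLipC

/-- By Rademacher's theorem the classical gradient exists almost everywhere, and integration by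
parts for line derivatives of Lipschitz functions identifies it as the weak gradient. -/
theorem hasWeakGradient_of_lipschitz {u : EuclideanSpace ℝ (Fin N) → ℝ}
    (hu : ∃ C, LipschitzWith C u) : HasWeakGradient u (gradient u) := by
  have hd := ae_differentiableAt hu
  obtain ⟨C, hC⟩ := hu
  refine ⟨hC.continuous.locallyIntegrable, ?_, fun φ hφ i => ?_⟩
  · refine (locallyIntegrable_const (C : ℝ)).mono (measurable_gradient u).aestronglyMeasurable
      (Eventually.of_forall fun x => ?_)
    rw [norm_gradient]
    exact (norm_fderiv_le_of_lipschitz ℝ hC).trans (by simp)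
  · obtain ⟨D, hD⟩ := hφ.isLipC.lip
    have h := hC.integral_lineDeriv_mul_eq (μ := volume) hD hφ.2 (EuclideanSpace.single i 1)
    have h1 : ∫ x, lineDeriv ℝ u x (EuclideanSpace.single i 1) * φ x
        = ∫ x, gradient u x i * φ x := by
      refine integral_congr_ae ?_
      filter_upwards [hd] with x hx
      rw [hx.lineDeriv_eq_fderiv, gradient_apply]
    rw [← h1, h, ← integral_neg]
    congr 1 with x
    rw [((hφ.1.differentiable (by simp)) x).lineDeriv_eq_fderiv, map_neg]
    ring

/-! ### Mollification and the Sobolev inequality for Lipschitz functions. -/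

section Mollification

open scoped Convolution

variable {u : EuclideanSpace ℝ (Fin N) → ℝ}

/-- Standard bump functions with radii tending to `0`. -/
def mollifier (N n : ℕ) : ContDiffBump (0 : EuclideanSpace ℝ (Fin N)) where
  rIn := 1 / (2 * ((n : ℝ) + 1))
  rOut := 1 / ((n : ℝ) + 1)
  rIn_pos := by positivity
  rIn_lt_rOut := by
    apply one_div_lt_one_div_of_lt <;> linarith [(n.cast_nonneg : (0 : ℝ) ≤ n)]

theorem mollifier_rOut_le_one (N n : ℕ) : (mollifier N n).rOut ≤ 1 := by
  change 1 / ((n : ℝ) + 1) ≤ 1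
  rw [div_le_one (by positivity)]
  linarith [(n.cast_nonneg : (0 : ℝ) ≤ n)]

/-- Convergence holds at Lebesgue points because the ratio of the outer to the inner radius stays
equal to 2. -/
theorem ae_tendsto_mollifier_convolution {F : Type*} [NormedAddCommGroup F] [NormedSpace ℝ F]
    [CompleteSpace F] {g : EuclideanSpace ℝ (Fin N) → F} (hg : LocallyIntegrable g volume) :
    ∀ᵐ x, Tendsto (fun n => ((mollifier N n).normed volume ⋆[ContinuousLinearMap.lsmul ℝ ℝ, volume]
      g) x) atTop (𝓝 (g x)) := by
  refine ContDiffBump.ae_convolution_tendsto_right_of_locallyIntegrable (K := 2) ?_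
    (Eventually.of_forall fun n => ?_) hg
  · exact tendsto_one_div_add_atTop_nhds_zero_nat
  · change 1 / ((n : ℝ) + 1) ≤ 2 * (1 / (2 * ((n : ℝ) + 1)))
    apply le_of_eq; field_simp

/-- The mollifications of `u`. -/
def mollify (u : EuclideanSpace ℝ (Fin N) → ℝ) (n : ℕ) : EuclideanSpace ℝ (Fin N) → ℝ :=
  (mollifier N n).normed volume ⋆[ContinuousLinearMap.lsmul ℝ ℝ, volume] u

theorem contDiff_mollify (hu : Continuous u) (n : ℕ) : ContDiff ℝ 1 (mollify u n) :=
  (mollifier N n).hasCompactSupport_normed.contDiff_convolution_left _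
    ((mollifier N n).contDiff_normed (n := 1)) hu.locallyIntegrable

theorem integrable_normed_smul (n : ℕ) {F : Type*} [NormedAddCommGroup F] [NormedSpace ℝ F]
    {g : EuclideanSpace ℝ (Fin N) → F} (hg : LocallyIntegrable g volume) :
    Integrable (fun t => (mollifier N n).normed volume t • g t) volume := by
  exact hg.integrable_smul_left_of_hasCompactSupport (mollifier N n).continuous_normed
    (mollifier N n).hasCompactSupport_normed

theorem locallyIntegrable_fderiv {C : ℝ≥0} (hu : LipschitzWith C u) :
    LocallyIntegrable (fderiv ℝ u) volume := by
  refine (locallyIntegrable_const (C : ℝ)).mono (measurable_fderiv ℝ u).aestronglyMeasurable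
      (Eventually.of_forall fun x => ?_)
  exact (norm_fderiv_le_of_lipschitz ℝ hu).trans (by simp)

theorem locallyIntegrable_comp_sub_left {F : Type*} [NormedAddCommGroup F]
    {g : EuclideanSpace ℝ (Fin N) → F} {C : ℝ} (hg : StronglyMeasurable g) (hC : ∀ x, ‖g x‖ ≤ C) (x) :
    LocallyIntegrable (fun t => g (x - t)) volume := by
  refine (locallyIntegrable_const C).mono
    (hg.comp_measurable (measurable_const.sub measurable_id)).aestronglyMeasurable
    (Eventually.of_forall fun t => (hC _).trans (le_abs_self _))

/-- Averaging does not increase the Lipschitz constant. The bound is uniform in n and serves as the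
dominating function for the gradients of the mollifications. -/
theorem norm_mollify_sub_le {C : ℝ≥0} (hu : LipschitzWith C u) (n : ℕ) (x y) :
    ‖mollify u n x - mollify u n y‖ ≤ C * ‖x - y‖ := by
  have hi : ∀ x, Integrable (fun t => (mollifier N n).normed volume t • u (x - t)) volume :=
    fun x => integrable_normed_smul n (hu.continuous.comp (by fun_prop)).locallyIntegrable
  unfold mollify
  simp only [convolution_def, ContinuousLinearMap.lsmul_apply]
  rw [← integral_sub (hi x) (hi y)]
  calc ‖∫ t, (mollifier N n).normed volume t • u (x - t) - (mollifier N n).normed volume t • u (y - t)‖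
      ≤ ∫ t, (mollifier N n).normed volume t * (C * ‖x - y‖) := by
        refine norm_integral_le_of_norm_le ((mollifier N n).integrable_normed.mul_const _)
          (Eventually.of_forall fun t => ?_)
        rw [← smul_sub, norm_smul, Real.norm_of_nonneg ((mollifier N n).nonneg_normed t)]
        refine mul_le_mul_of_nonneg_left ?_ ((mollifier N n).nonneg_normed t)
        simpa using hu.norm_sub_le (x - t) (y - t)
    _ = C * ‖x - y‖ := by
        rw [integral_mul_const, (mollifier N n).integral_normed, one_mul]

/-- The derivative is put on u, not on the kernel, so that a.e. convergence of mollifications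
applies to it. Differentiation under the integral uses the Lipschitz bound and, for a.e. t,
differentiability of u at x - t. -/
theorem fderiv_mollify {C : ℝ≥0} (hu : LipschitzWith C u) (n : ℕ) (x) :
    fderiv ℝ (mollify u n) x =
      ((mollifier N n).normed volume ⋆[ContinuousLinearMap.lsmul ℝ ℝ, volume] fderiv ℝ u) x := by
  have hd : ∀ᵐ t, DifferentiableAt ℝ u (x - t) :=
    (Measure.measurePreserving_sub_left volume x).quasiMeasurePreserving.ae hu.ae_differentiableAt
  have hi : ∀ x, Integrable (fun t => (mollifier N n).normed volume t • u (x - t)) volume :=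
    fun x => integrable_normed_smul n (hu.continuous.comp (by fun_prop)).locallyIntegrable
  have h := hasFDerivAt_integral_of_dominated_loc_of_lip' (μ := volume) (x₀ := x)
    (F := fun y t => (mollifier N n).normed volume t • u (y - t))
    (F' := fun t => (mollifier N n).normed volume t • fderiv ℝ u (x - t)) (s := Set.univ)
    (bound := fun t => (mollifier N n).normed volume t * C)
    univ_mem (fun y _ => (hi y).aestronglyMeasurable) (hi x)
    (integrable_normed_smul n (locallyIntegrable_comp_sub_left
      (measurable_fderiv ℝ u).stronglyMeasurable
      (fun x => norm_fderiv_le_of_lipschitz ℝ hu) x)).aestronglyMeasurable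
    (Eventually.of_forall fun t y _ => ?_)
    ((mollifier N n).integrable_normed.mul_const _) ?_
  · exact h.2.fderiv
  · rw [← smul_sub, norm_smul, Real.norm_of_nonneg ((mollifier N n).nonneg_normed t), mul_assoc]
    refine mul_le_mul_of_nonneg_left ?_ ((mollifier N n).nonneg_normed t)
    simpa using hu.norm_sub_le (y - t) (x - t)
  · filter_upwards [hd] with t ht
    have h2 : HasFDerivAt (fun y => u (y - t)) (fderiv ℝ u (x - t)) x := by
      have := ht.hasFDerivAt.comp x ((hasFDerivAt_id x).sub_const t)
      rwa [ContinuousLinearMap.comp_id] at this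
    exact h2.const_smul ((mollifier N n).normed volume t)

theorem support_mollify_subset (n : ℕ) :
    Function.support (mollify u n) ⊆ Metric.cthickening 1 (tsupport u) := by
  intro x hx
  obtain ⟨a, ha, b, hb, rfl⟩ := support_convolution_subset _ hx
  rw [ContDiffBump.support_normed_eq, mem_ball_zero_iff] at ha
  refine Metric.mem_cthickening_of_dist_le _ b _ _ (subset_tsupport _ hb) ?_
  simpa [dist_eq_norm] using ha.le.trans (mollifier_rOut_le_one N n)

end Mollification

/-- The Sobolev inequality for compactly supported Lipschitz functions. -/
theorem exists_sobolev_const (hN : 3 ≤ N) : ∃ S : ℝ≥0,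
    ∀ u : EuclideanSpace ℝ (Fin N) → ℝ, IsLipC u →
      eLpNorm u (ENNReal.ofReal (critExp N)) volume ≤ S * eLpNorm (gradient u) 2 volume := by
  refine ⟨SNormLESNormFDerivOfEqConst ℝ (volume : Measure (EuclideanSpace ℝ (Fin N))) 2, fun u hu => ?_⟩
  obtain ⟨C, hC⟩ := hu.lip
  set K := Metric.cthickening 1 (tsupport u)
  have hK : IsCompact K := IsCompact.cthickening hu.compact
  have hKs : ∀ n, tsupport (mollify u n) ⊆ K := fun n =>
    closure_minimal (support_mollify_subset n) Metric.isClosed_cthickening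
  have hN' : (3 : ℝ) ≤ N := by exact_mod_cast hN
  have hsob : ∀ n, eLpNorm (mollify u n) (ENNReal.ofReal (critExp N)) volume
      ≤ SNormLESNormFDerivOfEqConst ℝ (volume : Measure (EuclideanSpace ℝ (Fin N))) 2 *
        eLpNorm (fderiv ℝ (mollify u n)) 2 volume := by
    intro n
    refine eLpNorm_le_eLpNorm_fderiv_of_eq (p := 2) (p' := (critExp N).toNNReal) volume
      (contDiff_mollify hC.continuous n)
      (hK.of_isClosed_subset (isClosed_tsupport _) (hKs n)) (by norm_num) ?_ ?_
    · rw [finrank_euclideanSpace_fin]; omega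
    · have h0 : 0 < (N : ℝ) - 2 := by linarith
      rw [finrank_euclideanSpace_fin, Real.coe_toNNReal _ (by unfold critExp; positivity), critExp]
      push_cast
      field_simp
  -- The inequality for C¹ functions is transferred to u: Fatou on the left-hand side, dominated
  -- convergence on the right-hand side with the dominating function C² on the fixed compact set K.
  have h1 := Lp.eLpNorm_lim_le_liminf_eLpNorm (p := ENNReal.ofReal (critExp N)) (μ := volume)
    (f := fun n => mollify u n)
    (fun n => (contDiff_mollify hC.continuous n).continuous.aestronglyMeasurable) u
    (ae_tendsto_mollifier_convolution hC.continuous.locallyIntegrable)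
  have h2 : Tendsto (fun n => eLpNorm (fderiv ℝ (mollify u n)) 2 volume) atTop
      (𝓝 (eLpNorm (fderiv ℝ u) 2 volume)) := by
    simp only [eLpNorm_eq_lintegral_rpow_enorm_toReal two_ne_zero ENNReal.ofNat_ne_top]
    refine Tendsto.ennrpow_const _ ?_
    refine tendsto_lintegral_of_dominated_convergence
      (K.indicator fun _ => (C : ℝ≥0∞) ^ (2 : ℝ)) (fun n => ?_) (fun n => ?_) ?_ ?_
    · exact (measurable_fderiv ℝ _).enorm.pow_const _
    · refine Eventually.of_forall fun x => ?_
      by_cases hx : x ∈ K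
      · rw [Set.indicator_of_mem hx]
        simp only [ENNReal.toReal_ofNat]
        gcongr
        rw [← ofReal_norm, ← ENNReal.ofReal_coe_nnreal]
        refine ENNReal.ofReal_le_ofReal ?_
        exact norm_fderiv_le_of_lipschitz ℝ
          (LipschitzWith.of_dist_le_mul fun x y => by
            simpa [dist_eq_norm] using norm_mollify_sub_le hC n x y)
      · have : fderiv ℝ (mollify u n) x = 0 := by
          by_contra h
          exact hx (hKs n (support_fderiv_subset ℝ h))
        have h0 : ‖fderiv ℝ (mollify u n) x‖ₑ = 0 := by simp [enorm_eq_nnnorm, this]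
        beta_reduce
        rw [h0, ENNReal.zero_rpow_of_pos (by simp)]
        exact zero_le
    · rw [lintegral_indicator hK.measurableSet, lintegral_const]
      simp only [Measure.restrict_apply_univ]
      exact ENNReal.mul_ne_top (by simp) hK.measure_lt_top.ne
    · filter_upwards [ae_tendsto_mollifier_convolution (locallyIntegrable_fderiv hC)] with x hx
      refine Tendsto.ennrpow_const _ ?_
      refine Tendsto.enorm ?_
      simpa only [fderiv_mollify hC] using hx
  have h3 : eLpNorm (gradient u) 2 volume = eLpNorm (fderiv ℝ u) 2 volume :=
    eLpNorm_congr_norm_ae (Eventually.of_forall fun x => norm_gradient u x)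
  rw [h3]
  refine h1.trans ?_
  have h4 := (ENNReal.Tendsto.const_mul
    (a := (SNormLESNormFDerivOfEqConst ℝ (volume : Measure (EuclideanSpace ℝ (Fin N))) 2 : ℝ≥0∞))
    h2 (Or.inr (by simp))).liminf_eq
  rw [← h4]
  exact liminf_le_liminf (Eventually.of_forall hsob)

/-! ### Convexity of the energy in u². -/

section Gradient

variable {u v : EuclideanSpace ℝ (Fin N) → ℝ} {x : EuclideanSpace ℝ (Fin N)}

theorem hasGradientAt_comp {g : EuclideanSpace ℝ (Fin N)} {f : ℝ → ℝ} {c : ℝ}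
    (hf : HasDerivAt f c (u x)) (hu : HasGradientAt u g x) :
    HasGradientAt (fun y => f (u y)) (c • g) x := by
  rw [hasGradientAt_iff_hasFDerivAt] at hu ⊢
  have h := hf.comp_hasFDerivAt x hu
  rw [map_smulₛₗ]
  exact h

theorem hasGradientAt_add_const_mul (hu : DifferentiableAt ℝ u x) (hv : DifferentiableAt ℝ v x)
    (t : ℝ) : HasGradientAt (fun y => u y + t * v y) (gradient u x + t • gradient v x) x := by
  have h1 := hasGradientAt_iff_hasFDerivAt.1 hu.hasGradientAt
  have h2 := hasGradientAt_iff_hasFDerivAt.1 hv.hasGradientAt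
  rw [hasGradientAt_iff_hasFDerivAt, map_add, map_smulₛₗ]
  exact h1.add (h2.const_mul t)

theorem hasGradientAt_sq (hu : DifferentiableAt ℝ u x) :
    HasGradientAt (fun y => u y ^ 2) ((2 * u x) • gradient u x) x := by
  have h := hasGradientAt_comp (f := fun t : ℝ => t ^ 2) (by simpa using hasDerivAt_pow 2 (u x))
    hu.hasGradientAt
  exact h

/-- The gradient of the squared midpoint is computed in two ways. Keeping the factor 2w avoids
dividing where w = 0. -/
theorem two_mul_smul_gradient_sqrt (hu : DifferentiableAt ℝ u x) (hv : DifferentiableAt ℝ v x)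
    (hw : DifferentiableAt ℝ (fun y => √((u y ^ 2 + v y ^ 2) / 2)) x) :
    (2 * √((u x ^ 2 + v x ^ 2) / 2)) • gradient (fun y => √((u y ^ 2 + v y ^ 2) / 2)) x
      = u x • gradient u x + v x • gradient v x := by
  have h1 := hasGradientAt_sq hw
  have h2 : HasGradientAt (fun y => √((u y ^ 2 + v y ^ 2) / 2) ^ 2)
      (u x • gradient u x + v x • gradient v x) x := by
    have h3 := hasGradientAt_comp (f := fun t : ℝ => 1 / 2 * t) (c := 1 / 2)
      (by simpa only [mul_one] using
        (hasDerivAt_id' (u x ^ 2 + 1 * v x ^ 2)).const_mul (1 / 2 : ℝ))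
      (u := fun y => u y ^ 2 + 1 * v y ^ 2)
      (hasGradientAt_add_const_mul (hasGradientAt_sq hu).differentiableAt
        (hasGradientAt_sq hv).differentiableAt 1)
    rw [(hasGradientAt_sq hu).gradient, (hasGradientAt_sq hv).gradient] at h3
    convert h3 using 1
    · ext y
      rw [Real.sq_sqrt (by positivity)]; ring
    · module
  exact h1.unique h2

/-- A nonnegative function has a local minimum at each of its zeros. -/
theorem gradient_sqrt_eq_zero (h : (u x ^ 2 + v x ^ 2) / 2 = 0) :
    gradient (fun y => √((u y ^ 2 + v y ^ 2) / 2)) x = 0 := by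
  have : IsLocalMin (fun y => √((u y ^ 2 + v y ^ 2) / 2)) x :=
    Eventually.of_forall fun y => by simp only [h, Real.sqrt_zero]; positivity
  rw [gradient, this.fderiv_eq_zero, map_zero]

/-- Pointwise convexity in ρ = u². For the terms with c²‖g‖² the parallelogram law gives an
identity, which produces the gain 1/8 ‖∇(u²) - ∇(v²)‖². The term ‖g‖² is handled by Cauchy-Schwarz,
i.e. by the convexity of |∇√ρ|², after division by c². -/
theorem gradient_midpoint_inequality {a b c : ℝ} {g₁ g₂ g : EuclideanSpace ℝ (Fin N)}
    (hc : c ^ 2 = (a ^ 2 + b ^ 2) / 2) (hg : (2 * c) • g = a • g₁ + b • g₂)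
    (h0 : c = 0 → g = 0) :
    (1 + 2 * c ^ 2) * ‖g‖ ^ 2 + 1 / 8 * ‖(2 * a) • g₁ - (2 * b) • g₂‖ ^ 2
      ≤ ((1 + 2 * a ^ 2) * ‖g₁‖ ^ 2 + (1 + 2 * b ^ 2) * ‖g₂‖ ^ 2) / 2 := by
  have h1 : 4 * c ^ 2 * ‖g‖ ^ 2 = ‖a • g₁ + b • g₂‖ ^ 2 := by
    rw [← hg, norm_smul, mul_pow, Real.norm_eq_abs, sq_abs]; ring
  have hpar : ‖(2 * a) • g₁ - (2 * b) • g₂‖ ^ 2 =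
      8 * (a ^ 2 * ‖g₁‖ ^ 2 + b ^ 2 * ‖g₂‖ ^ 2) - 4 * ‖a • g₁ + b • g₂‖ ^ 2 := by
    have h := parallelogram_law_with_norm ℝ (a • g₁) (b • g₂)
    have h2 : (2 * a) • g₁ - (2 * b) • g₂ = (2 : ℝ) • (a • g₁ - b • g₂) := by module
    rw [h2, norm_smul, mul_pow]
    simp only [norm_smul, Real.norm_eq_abs, mul_pow, sq_abs] at h ⊢
    linarith
  have h2 : ‖g‖ ^ 2 ≤ (‖g₁‖ ^ 2 + ‖g₂‖ ^ 2) / 2 := by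
    rcases eq_or_ne c 0 with h | h
    · rw [h0 h, norm_zero, zero_pow two_ne_zero]; positivity
    · have hle : ‖a • g₁ + b • g₂‖ ^ 2 ≤ (a ^ 2 + b ^ 2) * (‖g₁‖ ^ 2 + ‖g₂‖ ^ 2) := by
        have h3 : ‖a • g₁ + b • g₂‖ ≤ |a| * ‖g₁‖ + |b| * ‖g₂‖ := by
          refine (norm_add_le _ _).trans ?_
          rw [norm_smul, norm_smul, Real.norm_eq_abs, Real.norm_eq_abs]
        have h4 : ‖a • g₁ + b • g₂‖ ^ 2 ≤ (|a| * ‖g₁‖ + |b| * ‖g₂‖) ^ 2 := by gcongr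
        rw [← sq_abs a, ← sq_abs b]
        nlinarith [sq_nonneg (|a| * ‖g₂‖ - |b| * ‖g₁‖)]
      have hc0 : 0 < c ^ 2 := by positivity
      have : 4 * c ^ 2 * ‖g‖ ^ 2 ≤ 4 * c ^ 2 * ((‖g₁‖ ^ 2 + ‖g₂‖ ^ 2) / 2) := by
        rw [h1]; refine hle.trans (le_of_eq ?_); rw [hc]; ring
      exact le_of_mul_le_mul_left this (by positivity)
  rw [hpar]
  nlinarith

end Gradient

theorem abs_rpow_eq_sq_rpow (x p : ℝ) : |x| ^ p = (x ^ 2) ^ (p / 2) := by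
  rw [← sq_abs, ← Real.rpow_natCast, ← Real.rpow_mul (abs_nonneg x)]
  congr 1; push_cast; ring

/-- Concavity of r ↦ r^(p/2) applied to r = a² and r = b². -/
theorem le_sqrt_rpow {p : ℝ} (hp0 : 0 ≤ p) (hp : p ≤ 2) (a b : ℝ) :
    (|a| ^ p + |b| ^ p) / 2 ≤ |√((a ^ 2 + b ^ 2) / 2)| ^ p := by
  rw [abs_rpow_eq_sq_rpow, abs_rpow_eq_sq_rpow, abs_rpow_eq_sq_rpow, Real.sq_sqrt (by positivity)]
  have h := (Real.concaveOn_rpow (p := p / 2) (by linarith) (by linarith)).2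
    (Set.mem_Ici.2 (sq_nonneg a)) (Set.mem_Ici.2 (sq_nonneg b))
    (by norm_num : (0 : ℝ) ≤ 1 / 2) (by norm_num : (0 : ℝ) ≤ 1 / 2) (by norm_num)
  simp only [smul_eq_mul] at h
  rw [show (a ^ 2 + b ^ 2) / 2 = 1 / 2 * a ^ 2 + 1 / 2 * b ^ 2 by ring]
  linarith

/-- Convexity of r ↦ r^(p/2), the counterpart for exponents above 2. -/
theorem sqrt_rpow_le {p : ℝ} (hp : 2 ≤ p) (a b : ℝ) :
    |√((a ^ 2 + b ^ 2) / 2)| ^ p ≤ (|a| ^ p + |b| ^ p) / 2 := by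
  rw [abs_rpow_eq_sq_rpow, abs_rpow_eq_sq_rpow, abs_rpow_eq_sq_rpow, Real.sq_sqrt (by positivity)]
  have h := (convexOn_rpow (p := p / 2) (by linarith)).2
    (Set.mem_Ici.2 (sq_nonneg a)) (Set.mem_Ici.2 (sq_nonneg b))
    (by norm_num : (0 : ℝ) ≤ 1 / 2) (by norm_num : (0 : ℝ) ≤ 1 / 2) (by norm_num)
  simp only [smul_eq_mul] at h
  rw [show (a ^ 2 + b ^ 2) / 2 = 1 / 2 * a ^ 2 + 1 / 2 * b ^ 2 by ring]
  linarith

/-- The energy functional on Lipschitz functions, with the classical gradient. -/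
def lipEnergy (k h : EuclideanSpace ℝ (Fin N) → ℝ) (q s : ℝ)
    (u : EuclideanSpace ℝ (Fin N) → ℝ) : ℝ :=
  1 / 2 * (∫ x, (1 + 2 * u x ^ 2) * ‖gradient u x‖ ^ 2)
    - 1 / q * (∫ x, k x * |u x| ^ q)
    + 1 / s * (∫ x, h x * |u x| ^ s)

namespace IsLipC

variable {u v : EuclideanSpace ℝ (Fin N) → ℝ}

theorem integrable_energy (hu : IsLipC u) :
    Integrable (fun x => (1 + 2 * u x ^ 2) * ‖gradient u x‖ ^ 2) volume :=
  hu.integrable_comp hu (F := fun a b _ _ => (1 + 2 * a ^ 2) * ‖b‖ ^ 2) (by fun_prop) (by simp)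

theorem integrable_mul_abs_rpow (hu : IsLipC u) {k : EuclideanSpace ℝ (Fin N) → ℝ}
    (hk : MemLp k ⊤ volume) {p : ℝ} (hp : 0 < p) :
    Integrable (fun x => k x * |u x| ^ p) volume :=
  hu.integrable_mul_comp hu hk (F := fun a _ _ _ => |a| ^ p)
    ((continuous_fst.abs).rpow_const fun _ => Or.inr hp.le) (by simp [hp.ne'])

theorem ae_differentiableAt (hu : IsLipC u) : ∀ᵐ x, DifferentiableAt ℝ u x :=
  QuasilinearSchrodinger.ae_differentiableAt hu.lip

end IsLipC

section Energy

variable {k h : EuclideanSpace ℝ (Fin N) → ℝ} {q s : ℝ}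

/-- Convexity of the energy as a functional of `u ^ 2`. -/
theorem lipEnergy_midpoint (hq0 : 0 < q) (hq2 : q ≤ 2) (hs : 2 ≤ s) (hk : MemLp k ⊤ volume)
    (hk0 : ∀ᵐ x, 0 ≤ k x) (hh : MemLp h ⊤ volume) (hh0 : ∀ᵐ x, 0 ≤ h x)
    {u v : EuclideanSpace ℝ (Fin N) → ℝ} (hu : IsLipC u) (hv : IsLipC v) :
    lipEnergy k h q s (fun x => √((u x ^ 2 + v x ^ 2) / 2))
      + 1 / 16 * ∫ x, ‖(2 * u x) • gradient u x - (2 * v x) • gradient v x‖ ^ 2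
      ≤ (lipEnergy k h q s u + lipEnergy k h q s v) / 2 := by
  have hw := hu.sqrt_add_sq_div_two hv
  set w := fun x => √((u x ^ 2 + v x ^ 2) / 2) with hwdef
  have hd : Integrable (fun x => ‖(2 * u x) • gradient u x - (2 * v x) • gradient v x‖ ^ 2)
      volume :=
    hu.integrable_comp hv (F := fun a b c d => ‖(2 * a) • b - (2 * c) • d‖ ^ 2)
      (by fun_prop) (by simp)
  -- The gain 1/8 becomes 1/16 after the factor 1/2 in front of the gradient term of the energy.
  have h1 : ∫ x, (1 + 2 * w x ^ 2) * ‖gradient w x‖ ^ 2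
      + 1 / 8 * ‖(2 * u x) • gradient u x - (2 * v x) • gradient v x‖ ^ 2
      ≤ ∫ x, 1 / 2 * ((1 + 2 * u x ^ 2) * ‖gradient u x‖ ^ 2)
        + 1 / 2 * ((1 + 2 * v x ^ 2) * ‖gradient v x‖ ^ 2) := by
    refine integral_mono_ae (hw.integrable_energy.add (hd.const_mul _))
      ((hu.integrable_energy.const_mul _).add (hv.integrable_energy.const_mul _)) ?_
    filter_upwards [hu.ae_differentiableAt, hv.ae_differentiableAt, hw.ae_differentiableAt]
      with x hux hvx hwx
    have hwx2 : w x ^ 2 = (u x ^ 2 + v x ^ 2) / 2 := Real.sq_sqrt (by positivity)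
    refine (gradient_midpoint_inequality hwx2 (two_mul_smul_gradient_sqrt hux hvx hwx)
      fun h => gradient_sqrt_eq_zero ?_).trans (le_of_eq (by ring))
    rw [← hwx2, h]; simp
  rw [integral_add hw.integrable_energy (hd.const_mul _), integral_add
    (hu.integrable_energy.const_mul _) (hv.integrable_energy.const_mul _), integral_const_mul,
    integral_const_mul, integral_const_mul] at h1
  have h2 : ∫ x, 1 / 2 * (k x * |u x| ^ q) + 1 / 2 * (k x * |v x| ^ q)
      ≤ ∫ x, k x * |w x| ^ q := by
    refine integral_mono_ae (((hu.integrable_mul_abs_rpow hk hq0).const_mul _).add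
      ((hv.integrable_mul_abs_rpow hk hq0).const_mul _)) (hw.integrable_mul_abs_rpow hk hq0) ?_
    filter_upwards [hk0] with x hx
    have := mul_le_mul_of_nonneg_left (le_sqrt_rpow hq0.le hq2 (u x) (v x)) hx
    refine le_trans (le_of_eq ?_) this
    ring
  rw [integral_add ((hu.integrable_mul_abs_rpow hk hq0).const_mul _)
      ((hv.integrable_mul_abs_rpow hk hq0).const_mul _), integral_const_mul,
      integral_const_mul] at h2
  have hs0 : 0 < s := by linarith
  have h3 : ∫ x, h x * |w x| ^ s
      ≤ ∫ x, 1 / 2 * (h x * |u x| ^ s) + 1 / 2 * (h x * |v x| ^ s) := by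
    refine integral_mono_ae (hw.integrable_mul_abs_rpow hh hs0)
      (((hu.integrable_mul_abs_rpow hh hs0).const_mul _).add
      ((hv.integrable_mul_abs_rpow hh hs0).const_mul _)) ?_
    filter_upwards [hh0] with x hx
    have := mul_le_mul_of_nonneg_left (sqrt_rpow_le hs (u x) (v x)) hx
    refine le_trans this (le_of_eq ?_)
    ring
  rw [integral_add ((hu.integrable_mul_abs_rpow hh hs0).const_mul _)
      ((hv.integrable_mul_abs_rpow hh hs0).const_mul _), integral_const_mul,
      integral_const_mul] at h3
  have h2' := mul_le_mul_of_nonneg_left h2 (by positivity : 0 ≤ 1 / q)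
  have h3' := mul_le_mul_of_nonneg_left h3 (by positivity : 0 ≤ 1 / s)
  unfold lipEnergy
  linarith

end Energy

/-! ### Coercivity of the energy and negativity of its infimum. -/

theorem critExp_pos (hN : 3 ≤ N) : 2 < critExp N := by
  have hN' : (3 : ℝ) ≤ N := by exact_mod_cast hN
  unfold critExp
  rw [lt_div_iff₀ (by linarith)]
  linarith

theorem conjExp_holderConjugate (hN : 3 ≤ N) {q : ℝ} (hq0 : 0 < q) (hq2 : q < 2) :
    (conjExp N q).HolderConjugate (critExp N / q) := by
  have hN' : (3 : ℝ) ≤ N := by exact_mod_cast hN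
  have h1 : 0 < (N : ℝ) - 2 := by linarith
  have h2 : 0 < 2 * (N : ℝ) - q * ((N : ℝ) - 2) := by nlinarith
  rw [Real.holderConjugate_iff]
  unfold conjExp critExp
  constructor
  · rw [lt_div_iff₀ h2]; nlinarith
  · field_simp; ring

namespace IsLipC

variable {u : EuclideanSpace ℝ (Fin N) → ℝ}

theorem memLp (hu : IsLipC u) (p : ℝ≥0∞) : MemLp u p volume :=
  hu.continuous.memLp_of_hasCompactSupport hu.compact

theorem integrable_gradient_sq (hu : IsLipC u) :
    Integrable (fun x => ‖gradient u x‖ ^ 2) volume :=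
  hu.integrable_comp hu (F := fun _ b _ _ => ‖b‖ ^ 2) (by fun_prop) (by simp)

theorem integrable_sq_mul_gradient_sq (hu : IsLipC u) :
    Integrable (fun x => u x ^ 2 * ‖gradient u x‖ ^ 2) volume :=
  hu.integrable_comp hu (F := fun a b _ _ => a ^ 2 * ‖b‖ ^ 2) (by fun_prop) (by simp)

theorem memLp_gradient (hu : IsLipC u) : MemLp (gradient u) 2 volume :=
  (memLp_two_iff_integrable_sq_norm (measurable_gradient u).aestronglyMeasurable).2
    hu.integrable_gradient_sq

theorem integrable_abs_rpow (hu : IsLipC u) {p : ℝ} (hp : 0 < p) :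
    Integrable (fun x => |u x| ^ p) volume := by
  simpa using hu.integrable_mul_abs_rpow (memLp_top_const (1 : ℝ)) hp

end IsLipC

theorem integral_abs_rpow_le_sobolev (hN : 3 ≤ N) : ∃ S : ℝ, 0 ≤ S ∧
    ∀ u : EuclideanSpace ℝ (Fin N) → ℝ, IsLipC u →
      ∫ x, |u x| ^ critExp N ≤ (S * √(∫ x, ‖gradient u x‖ ^ 2)) ^ critExp N := by
  obtain ⟨S, hS⟩ := exists_sobolev_const hN
  have hp := critExp_pos hN
  have hp0 : 0 < critExp N := by linarith
  refine ⟨S, S.coe_nonneg, fun u hu => ?_⟩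
  have h := hS u hu
  rw [(hu.memLp _).eLpNorm_eq_integral_rpow_norm (by simpa using hp0) ENNReal.ofReal_ne_top,
    hu.memLp_gradient.eLpNorm_eq_integral_rpow_norm two_ne_zero ENNReal.ofNat_ne_top,
    ← ENNReal.ofReal_coe_nnreal, ← ENNReal.ofReal_mul S.coe_nonneg, ENNReal.ofReal_le_ofReal_iff
    (by positivity), ENNReal.toReal_ofReal hp0.le, ENNReal.toReal_ofNat] at h
  simp only [Real.norm_eq_abs] at h
  have hI : 0 ≤ ∫ x, |u x| ^ critExp N := integral_nonneg fun x => by positivity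
  have h2 := Real.rpow_le_rpow (by positivity) h hp0.le
  rw [← Real.rpow_mul hI, inv_mul_cancel₀ hp0.ne', Real.rpow_one] at h2
  rw [Real.sqrt_eq_rpow]
  simpa [Real.rpow_two] using h2

/-- Hölder with the conjugate exponents q₀ and 2*/q, followed by Sobolev. The resulting power q/2 of
the Dirichlet integral is less than 1, which is what coercivity needs. -/
theorem exists_integral_mul_abs_rpow_le (hN : 3 ≤ N) {q : ℝ} (hq0 : 0 < q) (hq2 : q < 2)
    {k : EuclideanSpace ℝ (Fin N) → ℝ} (hk : MemLp k (ENNReal.ofReal (conjExp N q)) volume)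
    (hk0 : ∀ᵐ x, 0 ≤ k x) : ∃ A : ℝ, 0 ≤ A ∧ ∀ u : EuclideanSpace ℝ (Fin N) → ℝ, IsLipC u →
      ∫ x, k x * |u x| ^ q ≤ (∫ x, ‖gradient u x‖ ^ 2) ^ (q / 2) * A := by
  obtain ⟨S, hS0, hS⟩ := integral_abs_rpow_le_sobolev hN
  have hp := critExp_pos hN
  have hp0 : 0 < critExp N := by linarith
  have hc := conjExp_holderConjugate hN hq0 hq2
  set a := (∫ x, k x ^ conjExp N q) ^ (1 / conjExp N q)
  have ha : 0 ≤ a := by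
    refine Real.rpow_nonneg (integral_nonneg_of_ae ?_) _
    filter_upwards [hk0] with x hx
    exact Real.rpow_nonneg hx _
  refine ⟨a * S ^ q, by positivity, fun u hu => ?_⟩
  have h1 := integral_mul_le_Lp_mul_Lq_of_nonneg (μ := volume) hc hk0
    (g := fun x => |u x| ^ q) (Eventually.of_forall fun x => by positivity) hk ?_
  · have h2 : ∀ x, (|u x| ^ q) ^ (critExp N / q) = |u x| ^ critExp N := fun x => by
      rw [← Real.rpow_mul (abs_nonneg _)]; congr 1; field_simp
    simp only [h2] at h1
    refine h1.trans ?_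
    have hI : 0 ≤ ∫ x, |u x| ^ critExp N := integral_nonneg fun x => by positivity
    have h3 : (∫ x, |u x| ^ critExp N) ^ (1 / (critExp N / q))
        ≤ S ^ q * (∫ x, ‖gradient u x‖ ^ 2) ^ (q / 2) := by
      refine (Real.rpow_le_rpow hI (hS u hu) (by positivity)).trans (le_of_eq ?_)
      rw [← Real.rpow_mul (by positivity), show critExp N * (1 / (critExp N / q)) = q by field_simp,
        Real.mul_rpow hS0 (by positivity), Real.sqrt_eq_rpow, ← Real.rpow_mul (by positivity)]
      congr 2; ring
    calc a * _ ≤ a * (S ^ q * (∫ x, ‖gradient u x‖ ^ 2) ^ (q / 2)) := by gcongr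
      _ = _ := by ring
  · exact ((hu.continuous.abs.rpow_const fun _ => Or.inr hq0.le)).memLp_of_hasCompactSupport
      (hu.compact.comp_left (g := fun t : ℝ => |t| ^ q) (by simp [hq0.ne']))

section Energy

variable {k h : EuclideanSpace ℝ (Fin N) → ℝ} {q s : ℝ}

theorem lipEnergy_eq {u : EuclideanSpace ℝ (Fin N) → ℝ} (hu : IsLipC u) :
    lipEnergy k h q s u = 1 / 2 * (∫ x, ‖gradient u x‖ ^ 2) + (∫ x, u x ^ 2 * ‖gradient u x‖ ^ 2)
      - 1 / q * (∫ x, k x * |u x| ^ q) + 1 / s * (∫ x, h x * |u x| ^ s) := by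
  have : ∫ x, (1 + 2 * u x ^ 2) * ‖gradient u x‖ ^ 2
      = (∫ x, ‖gradient u x‖ ^ 2) + 2 * ∫ x, u x ^ 2 * ‖gradient u x‖ ^ 2 := by
    rw [← integral_const_mul, ← integral_add hu.integrable_gradient_sq
      (hu.integrable_sq_mul_gradient_sq.const_mul _)]
    congr 1 with x
    ring
  rw [lipEnergy, this]; ring

theorem exists_coercive_bound (hN : 3 ≤ N) (hq0 : 0 < q) (hq2 : q < 2)
    (hk : MemLp k (ENNReal.ofReal (conjExp N q)) volume) (hk0 : ∀ᵐ x, 0 ≤ k x) :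
    ∃ C : ℝ, ∀ u : EuclideanSpace ℝ (Fin N) → ℝ, IsLipC u →
      1 / 4 * (∫ x, ‖gradient u x‖ ^ 2) + (∫ x, u x ^ 2 * ‖gradient u x‖ ^ 2)
        + 1 / s * (∫ x, h x * |u x| ^ s) ≤ lipEnergy k h q s u + C := by
  obtain ⟨A, hA0, hA⟩ := exists_integral_mul_abs_rpow_le hN hq0 hq2 hk hk0
  -- Since q/2 < 1, the sublinear power of the Dirichlet integral is absorbed into 1/4 of it,
  -- leaving 1/4 of the original 1/2.
  obtain ⟨C, hC0, hC⟩ := exists_rpow_mul_le (a := q / 2) (p := 1) (ε := 1 / 4) (by positivity)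
    (by linarith) (by norm_num)
  refine ⟨C * (1 / q * A) ^ (1 / (1 - q / 2)), fun u hu => ?_⟩
  have h0 : 0 ≤ ∫ x, ‖gradient u x‖ ^ 2 := integral_nonneg fun x => by positivity
  have h1 := hC (∫ x, ‖gradient u x‖ ^ 2) (1 / q * A) h0 (by positivity)
  rw [Real.rpow_one] at h1
  have h2 := mul_le_mul_of_nonneg_left (hA u hu) (by positivity : 0 ≤ 1 / q)
  rw [lipEnergy_eq hu]
  linarith

/-- For t ≤ 1 the nonnegative terms scale at least as fast as t², while the k-term scales exactly
like t^q. As q < 2, the latter wins for small t. -/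
theorem lipEnergy_smul_le (hs : 2 < s) (hh : ∀ᵐ x, 0 ≤ h x)
    {φ : EuclideanSpace ℝ (Fin N) → ℝ} (hφ : IsTestFunction φ) {t : ℝ} (ht0 : 0 < t) (ht1 : t ≤ 1) :
    lipEnergy k h q s (fun x => t * φ x) ≤
      t ^ 2 * (1 / 2 * (∫ x, (1 + 2 * φ x ^ 2) * ‖gradient φ x‖ ^ 2)
        + 1 / s * (∫ x, h x * |φ x| ^ s)) - t ^ q * (1 / q * ∫ x, k x * |φ x| ^ q) := by
  have hg : ∀ x, gradient (fun x => t * φ x) x = t • gradient φ x := fun x => by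
    have := hasGradientAt_comp (f := fun y => t * y) (c := t) (u := φ)
      (by simpa using (hasDerivAt_id' (φ x)).const_mul t)
      ((hφ.1.differentiable (by simp)) x).hasGradientAt
    exact this.gradient
  have h1 : ∀ (p : ℝ) x, |t * φ x| ^ p = t ^ p * |φ x| ^ p := fun p x => by
    rw [abs_mul, abs_of_pos ht0, Real.mul_rpow ht0.le (abs_nonneg _)]
  have hint : ∀ (f : EuclideanSpace ℝ (Fin N) → ℝ) (p : ℝ),
      ∫ x, f x * |t * φ x| ^ p = t ^ p * ∫ x, f x * |φ x| ^ p := fun f p => by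
    rw [← integral_const_mul]
    congr 1 with x
    rw [h1]; ring
  have h2 : ∫ x, (1 + 2 * (t * φ x) ^ 2) * ‖gradient (fun x => t * φ x) x‖ ^ 2
      ≤ t ^ 2 * ∫ x, (1 + 2 * φ x ^ 2) * ‖gradient φ x‖ ^ 2 := by
    rw [← integral_const_mul]
    refine integral_mono_of_nonneg (Eventually.of_forall fun x => by positivity)
      (hφ.isLipC.integrable_energy.const_mul _) (Eventually.of_forall fun x => ?_)
    simp only [hg, norm_smul, mul_pow, Real.norm_eq_abs, sq_abs]
    have : t ^ 2 * φ x ^ 2 ≤ 1 * φ x ^ 2 := by gcongr; exact pow_le_one₀ ht0.le ht1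
    calc (1 + 2 * (t ^ 2 * φ x ^ 2)) * (t ^ 2 * ‖gradient φ x‖ ^ 2)
        ≤ (1 + 2 * (1 * φ x ^ 2)) * (t ^ 2 * ‖gradient φ x‖ ^ 2) := by gcongr
      _ = _ := by ring
  have h3 : t ^ s ≤ t ^ 2 := by
    rw [← Real.rpow_two]
    exact Real.rpow_le_rpow_of_exponent_ge ht0 ht1 hs.le
  have h4 : 0 ≤ ∫ x, h x * |φ x| ^ s := integral_nonneg_of_ae (by
    filter_upwards [hh] with x hx; positivity)
  have h5 := mul_le_mul_of_nonneg_right h3 h4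
  have h6 := mul_le_mul_of_nonneg_left h5 (by positivity : 0 ≤ 1 / s)
  simp only [lipEnergy, hint]
  linarith

theorem exists_testFunction_integral_pos (hq0 : 0 < q) (hk : MemLp k ⊤ volume)
    (hk0 : ∀ᵐ x, 0 ≤ k x) (hkne : ¬ ∀ᵐ x, k x = 0) :
    ∃ φ : EuclideanSpace ℝ (Fin N) → ℝ, IsTestFunction φ ∧ 0 < ∫ x, k x * |φ x| ^ q := by
  by_contra! hcon
  apply hkne
  let φ : ∀ n : ℕ, ContDiffBump (0 : EuclideanSpace ℝ (Fin N)) := fun n =>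
    ⟨n + 1, n + 2, by positivity, by linarith⟩
  have hφ : ∀ n, IsTestFunction (φ n) := fun n => ⟨(φ n).contDiff, (φ n).hasCompactSupport⟩
  have hz : ∀ n, ∀ᵐ x, k x * |φ n x| ^ q = 0 := fun n => by
    have h0 : 0 ≤ᵐ[volume] fun x => k x * |φ n x| ^ q := by
      filter_upwards [hk0] with x hx
      exact mul_nonneg hx (by positivity)
    exact (integral_eq_zero_iff_of_nonneg_ae h0 ((hφ n).isLipC.integrable_mul_abs_rpow hk hq0)).1
      (le_antisymm (hcon _ (hφ n)) (integral_nonneg_of_ae h0))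
  -- The n-th bump equals 1 on the ball of radius n + 1. If all the integrals vanished, k would
  -- vanish a.e. on every ball.
  filter_upwards [ae_all_iff.2 hz] with x hx
  obtain ⟨n, hn⟩ := exists_nat_ge ‖x‖
  have h1 : φ n x = 1 := (φ n).one_of_mem_closedBall (by
    rw [mem_closedBall_zero_iff]; change ‖x‖ ≤ n + 1; linarith)
  simpa [h1] using hx n

theorem exists_lipEnergy_neg (hq1 : 1 < q) (hq2 : q < 2) (hs : 2 < s) (hk : MemLp k ⊤ volume)
    (hk0 : ∀ᵐ x, 0 ≤ k x) (hkne : ¬ ∀ᵐ x, k x = 0) (hh : ∀ᵐ x, 0 ≤ h x) :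
    ∃ u : EuclideanSpace ℝ (Fin N) → ℝ, IsLipC u ∧ lipEnergy k h q s u < 0 := by
  obtain ⟨φ, hφ, hpos⟩ := exists_testFunction_integral_pos (q := q) (by linarith) hk hk0 hkne
  set B := 1 / 2 * (∫ x, (1 + 2 * φ x ^ 2) * ‖gradient φ x‖ ^ 2)
        + 1 / s * (∫ x, h x * |φ x| ^ s)
  have hq0 : 0 < q := by linarith
  set c := 1 / q * ∫ x, k x * |φ x| ^ q
  have hc : 0 < c := by positivity
  have hlim : Tendsto (fun t : ℝ => t ^ (2 - q) * B) (𝓝[>] 0) (𝓝 0) := by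
    have h1 : ContinuousAt (fun t : ℝ => t ^ (2 - q)) 0 :=
      Real.continuousAt_rpow_const _ _ (Or.inr (by linarith))
    have h2 := (h1.tendsto.mono_left (nhdsWithin_le_nhds (s := Set.Ioi 0))).mul_const B
    rwa [Real.zero_rpow (by linarith), zero_mul] at h2
  have hev := (hlim.eventually (gt_mem_nhds hc)).and (Ioc_mem_nhdsGT (zero_lt_one' ℝ))
  obtain ⟨t, ht, ht0, ht1⟩ := hev.exists
  refine ⟨fun x => t * φ x, ?_, (lipEnergy_smul_le hs hh hφ ht0 ht1).trans_lt ?_⟩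
  · have h0 : IsLipC (fun _ : EuclideanSpace ℝ (Fin N) => (0 : ℝ)) :=
      ⟨⟨0, LipschitzWith.const 0⟩, HasCompactSupport.zero⟩
    simpa using h0.add_const_mul hφ.isLipC t
  · have h1 : t ^ 2 = t ^ q * t ^ (2 - q) := by
      rw [← Real.rpow_add ht0, ← Real.rpow_two]; ring_nf
    have h2 : 0 < t ^ q := by positivity
    change t ^ 2 * B - t ^ q * c < 0
    rw [h1]
    nlinarith

end Energy

/-! ### The minimising sequence and its limit. -/

/-- `W = ∇(u²) = 2u∇u`. -/
def sqGradient (u : EuclideanSpace ℝ (Fin N) → ℝ) :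
    EuclideanSpace ℝ (Fin N) → EuclideanSpace ℝ (Fin N) :=
  fun x => (2 * u x) • gradient u x

/-- A minimising sequence `un` of nonnegative Lipschitz functions for the energy, with infimum `m`,
converging to `u` almost everywhere and with `∇(un²)` converging to `W` in `L²`. -/
structure IsMinimizingLimit (k h : EuclideanSpace ℝ (Fin N) → ℝ) (q s m M : ℝ)
    (un : ℕ → EuclideanSpace ℝ (Fin N) → ℝ) (u : EuclideanSpace ℝ (Fin N) → ℝ)
    (W : EuclideanSpace ℝ (Fin N) → EuclideanSpace ℝ (Fin N)) : Prop where
  lipC : ∀ n, IsLipC (un n)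
  nonneg : ∀ n x, 0 ≤ un n x
  le_lipEnergy : ∀ v, IsLipC v → m ≤ lipEnergy k h q s v
  tendsto_lipEnergy : Tendsto (fun n => lipEnergy k h q s (un n)) atTop (𝓝 m)
  bound_gradient : ∀ n, ∫ x, ‖gradient (un n) x‖ ^ 2 ≤ M
  bound_sqGradient : ∀ n, ∫ x, ‖sqGradient (un n) x‖ ^ 2 ≤ M
  bound_h : ∀ n, ∫ x, h x * |un n x| ^ s ≤ M
  bound_critExp : ∀ n, ∫ x, |un n x| ^ critExp N ≤ M
  measurable : Measurable u
  limit_nonneg : ∀ x, 0 ≤ u x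
  ae_tendsto : ∀ᵐ x, Tendsto (fun n => un n x) atTop (𝓝 (u x))
  memLp : MemLp W 2 volume
  ae_tendsto_sqGradient : ∀ᵐ x, Tendsto (fun n => sqGradient (un n) x) atTop (𝓝 (W x))
  tendsto_sqGradient : Tendsto (fun n => ∫ x, ‖sqGradient (un n) x - W x‖ ^ 2) atTop (𝓝 0)

theorem IsLipC.integrable_sqGradient_sq {u : EuclideanSpace ℝ (Fin N) → ℝ} (hu : IsLipC u) :
    Integrable (fun x => ‖sqGradient u x‖ ^ 2) volume :=
  hu.integrable_comp hu (F := fun a b _ _ => ‖(2 * a) • b‖ ^ 2) (by fun_prop) (by simp)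

theorem IsLipC.aestronglyMeasurable_sqGradient {u : EuclideanSpace ℝ (Fin N) → ℝ} (hu : IsLipC u) :
    AEStronglyMeasurable (sqGradient u) volume :=
  ((hu.continuous.measurable.const_mul 2).smul (measurable_gradient u)).aestronglyMeasurable

theorem IsLipC.memLp_sqGradient {u : EuclideanSpace ℝ (Fin N) → ℝ} (hu : IsLipC u) :
    MemLp (sqGradient u) 2 volume :=
  (memLp_two_iff_integrable_sq_norm hu.aestronglyMeasurable_sqGradient).2
    hu.integrable_sqGradient_sq

theorem norm_sqGradient_sq (u : EuclideanSpace ℝ (Fin N) → ℝ) (x) :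
    ‖sqGradient u x‖ ^ 2 = 4 * (u x ^ 2 * ‖gradient u x‖ ^ 2) := by
  rw [sqGradient, norm_smul, mul_pow, Real.norm_eq_abs, sq_abs]; ring

theorem eLpNorm_two_eq {α F : Type*} [MeasurableSpace α] {μ : Measure α} [NormedAddCommGroup F]
    {f : α → F} (hf : MemLp f 2 μ) : eLpNorm f 2 μ = ENNReal.ofReal (√(∫ x, ‖f x‖ ^ 2 ∂μ)) := by
  rw [hf.eLpNorm_eq_integral_rpow_norm two_ne_zero ENNReal.ofNat_ne_top, Real.sqrt_eq_rpow]
  simp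

theorem tsum_geometric_ofReal_ne_top {c : ℝ} (hc : 0 ≤ c) :
    ∑' n : ℕ, ENNReal.ofReal (c * (1 / 2) ^ n) ≠ ⊤ := by
  rw [← ENNReal.ofReal_tsum_of_nonneg (fun n => by positivity)
    (summable_geometric_two.mul_left c)]
  exact ENNReal.ofReal_ne_top

section Energy

variable {k h : EuclideanSpace ℝ (Fin N) → ℝ} {q s : ℝ}

theorem exists_minimizing_sequence (hN : 3 ≤ N) (hq0 : 0 < q) (hq2 : q < 2) (hs : 2 < s)
    (hk : MemLp k ⊤ volume) (hkq : MemLp k (ENNReal.ofReal (conjExp N q)) volume)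
    (hk0 : ∀ᵐ x, 0 ≤ k x) (hh : MemLp h ⊤ volume) (hh0 : ∀ᵐ x, 0 ≤ h x)
    (hneg : ∃ u : EuclideanSpace ℝ (Fin N) → ℝ, IsLipC u ∧ lipEnergy k h q s u < 0) :
    ∃ m < 0, (∀ v, IsLipC v → m ≤ lipEnergy k h q s v) ∧
      ∃ un : ℕ → EuclideanSpace ℝ (Fin N) → ℝ, ∀ n, IsLipC (un n) ∧ (∀ x, 0 ≤ un n x) ∧
        lipEnergy k h q s (un n) ≤ m + (1 / 4) ^ n := by
  obtain ⟨C, hC⟩ := exists_coercive_bound (h := h) (s := s) hN hq0 hq2 hkq hk0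
  obtain ⟨u₀, hu₀, hE₀⟩ := hneg
  set A : Set ℝ := {e | ∃ v : EuclideanSpace ℝ (Fin N) → ℝ, IsLipC v ∧ e = lipEnergy k h q s v}
  have hbdd : BddBelow A := by
    refine ⟨-C, ?_⟩
    rintro _ ⟨v, hv, rfl⟩
    have h1 := hC v hv
    have h2 : 0 ≤ ∫ x, ‖gradient v x‖ ^ 2 := integral_nonneg fun x => by positivity
    have h3 : 0 ≤ ∫ x, v x ^ 2 * ‖gradient v x‖ ^ 2 := integral_nonneg fun x => by positivity
    have h4 : 0 ≤ ∫ x, h x * |v x| ^ s := integral_nonneg_of_ae (by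
      filter_upwards [hh0] with x hx; positivity)
    have h5 : 0 ≤ 1 / s * ∫ x, h x * |v x| ^ s := by positivity
    linarith
  have hne : A.Nonempty := ⟨_, u₀, hu₀, rfl⟩
  refine ⟨sInf A, (csInf_le hbdd ⟨u₀, hu₀, rfl⟩).trans_lt hE₀,
    fun v hv => csInf_le hbdd ⟨v, hv, rfl⟩, ?_⟩
  have hex : ∀ n : ℕ, ∃ v : EuclideanSpace ℝ (Fin N) → ℝ, IsLipC v ∧ (∀ x, 0 ≤ v x) ∧
        lipEnergy k h q s v ≤ sInf A + (1 / 4) ^ n := fun n => by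
    obtain ⟨_, ⟨v, hv, rfl⟩, hlt⟩ := exists_lt_of_csInf_lt hne
      (lt_add_of_pos_right (sInf A) (by positivity : (0 : ℝ) < (1 / 4) ^ n))
    -- This is |v|, the midpoint of v with itself, so the midpoint inequality shows that its energy
    -- is no larger.
    refine ⟨fun x => √((v x ^ 2 + v x ^ 2) / 2), hv.sqrt_add_sq_div_two hv,
      fun x => Real.sqrt_nonneg _, ?_⟩
    have := lipEnergy_midpoint hq0 hq2.le hs.le hk hk0 hh hh0 hv hv
    simp only [sub_self, norm_zero, ne_eq, OfNat.ofNat_ne_zero, not_false_eq_true, zero_pow,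
      integral_zero, mul_zero, add_zero, add_self_div_two] at this ⊢
    linarith
  choose un hun using hex
  exact ⟨un, hun⟩

/-- The midpoint of un and ul has energy at least m, so the convexity gain is bounded by the excess
of J(un) and J(ul) over m. Excess (1/4)^n gives the summable rate (1/2)^n for ∇(un²) in L², and a.e.
convergence follows without a subsequence. -/
theorem exists_minimizingLimit (hN : 3 ≤ N) (hq0 : 0 < q) (hq2 : q < 2) (hs : 2 < s)
    (hk : MemLp k ⊤ volume) (hkq : MemLp k (ENNReal.ofReal (conjExp N q)) volume)
    (hk0 : ∀ᵐ x, 0 ≤ k x) (hh : MemLp h ⊤ volume) (hh0 : ∀ᵐ x, 0 ≤ h x)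
    (hneg : ∃ u : EuclideanSpace ℝ (Fin N) → ℝ, IsLipC u ∧ lipEnergy k h q s u < 0) :
    ∃ m < 0, ∃ M un u W, IsMinimizingLimit k h q s m M un u W := by
  obtain ⟨C, hC⟩ := exists_coercive_bound (h := h) (s := s) hN hq0 hq2 hkq hk0
  obtain ⟨S, hS⟩ := exists_sobolev_const hN
  obtain ⟨S', hS'0, hS'⟩ := integral_abs_rpow_le_sobolev hN
  obtain ⟨m, hm, hmin, un, hun⟩ :=
    exists_minimizing_sequence hN hq0 hq2 hs hk hkq hk0 hh hh0 hneg
  have hL : ∀ n, IsLipC (un n) := fun n => (hun n).1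
  have hE : ∀ n, lipEnergy k h q s (un n) ≤ m + (1 / 4) ^ n := fun n => (hun n).2.2
  have hp := critExp_pos hN
  have hI1 : ∀ n, 0 ≤ ∫ x, ‖gradient (un n) x‖ ^ 2 := fun n =>
    integral_nonneg fun x => by positivity
  have hI2 : ∀ n, 0 ≤ ∫ x, un n x ^ 2 * ‖gradient (un n) x‖ ^ 2 := fun n =>
    integral_nonneg fun x => by positivity
  have hI3 : ∀ n, 0 ≤ ∫ x, h x * |un n x| ^ s := fun n => integral_nonneg_of_ae (by
      filter_upwards [hh0] with x hx; positivity)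
  have hs0 : 0 < s := by linarith
  have hbd : ∀ n, 1 / 4 * (∫ x, ‖gradient (un n) x‖ ^ 2)
      + (∫ x, un n x ^ 2 * ‖gradient (un n) x‖ ^ 2)
        + 1 / s * (∫ x, h x * |un n x| ^ s) ≤ 1 + C := fun n => by
    have h1 : ((1 : ℝ) / 4) ^ n ≤ 1 := pow_le_one₀ (by norm_num) (by norm_num)
    linarith [hC _ (hL n), hE n]
  have hI3' : ∀ n, 0 ≤ 1 / s * ∫ x, h x * |un n x| ^ s := fun n => mul_nonneg (by positivity) (hI3 n)
  set D := 1 + C with hD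
  have hD0 : 0 ≤ D := by linarith [hbd 0, hI1 0, hI2 0, hI3' 0]
  have hW : ∀ n, MemLp (sqGradient (un n)) 2 volume := fun n => (hL n).memLp_sqGradient
  -- The gain satisfies 1/16 ‖·‖² ≤ (1/4)^K, hence the norm is at most 4 (1/2)^K.
  have hcau : ∀ K n l, K ≤ n → K ≤ l →
      eLpNorm (sqGradient (un n) - sqGradient (un l)) 2 volume
        ≤ ENNReal.ofReal (4 * (1 / 2) ^ K) := by
    intro K n l hn hl
    rw [eLpNorm_two_eq ((hW n).sub (hW l))]
    refine ENNReal.ofReal_le_ofReal (Real.sqrt_le_iff.2 ⟨by positivity, ?_⟩)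
    have h1 := lipEnergy_midpoint hq0 hq2.le hs.le hk hk0 hh hh0 (hL n) (hL l)
    have h2 := hmin _ ((hL n).sqrt_add_sq_div_two (hL l))
    have h3 : ((1 : ℝ) / 4) ^ n ≤ (1 / 4) ^ K :=
      pow_le_pow_of_le_one (by norm_num) (by norm_num) hn
    have h4 : ((1 : ℝ) / 4) ^ l ≤ (1 / 4) ^ K :=
      pow_le_pow_of_le_one (by norm_num) (by norm_num) hl
    have h5 : (4 * (1 / 2 : ℝ) ^ K) ^ 2 = 16 * (1 / 4) ^ K := by
      rw [mul_pow, ← pow_mul, mul_comm K 2, pow_mul]; norm_num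
    rw [h5]
    simp only [Pi.sub_apply, sqGradient]
    linarith [hE n, hE l]
  -- The constant is doubled only to make the inequality strict.
  have hcau1 : ∀ K n l, K ≤ n → K ≤ l →
      eLpNorm (sqGradient (un n) - sqGradient (un l)) 2 volume
        < ENNReal.ofReal (8 * (1 / 2) ^ K) := fun K n l hn hl =>
    (hcau K n l hn hl).trans_lt ((ENNReal.ofReal_lt_ofReal_iff (by positivity)).2 (by
      gcongr; norm_num))
  -- Sobolev applied to un² - ul², which is Lipschitz with compact support; S + 1 keeps the bound
  -- positive even if S = 0.
  have hcau2 : ∀ K n l, K ≤ n → K ≤ l →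
      eLpNorm ((fun x => un n x ^ 2) - fun x => un l x ^ 2) (ENNReal.ofReal (critExp N)) volume
        < ENNReal.ofReal (8 * (S + 1) * (1 / 2) ^ K) := by
    intro K n l hn hl
    have h1 : IsLipC ((fun x => un n x ^ 2) - fun x => un l x ^ 2) := by
      convert (hL n).sq.add_const_mul (hL l).sq (-1) using 1
      ext x; simp; ring
    have h2 : gradient ((fun x => un n x ^ 2) - fun x => un l x ^ 2) =ᵐ[volume]
        sqGradient (un n) - sqGradient (un l) := by
      filter_upwards [(hL n).ae_differentiableAt, (hL l).ae_differentiableAt] with x hx1 hx2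
      have h3 := hasGradientAt_add_const_mul (hasGradientAt_sq hx1).differentiableAt
        (hasGradientAt_sq hx2).differentiableAt (-1)
      rw [(hasGradientAt_sq hx1).gradient, (hasGradientAt_sq hx2).gradient] at h3
      have h4 : ((fun x => un n x ^ 2) - fun x => un l x ^ 2)
          = fun y => un n y ^ 2 + -1 * un l y ^ 2 := by
        ext x; simp; ring
      rw [h4, h3.gradient]
      simp only [Pi.sub_apply, sqGradient]
      module
    refine (hS _ h1).trans_lt ?_
    rw [eLpNorm_congr_ae h2]
    calc _ ≤ (S : ℝ≥0∞) * ENNReal.ofReal (4 * (1 / 2) ^ K) := by gcongr; exact hcau K n l hn hl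
      _ = ENNReal.ofReal (S * (4 * (1 / 2) ^ K)) := by
          rw [ENNReal.ofReal_mul S.coe_nonneg, ENNReal.ofReal_coe_nnreal]
      _ < _ := by
          have h0 : (0 : ℝ) < (1 / 2) ^ K := by positivity
          have h0' := S.coe_nonneg
          refine (ENNReal.ofReal_lt_ofReal_iff (by positivity)).2 ?_
          nlinarith [mul_nonneg h0' h0.le]
  have hB1 := tsum_geometric_ofReal_ne_top (c := 8) (by norm_num)
  have hB2 := tsum_geometric_ofReal_ne_top (c := 8 * (S + 1)) (by positivity)
  obtain ⟨W, hWm, hWlim⟩ := exists_stronglyMeasurable_limit_of_tendsto_ae (fun n => (hW n).1)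
    (Lp.ae_tendsto_of_cauchy_eLpNorm (fun n => (hW n).1) one_le_two hB1 hcau1)
  have hWt := Lp.cauchy_tendsto_of_tendsto (fun n => (hW n).1) W hB1 hcau1 hWlim
  have hWL := Lp.memLp_of_cauchy_tendsto one_le_two hW W hWm.aestronglyMeasurable hWt
  have hwm : ∀ n, AEStronglyMeasurable (fun x => un n x ^ 2) volume := fun n =>
    (hL n).sq.continuous.aestronglyMeasurable
  obtain ⟨w, hwm', hwlim⟩ := exists_stronglyMeasurable_limit_of_tendsto_ae hwm
    (Lp.ae_tendsto_of_cauchy_eLpNorm hwm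
      (by rw [← ENNReal.ofReal_one]; exact ENNReal.ofReal_le_ofReal (by linarith)) hB2 hcau2)
  -- The three entries bound, in this order, both gradient integrals, the h-integral, and the
  -- critical norm through Sobolev.
  set M := max (4 * D) (max (s * D) ((S' * √(4 * D)) ^ critExp N)) with hM
  have hg4 : ∀ n, ∫ x, ‖gradient (un n) x‖ ^ 2 ≤ 4 * D := fun n => by
    linarith [hbd n, hI1 n, hI2 n, hI3' n]
  -- The limit is defined as √w with w the limit of un². The square root makes it nonnegative at
  -- every point, not just almost everywhere.
  refine ⟨m, hm, M, un, fun x => √(w x), W, ⟨hL, fun n => (hun n).2.1, hmin, ?_, fun n => ?_,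
    fun n => ?_, fun n => ?_, fun n => ?_, hwm'.measurable.sqrt, fun x => Real.sqrt_nonneg _, ?_,
    hWL, hWlim, ?_⟩⟩
  · refine tendsto_of_tendsto_of_tendsto_of_le_of_le tendsto_const_nhds ?_
      (fun n => hmin _ (hL n)) hE
    simpa using (tendsto_pow_atTop_nhds_zero_of_lt_one (r := (1 : ℝ) / 4) (by norm_num)
      (by norm_num)).const_add m
  · exact (hg4 n).trans (le_max_left _ _)
  · refine le_trans ?_ (le_max_left _ _)
    simp only [norm_sqGradient_sq, integral_const_mul]
    linarith [hbd n, hI1 n, hI2 n, hI3' n]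
  · refine le_trans ?_ ((le_max_left _ _).trans (le_max_right _ _))
    have h1 : 1 / s * (∫ x, h x * |un n x| ^ s) ≤ D := by linarith [hbd n, hI1 n, hI2 n]
    rwa [one_div, inv_mul_le_iff₀ hs0] at h1
  · refine le_trans ?_ ((le_max_right _ _).trans (le_max_right _ _))
    refine (hS' _ (hL n)).trans ?_
    gcongr
    exact hg4 n
  · filter_upwards [hwlim] with x hx
    have := (Real.continuous_sqrt.tendsto (w x)).comp hx
    refine this.congr fun n => ?_
    simp [Real.sqrt_sq ((hun n).2.1 x)]
  · have h1 : ∀ n, eLpNorm (sqGradient (un n) - W) 2 volume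
        = ENNReal.ofReal (√(∫ x, ‖sqGradient (un n) x - W x‖ ^ 2)) := fun n => by
      rw [eLpNorm_two_eq ((hW n).sub hWL)]; rfl
    simp only [h1] at hWt
    have h2 := (ENNReal.tendsto_toReal ENNReal.zero_ne_top).comp hWt
    have h3 : Tendsto (fun n => √(∫ x, ‖sqGradient (un n) x - W x‖ ^ 2)) atTop (𝓝 0) := by
      simpa [Function.comp_def, ENNReal.toReal_ofReal] using h2
    have h4 := h3.pow 2
    simp only [ne_eq, OfNat.ofNat_ne_zero, not_false_eq_true, zero_pow] at h4
    refine h4.congr fun n => Real.sq_sqrt (integral_nonneg fun x => by positivity)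

end Energy

/-! ### The weak gradient of the limit. -/

/-- The gradient `∇u = ∇(u²) / (2u)` of the limit, extended by `0` to `{u = 0}`. -/
def limitGradient (u : EuclideanSpace ℝ (Fin N) → ℝ)
    (W : EuclideanSpace ℝ (Fin N) → EuclideanSpace ℝ (Fin N)) :
    EuclideanSpace ℝ (Fin N) → EuclideanSpace ℝ (Fin N) :=
  fun x => (2 * u x)⁻¹ • W x

theorem IsTestFunction.fderiv_apply {φ : EuclideanSpace ℝ (Fin N) → ℝ} (hφ : IsTestFunction φ)
    (v : EuclideanSpace ℝ (Fin N)) : IsTestFunction fun x => fderiv ℝ φ x v :=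
  ⟨(hφ.1.fderiv_right (m := ∞) (by simp)).clm_apply contDiff_const,
    hφ.2.fderiv_apply ℝ v⟩

theorem IsTestFunction.continuous {φ : EuclideanSpace ℝ (Fin N) → ℝ} (hφ : IsTestFunction φ) :
    Continuous φ := hφ.1.continuous

theorem mul_le_eps_sq_add {ε : ℝ} (hε : 0 < ε) (a b : ℝ) :
    a * b ≤ ε * a ^ 2 + b ^ 2 / (4 * ε) := by
  have h : ε * a ^ 2 + b ^ 2 / (4 * ε) - a * b = (2 * ε * a - b) ^ 2 / (4 * ε) := by
    field_simp; ring
  rw [← sub_nonneg, h]; positivity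

theorem continuous_coord (i : Fin N) : Continuous fun y : EuclideanSpace ℝ (Fin N) => y i := by
  fun_prop

theorem abs_coord_le (y : EuclideanSpace ℝ (Fin N)) (i : Fin N) : |y i| ≤ ‖y‖ :=
  PiLp.norm_apply_le y i

theorem hasDerivAt_sqrt_sq_add {δ : ℝ} (hδ : 0 < δ) (t : ℝ) :
    HasDerivAt (fun t => √(t ^ 2 + δ ^ 2)) (t / √(t ^ 2 + δ ^ 2)) t := by
  have h := ((hasDerivAt_pow 2 t).add_const (δ ^ 2)).sqrt (by positivity)
  convert h using 1
  field_simp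
  simp [mul_comm]

theorem gradient_sqrt_sq_add {u : EuclideanSpace ℝ (Fin N) → ℝ} {x} {δ : ℝ} (hδ : 0 < δ)
    (hu : DifferentiableAt ℝ u x) :
    gradient (fun y => √(u y ^ 2 + δ ^ 2)) x = (2 * √(u x ^ 2 + δ ^ 2))⁻¹ • sqGradient u x := by
  rw [(hasGradientAt_comp (hasDerivAt_sqrt_sq_add hδ (u x)) hu.hasGradientAt).gradient, sqGradient,
    smul_smul]
  congr 1
  field_simp

namespace IsMinimizingLimit

variable {k h : EuclideanSpace ℝ (Fin N) → ℝ} {q s m M : ℝ}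
  {un : ℕ → EuclideanSpace ℝ (Fin N) → ℝ} {u : EuclideanSpace ℝ (Fin N) → ℝ}
  {W : EuclideanSpace ℝ (Fin N) → EuclideanSpace ℝ (Fin N)}

theorem lintegral_gradient_le (H : IsMinimizingLimit k h q s m M un u W) (n : ℕ) :
    ∫⁻ x, ‖gradient (un n) x‖ₑ ^ 2 ≤ ENNReal.ofReal M := by
  have h1 : ∀ x, ‖gradient (un n) x‖ₑ ^ 2 = ENNReal.ofReal (‖gradient (un n) x‖ ^ 2) := fun x => by
    rw [← ofReal_norm, ENNReal.ofReal_pow (norm_nonneg _)]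
  simp only [h1]
  rw [← ofReal_integral_eq_lintegral_ofReal (H.lipC n).integrable_gradient_sq
    (Eventually.of_forall fun x => by positivity)]
  exact ENNReal.ofReal_le_ofReal (H.bound_gradient n)

/-- Fatou's lemma for |∇un|² with |∇un| ≥ |∇(un²)|/|2un|. In extended reals the quotient is ∞ where
u = 0 and W ≠ 0, and 0 where W = 0, so finiteness of this integral also controls W on {u = 0}. -/
theorem lintegral_div_le (H : IsMinimizingLimit k h q s m M un u W) :
    ∫⁻ x, (‖W x‖ₑ / ‖2 * u x‖ₑ) ^ 2 ≤ ENNReal.ofReal M := by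
  calc ∫⁻ x, (‖W x‖ₑ / ‖2 * u x‖ₑ) ^ 2
      ≤ ∫⁻ x, liminf (fun n => ‖gradient (un n) x‖ₑ ^ 2) atTop := by
        refine lintegral_mono_ae ?_
        filter_upwards [H.ae_tendsto, H.ae_tendsto_sqGradient] with x hx hWx
        rcases eq_or_ne (W x) 0 with h0 | h0
        · simp [h0]
        · have h1 : Tendsto (fun n => (‖sqGradient (un n) x‖ₑ / ‖2 * un n x‖ₑ) ^ 2) atTop
              (𝓝 ((‖W x‖ₑ / ‖2 * u x‖ₑ) ^ 2)) := by
            refine (ENNReal.continuous_pow 2).continuousAt.tendsto.comp ?_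
            exact ENNReal.Tendsto.div hWx.enorm (Or.inl (by simpa using h0))
              (hx.const_mul 2).enorm (Or.inr (by simp))
          rw [← h1.liminf_eq]
          refine liminf_le_liminf (Eventually.of_forall fun n => ?_)
          gcongr
          rw [sqGradient, enorm_smul]
          exact ENNReal.div_le_of_le_mul (le_of_eq (mul_comm _ _))
    _ ≤ liminf (fun n => ∫⁻ x, ‖gradient (un n) x‖ₑ ^ 2) atTop :=
        lintegral_liminf_le fun n => (measurable_gradient (un n)).enorm.pow_const 2
    _ ≤ liminf (fun _ => ENNReal.ofReal M) atTop :=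
        liminf_le_liminf (Eventually.of_forall H.lintegral_gradient_le)
    _ = _ := by simp

theorem ae_eq_zero (H : IsMinimizingLimit k h q s m M un u W) :
    ∀ᵐ x, u x = 0 → W x = 0 := by
  have hm : AEMeasurable (fun x => (‖W x‖ₑ / ‖2 * u x‖ₑ) ^ 2) volume :=
    (H.memLp.1.enorm.div (H.measurable.const_mul 2).enorm.aemeasurable).pow_const 2
  filter_upwards [ae_lt_top' hm (H.lintegral_div_le.trans_lt ENNReal.ofReal_lt_top).ne]
    with x hx h0
  by_contra hW
  simp [h0, ENNReal.div_zero, hW] at hx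

theorem ae_eq_smul_limitGradient (H : IsMinimizingLimit k h q s m M un u W) :
    ∀ᵐ x, W x = (2 * u x) • limitGradient u W x := by
  filter_upwards [H.ae_eq_zero] with x hx
  rcases eq_or_ne (u x) 0 with h0 | h0
  · simp [h0, hx h0]
  · rw [limitGradient, smul_smul, mul_inv_cancel₀ (by positivity), one_smul]

theorem memLp_limitGradient (H : IsMinimizingLimit k h q s m M un u W) :
    MemLp (limitGradient u W) 2 volume := by
  refine ⟨((H.measurable.const_mul 2).inv.aestronglyMeasurable).smul H.memLp.1, ?_⟩
  rw [eLpNorm_lt_top_iff_lintegral_rpow_enorm_lt_top two_ne_zero ENNReal.ofNat_ne_top]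
  refine lt_of_le_of_lt ?_ (H.lintegral_div_le.trans_lt ENNReal.ofReal_lt_top)
  refine lintegral_mono fun x => ?_
  rw [ENNReal.toReal_ofNat, ENNReal.rpow_ofNat]
  gcongr
  rw [limitGradient]
  rcases eq_or_ne (u x) 0 with h0 | h0
  · simp [h0]
  · rw [enorm_smul, enorm_inv (by positivity), mul_comm, ENNReal.div_eq_inv_mul, mul_comm]

theorem ae_tendsto_gradient (H : IsMinimizingLimit k h q s m M un u W) :
    ∀ᵐ x, u x ≠ 0 → Tendsto (fun n => gradient (un n) x) atTop (𝓝 (limitGradient u W x)) := by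
  filter_upwards [H.ae_tendsto, H.ae_tendsto_sqGradient] with x hx hWx h0
  have h1 : Tendsto (fun n => (2 * un n x)⁻¹ • sqGradient (un n) x) atTop
      (𝓝 (limitGradient u W x)) := ((hx.const_mul 2).inv₀ (by positivity)).smul hWx
  refine h1.congr' ?_
  filter_upwards [hx.eventually_ne h0] with n hn
  rw [sqGradient, smul_smul, inv_mul_cancel₀ (by positivity), one_smul]

theorem integrable_abs_rpow_critExp (H : IsMinimizingLimit k h q s m M un u W) (hN : 3 ≤ N) :
    Integrable (fun x => |u x| ^ critExp N) volume := by
  have hp := critExp_pos hN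
  refine (integral_le_of_ae_tendsto (f := fun n x => |un n x| ^ critExp N) (c := fun _ => M)
    (fun n => (H.lipC n).integrable_abs_rpow (by linarith))
    (fun n => Eventually.of_forall fun x => by positivity) ?_ H.bound_critExp
    tendsto_const_nhds).1
  filter_upwards [H.ae_tendsto] with x hx
  exact hx.abs.rpow_const (Or.inr (by linarith))

theorem memLp_critExp (H : IsMinimizingLimit k h q s m M un u W) (hN : 3 ≤ N) :
    MemLp u (ENNReal.ofReal (critExp N)) volume := by
  have hp := critExp_pos hN
  rw [← integrable_norm_rpow_iff H.measurable.aestronglyMeasurable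
    (by simp; linarith) ENNReal.ofReal_ne_top, ENNReal.toReal_ofReal (by linarith)]
  exact H.integrable_abs_rpow_critExp hN

theorem locallyIntegrable (H : IsMinimizingLimit k h q s m M un u W) (hN : 3 ≤ N) :
    LocallyIntegrable u volume :=
  (H.memLp_critExp hN).locallyIntegrable (by
    rw [← ENNReal.ofReal_one]
    exact ENNReal.ofReal_le_ofReal (by linarith [critExp_pos hN]))

/-- By Young, |un||ψ| is at most ε|un|^{2*} plus a fixed integrable function, so the bound on the
critical norm allows passage to the limit although no dominating function for un is at hand. -/
theorem tendsto_integral_mul (H : IsMinimizingLimit k h q s m M un u W) (hN : 3 ≤ N)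
    {ψ : EuclideanSpace ℝ (Fin N) → ℝ} (hψ : Continuous ψ) (hψc : HasCompactSupport ψ)
    {vn : ℕ → EuclideanSpace ℝ (Fin N) → ℝ} {v : EuclideanSpace ℝ (Fin N) → ℝ} {δ : ℝ}
    (hvm : ∀ n, Continuous (vn n)) (hvb : ∀ n x, |vn n x| ≤ |un n x| + δ)
    (hlim : ∀ᵐ x, Tendsto (fun n => vn n x) atTop (𝓝 (v x))) :
    Tendsto (fun n => ∫ x, vn n x * ψ x) atTop (𝓝 (∫ x, v x * ψ x)) := by
  have hp := critExp_pos hN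
  refine (tendsto_integral_of_forall_eps (g := fun n x => |un n x| ^ critExp N) (M := M)
    (fun n => ((hvm n).mul hψ).aestronglyMeasurable) ?_
    (fun n => (H.lipC n).integrable_abs_rpow (by linarith))
    (fun n => Eventually.of_forall fun x => by positivity) H.bound_critExp fun ε hε => ?_).2
  · filter_upwards [hlim] with x hx
    exact hx.mul_const _
  · obtain ⟨C, hC0, hC⟩ := exists_rpow_mul_le (a := 1) (p := critExp N) one_pos (by linarith) hε
    have hr : 0 < critExp N / (critExp N - 1) := div_pos (by linarith) (by linarith)
    have h1 : Continuous fun x => |ψ x| ^ (critExp N / (critExp N - 1)) :=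
      hψ.abs.rpow_const fun _ => Or.inr hr.le
    refine ⟨fun x => C * |ψ x| ^ (critExp N / (critExp N - 1)) + δ * |ψ x|, ?_, fun n =>
      Eventually.of_forall fun x => ?_⟩
    · exact ((h1.integrable_of_hasCompactSupport (hψc.comp_left
        (g := fun t : ℝ => |t| ^ (critExp N / (critExp N - 1))) (by simp [hr.ne']))).const_mul
        C).add ((hψ.integrable_of_hasCompactSupport hψc).abs.const_mul δ)
    · have h2 := hC |un n x| |ψ x| (abs_nonneg _) (abs_nonneg _)
      rw [Real.rpow_one] at h2
      rw [Pi.mul_apply, abs_mul]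
      have h3 := mul_le_mul_of_nonneg_right (hvb n x) (abs_nonneg (ψ x))
      linarith

theorem tendsto_integral_coord_mul (H : IsMinimizingLimit k h q s m M un u W)
    {ψ : EuclideanSpace ℝ (Fin N) → ℝ} (hψ : Continuous ψ) (hψc : HasCompactSupport ψ) (i : Fin N)
    {cn : ℕ → EuclideanSpace ℝ (Fin N) → ℝ} {c : EuclideanSpace ℝ (Fin N) → ℝ} {K : ℝ}
    (hcm : ∀ n, Continuous (cn n)) (hcb : ∀ n x, |cn n x| ≤ K)
    (hlim : ∀ᵐ x, Tendsto (fun n => cn n x) atTop (𝓝 (c x))) :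
    Tendsto (fun n => ∫ x, cn n x * sqGradient (un n) x i * ψ x) atTop
      (𝓝 (∫ x, c x * W x i * ψ x)) := by
  refine (tendsto_integral_of_forall_eps (g := fun n x => ‖sqGradient (un n) x‖ ^ 2) (M := M)
    (fun n => ?_) ?_ (fun n => (H.lipC n).integrable_sqGradient_sq)
    (fun n => Eventually.of_forall fun x => by positivity) H.bound_sqGradient fun ε hε => ?_).2
  · have h1 : AEStronglyMeasurable (fun x => sqGradient (un n) x i) volume :=
      (continuous_coord i).comp_aestronglyMeasurable (H.lipC n).aestronglyMeasurable_sqGradient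
    exact ((hcm n).aestronglyMeasurable.mul h1).mul hψ.aestronglyMeasurable
  · filter_upwards [hlim, H.ae_tendsto_sqGradient] with x hx hWx
    have h1 : Tendsto (fun n => sqGradient (un n) x i) atTop (𝓝 (W x i)) :=
      ((continuous_coord i).tendsto (W x)).comp hWx
    exact (hx.mul h1).mul_const (ψ x)
  · refine ⟨fun x => K ^ 2 / (4 * ε) * ψ x ^ 2, ?_, fun n => Eventually.of_forall fun x => ?_⟩
    · have h1 : Continuous fun x => ψ x ^ 2 := hψ.pow 2
      have h2 : HasCompactSupport fun x => ψ x ^ 2 :=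
        hψc.comp_left (g := fun t : ℝ => t ^ 2) (zero_pow two_ne_zero)
      exact (h1.integrable_of_hasCompactSupport h2).const_mul _
    · have h4 : |sqGradient (un n) x i| ≤ ‖sqGradient (un n) x‖ :=
        abs_coord_le _ i
      have hK := hcb n x
      have hK0 : 0 ≤ K := (abs_nonneg _).trans hK
      have h5 := mul_le_eps_sq_add hε ‖sqGradient (un n) x‖ (K * |ψ x|)
      rw [abs_mul, abs_mul]
      have h6 : |cn n x| * |sqGradient (un n) x i| * |ψ x|
          ≤ K * ‖sqGradient (un n) x‖ * |ψ x| := by gcongr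
      refine h6.trans ((le_of_eq (by ring)).trans (h5.trans (le_of_eq ?_)))
      rw [mul_pow, sq_abs]; ring

/-- The regularisation √(u² + δ²) has gradient ∇(u²)/(2√(u² + δ²)), whose coefficient is bounded by
1/(2δ). The limit n → ∞ therefore needs only the convergence of un and ∇(un²), not that of ∇un. -/
theorem integral_sqrt_mul_fderiv (H : IsMinimizingLimit k h q s m M un u W) (hN : 3 ≤ N)
    {ψ : EuclideanSpace ℝ (Fin N) → ℝ} (hψ : IsTestFunction ψ) (i : Fin N) {δ : ℝ} (hδ : 0 < δ) :
    ∫ x, √(u x ^ 2 + δ ^ 2) * fderiv ℝ ψ x (EuclideanSpace.single i 1)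
      = -∫ x, (2 * √(u x ^ 2 + δ ^ 2))⁻¹ * W x i * ψ x := by
  have hL : ∀ n, ∃ C, LipschitzWith C fun x => √(un n x ^ 2 + δ ^ 2) := fun n => by
    obtain ⟨C, hC⟩ := (H.lipC n).lip
    refine ⟨C, LipschitzWith.of_dist_le_mul fun x y => ?_⟩
    refine (abs_sqrt_add_sq_sub_le _ _ _ _).trans ?_
    simpa [Real.dist_eq] using hC.dist_le_mul x y
  have hc : ∀ n, Continuous fun x => √(un n x ^ 2 + δ ^ 2) := fun n =>
    (hL n).choose_spec.continuous
  have hbd : ∀ t : ℝ, δ ≤ √(t ^ 2 + δ ^ 2) := fun t =>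
    Real.le_sqrt_of_sq_le (by linarith [sq_nonneg t])
  have h1 : Tendsto (fun n => ∫ x, √(un n x ^ 2 + δ ^ 2) *
      fderiv ℝ ψ x (EuclideanSpace.single i 1)) atTop
      (𝓝 (∫ x, √(u x ^ 2 + δ ^ 2) * fderiv ℝ ψ x (EuclideanSpace.single i 1))) := by
    refine H.tendsto_integral_mul hN (hψ.fderiv_apply _).continuous (hψ.fderiv_apply _).2
      (δ := δ) hc (fun n x => ?_) ?_
    · rw [abs_of_nonneg (Real.sqrt_nonneg _)]
      refine Real.sqrt_le_iff.2 ⟨by positivity, ?_⟩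
      have := sq_abs (un n x)
      nlinarith [mul_nonneg (abs_nonneg (un n x)) hδ.le]
    · filter_upwards [H.ae_tendsto] with x hx
      exact ((hx.pow 2).add_const _).sqrt
  have h2 : Tendsto (fun n => ∫ x, (2 * √(un n x ^ 2 + δ ^ 2))⁻¹ * sqGradient (un n) x i * ψ x)
      atTop (𝓝 (∫ x, (2 * √(u x ^ 2 + δ ^ 2))⁻¹ * W x i * ψ x)) := by
    refine H.tendsto_integral_coord_mul hψ.continuous hψ.2 i
      (fun n => Continuous.inv₀ ((hc n).const_mul 2) fun x => ?_) (K := (2 * δ)⁻¹)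
      (fun n x => ?_) ?_
    · have := hbd (un n x)
      have : 0 < √(un n x ^ 2 + δ ^ 2) := by linarith
      positivity
    · rw [abs_of_nonneg (by positivity)]
      have := hbd (un n x)
      gcongr
    · filter_upwards [H.ae_tendsto] with x hx
      refine Tendsto.inv₀ ((((hx.pow 2).add_const _).sqrt).const_mul 2) ?_
      have := hbd (u x)
      have : 0 < √(u x ^ 2 + δ ^ 2) := by linarith
      positivity
  refine tendsto_nhds_unique h1 ?_
  refine h2.neg.congr fun n => ?_
  rw [(hasWeakGradient_of_lipschitz (hL n)).integral_eq ψ hψ i]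
  congr 1
  refine integral_congr_ae ?_
  filter_upwards [(H.lipC n).ae_differentiableAt] with x hx
  rw [gradient_sqrt_sq_add hδ hx]
  simp

/-- Let δ → 0 in the regularised identity. Since W = 0 a.e. on {u = 0}, the regularised gradients
are dominated by |W/(2u)| there too. -/
theorem hasWeakGradient (H : IsMinimizingLimit k h q s m M un u W) (hN : 3 ≤ N) :
    HasWeakGradient u (limitGradient u W) := by
  have hGl : LocallyIntegrable (limitGradient u W) volume :=
    H.memLp_limitGradient.locallyIntegrable one_le_two
  refine ⟨H.locallyIntegrable hN, hGl, fun ψ hψ i => ?_⟩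
  have hδ : Tendsto (fun n : ℕ => 1 / ((n : ℝ) + 1)) atTop (𝓝 0) :=
    tendsto_one_div_add_atTop_nhds_zero_nat
  have hsq : ∀ x, Tendsto (fun n : ℕ => √(u x ^ 2 + (1 / ((n : ℝ) + 1)) ^ 2)) atTop (𝓝 (u x)) := by
    intro x
    have := ((hδ.pow 2).const_add (u x ^ 2)).sqrt
    simpa [Real.sqrt_sq (H.limit_nonneg x)] using this
  have hd1 : ∀ n : ℕ, 1 / ((n : ℝ) + 1) ≤ 1 := fun n => by
    rw [div_le_one (by positivity)]
    linarith [(n.cast_nonneg : (0 : ℝ) ≤ n)]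
  have hGm : AEStronglyMeasurable (fun x => limitGradient u W x i) volume :=
    (continuous_coord i).comp_aestronglyMeasurable H.memLp_limitGradient.1
  have hWm : AEStronglyMeasurable (fun x => W x i) volume :=
    (continuous_coord i).comp_aestronglyMeasurable H.memLp.1
  have h1 : Tendsto (fun n : ℕ => ∫ x, √(u x ^ 2 + (1 / ((n : ℝ) + 1)) ^ 2) *
      fderiv ℝ ψ x (EuclideanSpace.single i 1)) atTop
      (𝓝 (∫ x, u x * fderiv ℝ ψ x (EuclideanSpace.single i 1))) := by
    have hψ' := hψ.fderiv_apply (EuclideanSpace.single i 1)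
    refine tendsto_integral_of_dominated_convergence
      (fun x => (u x + 1) * |fderiv ℝ ψ x (EuclideanSpace.single i 1)|) (fun n => ?_) ?_
      (fun n => Eventually.of_forall fun x => ?_) (Eventually.of_forall fun x => ?_)
    · exact (((H.measurable.pow_const 2).add_const _).sqrt.aestronglyMeasurable).mul
        hψ'.continuous.aestronglyMeasurable
    · exact ((H.locallyIntegrable hN).add (locallyIntegrable_const 1))
        |>.integrable_smul_right_of_hasCompactSupport hψ'.continuous.abs
          (hψ'.2.comp_left (g := fun t : ℝ => |t|) abs_zero)
    · rw [Real.norm_eq_abs, abs_mul, abs_of_nonneg (Real.sqrt_nonneg _)]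
      refine mul_le_mul_of_nonneg_right ?_ (abs_nonneg _)
      have h0 := H.limit_nonneg x
      have h2 : (0 : ℝ) ≤ 1 / ((n : ℝ) + 1) := by positivity
      refine Real.sqrt_le_iff.2 ⟨by positivity, ?_⟩
      nlinarith [hd1 n]
    · exact (hsq x).mul_const _
  have h2 : Tendsto (fun n : ℕ => ∫ x, (2 * √(u x ^ 2 + (1 / ((n : ℝ) + 1)) ^ 2))⁻¹ * W x i * ψ x)
      atTop (𝓝 (∫ x, limitGradient u W x i * ψ x)) := by
    refine tendsto_integral_of_dominated_convergence
      (fun x => ‖limitGradient u W x‖ * |ψ x|) (fun n => ?_) ?_ (fun n => ?_) ?_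
    · exact ((((H.measurable.pow_const 2).add_const _).sqrt.const_mul
        2).inv.aestronglyMeasurable.mul hWm).mul hψ.continuous.aestronglyMeasurable
    · have h3 := (hGl.integrable_smul_left_of_hasCompactSupport hψ.continuous hψ.2).norm
      simpa only [norm_smul, mul_comm, Real.norm_eq_abs] using h3
    · filter_upwards [H.ae_eq_zero] with x hx
      rw [Real.norm_eq_abs, abs_mul]
      refine mul_le_mul_of_nonneg_right ?_ (abs_nonneg _)
      rcases (H.limit_nonneg x).eq_or_lt with h0 | h0
      · simp [hx h0.symm]
      · rw [limitGradient, norm_smul, abs_mul, Real.norm_eq_abs]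
        have h3 : u x ≤ √(u x ^ 2 + (1 / ((n : ℝ) + 1)) ^ 2) :=
          Real.le_sqrt_of_sq_le (by linarith [sq_nonneg (1 / ((n : ℝ) + 1))])
        refine mul_le_mul ?_ (abs_coord_le _ i) (abs_nonneg _) (abs_nonneg _)
        rw [abs_of_nonneg (by positivity), abs_of_pos (by positivity)]
        gcongr
    · filter_upwards [H.ae_eq_zero] with x hx
      rcases (H.limit_nonneg x).eq_or_lt with h0 | h0
      · simp [limitGradient, hx h0.symm]
      · exact ((((hsq x).const_mul 2).inv₀ (by positivity)).mul_const (W x i)).mul_const (ψ x)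
  refine tendsto_nhds_unique h1 (h2.neg.congr fun n => ?_)
  exact (H.integral_sqrt_mul_fderiv hN hψ i (by positivity)).symm

end IsMinimizingLimit

/-! ### Convergence of the terms of the first variation. -/

/-- Continuous functions with compact support `ψ` give integrable powers `|ψ|^p`. -/
theorem integrable_abs_rpow_of_hasCompactSupport {ψ : EuclideanSpace ℝ (Fin N) → ℝ}
    (hψ : Continuous ψ) (hψc : HasCompactSupport ψ) {p : ℝ} (hp : 0 < p) :
    Integrable (fun x => |ψ x| ^ p) volume := by
  have h1 : Continuous fun x => |ψ x| ^ p := hψ.abs.rpow_const fun _ => Or.inr hp.le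
  exact h1.integrable_of_hasCompactSupport
    (hψc.comp_left (g := fun t : ℝ => |t| ^ p) (by simp [hp.ne']))

theorem IsTestFunction.continuous_gradient {φ : EuclideanSpace ℝ (Fin N) → ℝ}
    (hφ : IsTestFunction φ) : Continuous (gradient φ) :=
  (InnerProductSpace.toDual ℝ _).symm.continuous.comp (hφ.1.continuous_fderiv (by simp))

theorem IsTestFunction.hasCompactSupport_norm_gradient {φ : EuclideanSpace ℝ (Fin N) → ℝ}
    (hφ : IsTestFunction φ) : HasCompactSupport fun x => ‖gradient φ x‖ := by
  refine hφ.2.mono' fun x hx => ?_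
  by_contra h
  exact hx (by simp [gradient_eq_zero_of_notMem h])

/-- The Laplacian `∑ ∂ᵢ∂ᵢφ`. -/
def coordLaplacian (φ : EuclideanSpace ℝ (Fin N) → ℝ) (x : EuclideanSpace ℝ (Fin N)) : ℝ :=
  ∑ i, fderiv ℝ (fun y => fderiv ℝ φ y (EuclideanSpace.single i 1)) x (EuclideanSpace.single i 1)

theorem IsTestFunction.sum {ι : Type*} {s : Finset ι}
    {f : ι → EuclideanSpace ℝ (Fin N) → ℝ} (hf : ∀ i, IsTestFunction (f i)) :
    IsTestFunction fun x => ∑ i ∈ s, f i x := by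
  refine ⟨ContDiff.sum fun i _ => (hf i).1, ?_⟩
  classical
  induction s using Finset.induction_on with
  | empty =>
    simp only [Finset.sum_empty]
    exact HasCompactSupport.zero
  | insert i s his ih =>
    simp only [Finset.sum_insert his]
    exact (hf i).2.add ih

theorem IsTestFunction.coordLaplacian {φ : EuclideanSpace ℝ (Fin N) → ℝ}
    (hφ : IsTestFunction φ) : IsTestFunction (coordLaplacian φ) :=
  IsTestFunction.sum fun _ => (hφ.fderiv_apply _).fderiv_apply _

/-- Weak gradients are tested against gradients of test functions by integration by parts. -/
theorem HasWeakGradient.integral_inner_gradient {u : EuclideanSpace ℝ (Fin N) → ℝ}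
    {G : EuclideanSpace ℝ (Fin N) → EuclideanSpace ℝ (Fin N)} (hG : HasWeakGradient u G)
    {φ : EuclideanSpace ℝ (Fin N) → ℝ} (hφ : IsTestFunction φ) :
    ∫ x, inner ℝ (G x) (gradient φ x) = -∫ x, u x * coordLaplacian φ x := by
  have hG' : ∀ i : Fin N, Integrable (fun x => G x i * fderiv ℝ φ x (EuclideanSpace.single i 1))
      volume := fun i => by
    have hφ' := hφ.fderiv_apply (EuclideanSpace.single i 1)
    have h := hG.locallyIntegrable_grad.integrable_smul_left_of_hasCompactSupport
      hφ'.continuous hφ'.2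
    refine h.mono (((continuous_coord i).comp_aestronglyMeasurable
      hG.locallyIntegrable_grad.aestronglyMeasurable).mul hφ'.continuous.aestronglyMeasurable)
      (Eventually.of_forall fun x => ?_)
    rw [norm_smul, norm_mul, mul_comm]
    exact mul_le_mul_of_nonneg_left (abs_coord_le _ i) (norm_nonneg _)
  have hu' : ∀ i : Fin N, Integrable (fun x => u x * fderiv ℝ
      (fun y => fderiv ℝ φ y (EuclideanSpace.single i 1)) x (EuclideanSpace.single i 1))
      volume := fun i => by
    have hφ' := (hφ.fderiv_apply (EuclideanSpace.single i 1)).fderiv_apply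
      (EuclideanSpace.single i 1)
    exact hG.locallyIntegrable.integrable_smul_right_of_hasCompactSupport hφ'.continuous hφ'.2
  simp only [QuasilinearSchrodinger.coordLaplacian, Finset.mul_sum]
  rw [integral_finsetSum _ fun i _ => hu' i, ← Finset.sum_neg_distrib]
  have h1 : ∀ x, inner ℝ (G x) (gradient φ x)
      = ∑ i, G x i * fderiv ℝ φ x (EuclideanSpace.single i 1) := fun x => by
    rw [PiLp.inner_apply]
    refine Finset.sum_congr rfl fun i _ => ?_
    rw [gradient_apply]
    simp [mul_comm]
  simp only [h1]
  rw [integral_finsetSum _ fun i _ => hG' i]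
  refine Finset.sum_congr rfl fun i _ => ?_
  rw [hG.integral_eq _ (hφ.fderiv_apply _) i, neg_neg]

/-- Expansion of the gradient term of the energy in a direction `(b, p)`. -/
theorem energy_density_add_le {a b t : ℝ} {g p : EuclideanSpace ℝ (Fin N)} (ht : |t| ≤ 1) :
    1 / 2 * ((1 + 2 * (a + t * b) ^ 2) * ‖g + t • p‖ ^ 2) ≤
      1 / 2 * ((1 + 2 * a ^ 2) * ‖g‖ ^ 2)
      + t * (inner ℝ g p + a * inner ℝ ((2 * a) • g) p + b * inner ℝ ((2 * a) • g) g)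
      + t ^ 2 * (4 * ((1 + b ^ 2) * ‖p‖ ^ 2 + a ^ 2 * ‖p‖ ^ 2 + b ^ 2 * ‖g‖ ^ 2)) := by
  have h1 : ‖g + t • p‖ ^ 2 = ‖g‖ ^ 2 + 2 * t * inner ℝ g p + t ^ 2 * ‖p‖ ^ 2 := by
    rw [norm_add_sq_real, inner_smul_right, norm_smul, mul_pow, Real.norm_eq_abs, sq_abs]; ring
  have h2 : |inner ℝ g p| ≤ ‖g‖ * ‖p‖ := abs_real_inner_le_norm g p
  rw [h1, real_inner_smul_left, real_inner_smul_left, real_inner_self_eq_norm_sq]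
  generalize inner ℝ g p = I at h2 ⊢
  have hI1 : |a * b * I| ≤ (a ^ 2 * ‖p‖ ^ 2 + b ^ 2 * ‖g‖ ^ 2) / 2 := by
    rw [abs_mul]
    have : |a * b| * |I| ≤ |a * b| * (‖g‖ * ‖p‖) := by gcongr
    rw [abs_mul] at this ⊢
    nlinarith [sq_nonneg (|a| * ‖p‖ - |b| * ‖g‖), sq_abs a, sq_abs b]
  have hI2 : |I| ≤ (‖g‖ ^ 2 + ‖p‖ ^ 2) / 2 := h2.trans (by nlinarith [sq_nonneg (‖g‖ - ‖p‖)])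
  have hab : |a * b| ≤ (a ^ 2 + b ^ 2) / 2 := by
    rw [abs_mul]; nlinarith [sq_nonneg (|a| - |b|), sq_abs a, sq_abs b]
  -- All terms of order at least two in t, divided by t². The bound |t| ≤ 1 disposes of the
  -- remaining powers of t.
  have key : 1 / 2 * ((1 + 2 * a ^ 2) * ‖p‖ ^ 2 + 8 * (a * b * I) + 2 * b ^ 2 * ‖g‖ ^ 2
      + t * (4 * (a * b) * ‖p‖ ^ 2 + 4 * b ^ 2 * I) + t ^ 2 * (2 * b ^ 2 * ‖p‖ ^ 2))
      ≤ 4 * ((1 + b ^ 2) * ‖p‖ ^ 2 + a ^ 2 * ‖p‖ ^ 2 + b ^ 2 * ‖g‖ ^ 2) := by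
    have e1 : t * (4 * (a * b) * ‖p‖ ^ 2 + 4 * b ^ 2 * I)
        ≤ 4 * ((a ^ 2 + b ^ 2) / 2) * ‖p‖ ^ 2 + 4 * b ^ 2 * ((‖g‖ ^ 2 + ‖p‖ ^ 2) / 2) := by
      calc _ ≤ |t * (4 * (a * b) * ‖p‖ ^ 2 + 4 * b ^ 2 * I)| := le_abs_self _
        _ ≤ 1 * |4 * (a * b) * ‖p‖ ^ 2 + 4 * b ^ 2 * I| := by rw [abs_mul]; gcongr
        _ ≤ |4 * (a * b) * ‖p‖ ^ 2| + |4 * b ^ 2 * I| := by rw [one_mul]; exact abs_add_le _ _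
        _ = 4 * |a * b| * ‖p‖ ^ 2 + 4 * b ^ 2 * |I| := by
            rw [abs_mul, abs_mul, abs_mul (4 * b ^ 2), abs_of_nonneg (by positivity : 0 ≤ ‖p‖ ^ 2),
              abs_of_nonneg (by positivity : 0 ≤ 4 * b ^ 2), abs_of_pos (by norm_num : (0 : ℝ) < 4)]
        _ ≤ _ := by gcongr
    have e2 : t ^ 2 * (2 * b ^ 2 * ‖p‖ ^ 2) ≤ 1 * (2 * b ^ 2 * ‖p‖ ^ 2) := by
      gcongr
      rw [← sq_abs]; exact pow_le_one₀ (abs_nonneg t) ht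
    have e3 := (le_abs_self _).trans hI1
    nlinarith [sq_nonneg (b * ‖p‖), sq_nonneg ‖p‖, sq_nonneg (a * ‖p‖)]
  have := mul_le_mul_of_nonneg_left key (sq_nonneg t)
  linarith

/-- Convergence of `∫ g (|un + t φ|^p - |un|^p)`. -/
theorem tendsto_integral_abs_rpow_sub {un : ℕ → EuclideanSpace ℝ (Fin N) → ℝ}
    {u φ g : EuclideanSpace ℝ (Fin N) → ℝ} {p M : ℝ} (hp : 1 < p) (hun : ∀ n, IsLipC (un n))
    (hφ : IsLipC φ) (hg : MemLp g ⊤ volume) (hg0 : ∀ᵐ x, 0 ≤ g x)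
    (hM : ∀ n, ∫ x, g x * |un n x| ^ p ≤ M)
    (hlim : ∀ᵐ x, Tendsto (fun n => un n x) atTop (𝓝 (u x))) (t : ℝ) :
    Tendsto (fun n => ∫ x, g x * (|un n x + t * φ x| ^ p - |un n x| ^ p)) atTop
      (𝓝 (∫ x, g x * (|u x + t * φ x| ^ p - |u x| ^ p))) := by
  have hp0 : 0 < p := by linarith
  have htφ : IsLipC fun x => 0 + t * φ x := by
    have h0 : IsLipC (fun _ : EuclideanSpace ℝ (Fin N) => (0 : ℝ)) :=
      ⟨⟨0, LipschitzWith.const 0⟩, HasCompactSupport.zero⟩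
    exact h0.add_const_mul hφ t
  simp only [zero_add] at htφ
  refine (tendsto_integral_of_forall_eps (g := fun n x => g x * |un n x| ^ p) (M := M)
    (fun n => ?_) ?_ (fun n => (hun n).integrable_mul_abs_rpow hg hp0) (fun n => ?_) hM
    fun ε hε => ?_).2
  · have h1 : Continuous fun x => |un n x + t * φ x| ^ p - |un n x| ^ p :=
      (((hun n).add_const_mul hφ t).continuous.abs.rpow_const fun _ => Or.inr hp0.le).sub
        ((hun n).continuous.abs.rpow_const fun _ => Or.inr hp0.le)
    exact hg.1.mul h1.aestronglyMeasurable
  · filter_upwards [hlim] with x hx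
    exact (((hx.add_const _).abs.rpow_const (Or.inr hp0.le)).sub
      (hx.abs.rpow_const (Or.inr hp0.le))).const_mul _
  · filter_upwards [hg0] with x hx
    positivity
  -- The difference of powers is at most ε|un|^p plus a fixed integrable function of φ, so it
  -- converges even when ∫ g|un|^p itself is merely bounded.
  · obtain ⟨C, hC0, hC⟩ := exists_abs_rpow_sub_le hp hε
    refine ⟨fun x => C * (g x * |t * φ x| ^ p), (htφ.integrable_mul_abs_rpow hg hp0).const_mul C,
      fun n => ?_⟩
    filter_upwards [hg0] with x hx
    rw [abs_mul, abs_of_nonneg hx]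
    refine (mul_le_mul_of_nonneg_left (hC (un n x) (t * φ x)) hx).trans (le_of_eq (by ring))

namespace IsMinimizingLimit

variable {k h : EuclideanSpace ℝ (Fin N) → ℝ} {q s m M : ℝ}
  {un : ℕ → EuclideanSpace ℝ (Fin N) → ℝ} {u : EuclideanSpace ℝ (Fin N) → ℝ}
  {W : EuclideanSpace ℝ (Fin N) → EuclideanSpace ℝ (Fin N)}

/-- Integrating by parts once more moves the gradient onto φ, which reduces the claim to the
convergence of un tested against the Laplacian of φ. -/
theorem tendsto_integral_inner_gradient (H : IsMinimizingLimit k h q s m M un u W) (hN : 3 ≤ N)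
    {φ : EuclideanSpace ℝ (Fin N) → ℝ} (hφ : IsTestFunction φ) :
    Tendsto (fun n => ∫ x, inner ℝ (gradient (un n) x) (gradient φ x)) atTop
      (𝓝 (∫ x, inner ℝ (limitGradient u W x) (gradient φ x))) := by
  rw [(H.hasWeakGradient hN).integral_inner_gradient hφ]
  simp only [fun n => (hasWeakGradient_of_lipschitz (H.lipC n).lip).integral_inner_gradient hφ]
  exact (H.tendsto_integral_mul hN (δ := 0) hφ.coordLaplacian.continuous hφ.coordLaplacian.2
    (fun n => (H.lipC n).continuous) (fun n x => by simp) H.ae_tendsto).neg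

/-- Young is used twice: first to split off ε|∇(un²)|², then to bound un²|∇φ|²/(4ε) by ε|un|^{2*}
plus a fixed integrable function. -/
theorem tendsto_integral_mul_inner (H : IsMinimizingLimit k h q s m M un u W) (hN : 3 ≤ N)
    {φ : EuclideanSpace ℝ (Fin N) → ℝ} (hφ : IsTestFunction φ) :
    Tendsto (fun n => ∫ x, un n x * inner ℝ (sqGradient (un n) x) (gradient φ x)) atTop
      (𝓝 (∫ x, u x * inner ℝ (W x) (gradient φ x))) := by
  have hp := critExp_pos hN
  have hL := hφ.isLipC
  refine (tendsto_integral_of_forall_eps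
    (g := fun n x => ‖sqGradient (un n) x‖ ^ 2 + |un n x| ^ critExp N) (M := M + M)
    (fun n => ?_) ?_ (fun n => (H.lipC n).integrable_sqGradient_sq.add
      ((H.lipC n).integrable_abs_rpow (by linarith)))
    (fun n => Eventually.of_forall fun x => by positivity) (fun n => ?_) fun ε hε => ?_).2
  · exact (H.lipC n).continuous.aestronglyMeasurable.mul
      ((H.lipC n).aestronglyMeasurable_sqGradient.inner
        (measurable_gradient φ).aestronglyMeasurable)
  · filter_upwards [H.ae_tendsto, H.ae_tendsto_sqGradient] with x hx hWx
    exact hx.mul (hWx.inner tendsto_const_nhds)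
  · rw [integral_add (H.lipC n).integrable_sqGradient_sq
      ((H.lipC n).integrable_abs_rpow (by linarith))]
    exact add_le_add (H.bound_sqGradient n) (H.bound_critExp n)
  · obtain ⟨C, hC0, hC⟩ := exists_rpow_mul_le (a := 2) (p := critExp N) two_pos hp hε
    have hr : 0 < critExp N / (critExp N - 2) := div_pos (by linarith) (by linarith)
    have h1 : Continuous fun x => ‖gradient φ x‖ ^ 2 / (4 * ε) :=
      (hφ.continuous_gradient.norm.pow 2).div_const _
    have h2 : HasCompactSupport fun x => ‖gradient φ x‖ ^ 2 / (4 * ε) :=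
      hφ.hasCompactSupport_norm_gradient.comp_left (g := fun t : ℝ => t ^ 2 / (4 * ε)) (by simp)
    refine ⟨fun x => C * |‖gradient φ x‖ ^ 2 / (4 * ε)| ^ (critExp N / (critExp N - 2)),
      (integrable_abs_rpow_of_hasCompactSupport h1 h2 hr).const_mul C,
      fun n => Eventually.of_forall fun x => ?_⟩
    have h3 := mul_le_eps_sq_add hε ‖sqGradient (un n) x‖ (|un n x| * ‖gradient φ x‖)
    have h4 := hC |un n x| |‖gradient φ x‖ ^ 2 / (4 * ε)| (abs_nonneg _) (abs_nonneg _)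
    have h5 : (|un n x| * ‖gradient φ x‖) ^ 2 / (4 * ε)
        = |un n x| ^ (2 : ℝ) * |‖gradient φ x‖ ^ 2 / (4 * ε)| := by
      rw [abs_of_nonneg (a := ‖gradient φ x‖ ^ 2 / (4 * ε)) (by positivity), Real.rpow_two]; ring
    rw [abs_mul]
    have h6 : |un n x| * |inner ℝ (sqGradient (un n) x) (gradient φ x)|
        ≤ |un n x| * (‖sqGradient (un n) x‖ * ‖gradient φ x‖) := by
      gcongr; exact abs_real_inner_le_norm _ _
    simp only
    linarith

/-- Write ∇(un²) = W + (∇(un²) - W). With W fixed, ∇un converges pointwise on {u ≠ 0}, and W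
vanishes a.e. elsewhere. The remainder tends to 0 because ∇(un²) → W in L² while ∇un stays bounded
in L². -/
theorem tendsto_integral_mul_inner_gradient (H : IsMinimizingLimit k h q s m M un u W)
    {φ : EuclideanSpace ℝ (Fin N) → ℝ} (hφ : IsLipC φ) :
    Tendsto (fun n => ∫ x, φ x * inner ℝ (sqGradient (un n) x) (gradient (un n) x)) atTop
      (𝓝 (∫ x, φ x * inner ℝ (W x) (limitGradient u W x))) := by
  obtain ⟨B, hB0, hB⟩ := hφ.exists_bound
  have hWi := (memLp_two_iff_integrable_sq_norm H.memLp.1).1 H.memLp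
  have hWd : ∀ n, Integrable (fun x => ‖sqGradient (un n) x - W x‖ ^ 2) volume := fun n =>
    (memLp_two_iff_integrable_sq_norm ((H.lipC n).memLp_sqGradient.sub H.memLp).1).1
      ((H.lipC n).memLp_sqGradient.sub H.memLp)
  have hyoung : ∀ ε : ℝ, 0 < ε → ∀ (b : ℝ) (x y : EuclideanSpace ℝ (Fin N)), |b| ≤ B →
      |b * inner ℝ x y| ≤ ε * ‖y‖ ^ 2 + B ^ 2 / (4 * ε) * ‖x‖ ^ 2 := fun ε hε b x y hb => by
    have h1 := mul_le_eps_sq_add hε ‖y‖ (B * ‖x‖)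
    rw [abs_mul]
    have h2 : |b| * |inner ℝ x y| ≤ B * (‖x‖ * ‖y‖) := by
      gcongr; exact abs_real_inner_le_norm _ _
    refine h2.trans ((le_of_eq (by ring)).trans (h1.trans (le_of_eq (by ring))))
  have hm1 : ∀ n, AEStronglyMeasurable
      (fun x => φ x * inner ℝ (W x) (gradient (un n) x)) volume := fun n =>
    hφ.continuous.aestronglyMeasurable.mul
      (H.memLp.1.inner (measurable_gradient (un n)).aestronglyMeasurable)
  have hm2 : ∀ n, AEStronglyMeasurable
      (fun x => φ x * inner ℝ (sqGradient (un n) x - W x) (gradient (un n) x)) volume := fun n =>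
    hφ.continuous.aestronglyMeasurable.mul
      (((H.lipC n).aestronglyMeasurable_sqGradient.sub H.memLp.1).inner
        (measurable_gradient (un n)).aestronglyMeasurable)
  have h1 : Tendsto (fun n => ∫ x, φ x * inner ℝ (W x) (gradient (un n) x)) atTop
      (𝓝 (∫ x, φ x * inner ℝ (W x) (limitGradient u W x))) := by
    refine (tendsto_integral_of_forall_eps (g := fun n x => ‖gradient (un n) x‖ ^ 2) (M := M)
      hm1 ?_ (fun n => (H.lipC n).integrable_gradient_sq)
      (fun n => Eventually.of_forall fun x => by positivity) H.bound_gradient fun ε hε => ?_).2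
    · filter_upwards [H.ae_tendsto_gradient, H.ae_eq_zero] with x hx h0
      by_cases hu : u x = 0
      · simp [h0 hu]
      · exact (tendsto_const_nhds.inner (hx hu)).const_mul _
    · exact ⟨_, hWi.const_mul (B ^ 2 / (4 * ε)), fun n => Eventually.of_forall fun x =>
        hyoung ε hε _ _ _ (hB x)⟩
  have h2 : Tendsto (fun n => ∫ x, φ x * inner ℝ (sqGradient (un n) x - W x) (gradient (un n) x))
      atTop (𝓝 0) :=
    tendsto_integral_zero_of_forall_eps (g := fun n x => ‖gradient (un n) x‖ ^ 2) (M := M)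
      (fun n => (H.lipC n).integrable_gradient_sq) H.bound_gradient hWd H.tendsto_sqGradient
      fun ε hε => ⟨B ^ 2 / (4 * ε), fun n => Eventually.of_forall fun x =>
        hyoung ε hε _ _ _ (hB x)⟩
  have h3 := h1.add h2
  rw [add_zero] at h3
  refine h3.congr fun n => ?_
  rw [← integral_add]
  · congr 1 with x
    rw [inner_sub_left]; ring
  · exact (((H.lipC n).integrable_gradient_sq.const_mul 1).add
      (hWi.const_mul (B ^ 2 / (4 * 1)))).mono' (hm1 n)
      (Eventually.of_forall fun x => hyoung 1 one_pos _ _ _ (hB x))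
  · exact (((H.lipC n).integrable_gradient_sq.const_mul 1).add
      ((hWd n).const_mul (B ^ 2 / (4 * 1)))).mono' (hm2 n)
      (Eventually.of_forall fun x => hyoung 1 one_pos _ _ _ (hB x))

end IsMinimizingLimit

/-! ### Lower semicontinuity and the inequality for variations. -/

namespace IsMinimizingLimit

variable {k h : EuclideanSpace ℝ (Fin N) → ℝ} {q s m M : ℝ}
  {un : ℕ → EuclideanSpace ℝ (Fin N) → ℝ} {u : EuclideanSpace ℝ (Fin N) → ℝ}
  {W : EuclideanSpace ℝ (Fin N) → EuclideanSpace ℝ (Fin N)}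

theorem exists_bound_k (H : IsMinimizingLimit k h q s m M un u W) (hN : 3 ≤ N) (hq0 : 0 < q)
    (hq2 : q < 2) (hkq : MemLp k (ENNReal.ofReal (conjExp N q)) volume) (hk0 : ∀ᵐ x, 0 ≤ k x) :
    ∃ M', ∀ n, ∫ x, k x * |un n x| ^ q ≤ M' := by
  obtain ⟨A, hA0, hA⟩ := exists_integral_mul_abs_rpow_le hN hq0 hq2 hkq hk0
  refine ⟨M ^ (q / 2) * A, fun n => (hA _ (H.lipC n)).trans ?_⟩
  have := H.bound_gradient n
  gcongr

/-- The k-term enters with a negative sign, so boundedness is not enough. Young gives k|un|^q ≤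
ε|un|^{2*} + C k^{q₀}, and the last function is integrable. -/
theorem tendsto_integral_k (H : IsMinimizingLimit k h q s m M un u W) (hN : 3 ≤ N) (hq0 : 0 < q)
    (hq2 : q < 2) (hkq : MemLp k (ENNReal.ofReal (conjExp N q)) volume) (hk0 : ∀ᵐ x, 0 ≤ k x) :
    Integrable (fun x => k x * |u x| ^ q) volume ∧
    Tendsto (fun n => ∫ x, k x * |un n x| ^ q) atTop (𝓝 (∫ x, k x * |u x| ^ q)) := by
  have hp := critExp_pos hN
  have hc := conjExp_holderConjugate hN hq0 hq2
  have hr : critExp N / (critExp N - q) = conjExp N q := by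
    have h1 : critExp N / q - 1 ≠ 0 := hc.symm.sub_one_pos.ne'
    rw [hc.symm.conjugate_eq]
    have h2 : critExp N - q ≠ 0 := by linarith
    field_simp
  have hki : Integrable (fun x => ‖k x‖ ^ conjExp N q) volume := by
    have := hkq.integrable_norm_rpow (by simpa using hc.pos) ENNReal.ofReal_ne_top
    rwa [ENNReal.toReal_ofReal hc.nonneg] at this
  refine tendsto_integral_of_forall_eps (g := fun n x => |un n x| ^ critExp N) (M := M)
    (fun n => ?_) ?_ (fun n => (H.lipC n).integrable_abs_rpow (by linarith))
    (fun n => Eventually.of_forall fun x => by positivity) H.bound_critExp fun ε hε => ?_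
  · exact hkq.1.mul ((H.lipC n).continuous.abs.rpow_const
      fun _ => Or.inr hq0.le).aestronglyMeasurable
  · filter_upwards [H.ae_tendsto] with x hx
    exact (hx.abs.rpow_const (Or.inr hq0.le)).const_mul _
  · obtain ⟨C, hC0, hC⟩ := exists_rpow_mul_le (a := q) (p := critExp N) hq0 (by linarith) hε
    refine ⟨fun x => C * ‖k x‖ ^ conjExp N q, hki.const_mul C, fun n => ?_⟩
    filter_upwards [hk0] with x hx
    have h1 := hC |un n x| ‖k x‖ (abs_nonneg _) (norm_nonneg _)
    rw [hr] at h1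
    rw [abs_mul, mul_comm, abs_of_nonneg (a := |un n x| ^ q) (by positivity)]
    exact h1

theorem integrable_h (H : IsMinimizingLimit k h q s m M un u W) (hs : 0 < s)
    (hh : MemLp h ⊤ volume) (hh0 : ∀ᵐ x, 0 ≤ h x) :
    Integrable (fun x => h x * |u x| ^ s) volume := by
  refine (integral_le_of_ae_tendsto (f := fun n x => h x * |un n x| ^ s) (c := fun _ => M)
    (fun n => (H.lipC n).integrable_mul_abs_rpow hh hs) (fun n => ?_) ?_ H.bound_h
    tendsto_const_nhds).1
  · filter_upwards [hh0] with x hx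
    positivity
  · filter_upwards [H.ae_tendsto] with x hx
    exact (hx.abs.rpow_const (Or.inr hs.le)).const_mul _

theorem integrable_energy (H : IsMinimizingLimit k h q s m M un u W) :
    Integrable (fun x => (1 + 2 * u x ^ 2) * ‖limitGradient u W x‖ ^ 2) volume := by
  have h1 := (memLp_two_iff_integrable_sq_norm H.memLp.1).1 H.memLp
  have h2 := (memLp_two_iff_integrable_sq_norm H.memLp_limitGradient.1).1 H.memLp_limitGradient
  refine (h2.add (h1.const_mul (1 / 2))).congr ?_
  filter_upwards [H.ae_eq_smul_limitGradient] with x hx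
  have h3 : ‖W x‖ ^ 2 = (2 * u x) ^ 2 * ‖limitGradient u W x‖ ^ 2 := by
    have := congrArg (fun y => ‖y‖ ^ 2) hx
    simpa only [norm_smul, mul_pow, Real.norm_eq_abs, sq_abs] using this
  rw [Pi.add_apply, h3]
  ring

/-- Lower semicontinuity of the energy along the minimising sequence. -/
theorem energy_le (H : IsMinimizingLimit k h q s m M un u W) (hN : 3 ≤ N) (hq0 : 0 < q)
    (hq2 : q < 2) (hs : 0 < s) (hkq : MemLp k (ENNReal.ofReal (conjExp N q)) volume)
    (hk0 : ∀ᵐ x, 0 ≤ k x) (hh : MemLp h ⊤ volume) (hh0 : ∀ᵐ x, 0 ≤ h x) :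
    1 / 2 * (∫ x, (1 + 2 * u x ^ 2) * ‖limitGradient u W x‖ ^ 2)
      - 1 / q * (∫ x, k x * |u x| ^ q) + 1 / s * (∫ x, h x * |u x| ^ s) ≤ m := by
  obtain ⟨-, hk⟩ := H.tendsto_integral_k hN hq0 hq2 hkq hk0
  have hSm : MeasurableSet {x | u x ≠ 0} := (H.measurable (measurableSet_singleton 0)).compl
  have hint : ∀ n, Integrable (fun x => {x | u x ≠ 0}.indicator
      (fun x => 1 / 2 * ((1 + 2 * un n x ^ 2) * ‖gradient (un n) x‖ ^ 2)) x
      + 1 / s * (h x * |un n x| ^ s)) volume := fun n =>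
    (((H.lipC n).integrable_energy.const_mul (1 / 2)).indicator hSm).add
      (((H.lipC n).integrable_mul_abs_rpow hh hs).const_mul _)
  -- Fatou for the gradient and h-terms together, the k-term being moved to the other side. The
  -- indicator discards {u = 0}, where ∇un need not converge and where the limit gradient is 0.
  have h1 := integral_le_of_ae_tendsto (μ := volume)
    (f := fun n x => {x | u x ≠ 0}.indicator
      (fun x => 1 / 2 * ((1 + 2 * un n x ^ 2) * ‖gradient (un n) x‖ ^ 2)) x
      + 1 / s * (h x * |un n x| ^ s))
    (F := fun x => 1 / 2 * ((1 + 2 * u x ^ 2) * ‖limitGradient u W x‖ ^ 2)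
      + 1 / s * (h x * |u x| ^ s))
    (c := fun n => lipEnergy k h q s (un n) + 1 / q * (∫ x, k x * |un n x| ^ q))
    (L := m + 1 / q * (∫ x, k x * |u x| ^ q)) hint (fun n => ?_) ?_ (fun n => ?_)
    (H.tendsto_lipEnergy.add (hk.const_mul _))
  · have h2 := h1.2
    rw [integral_add (H.integrable_energy.const_mul _) ((H.integrable_h hs hh hh0).const_mul _),
      integral_const_mul, integral_const_mul] at h2
    linarith
  · filter_upwards [hh0] with x hx
    refine add_nonneg (Set.indicator_nonneg (fun y _ => by positivity) x) (by positivity)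
  · filter_upwards [H.ae_tendsto, H.ae_tendsto_gradient] with x hx hgx
    refine Tendsto.add ?_ ((hx.abs.rpow_const (Or.inr hs.le)).const_mul _ |>.const_mul _)
    by_cases hu : u x = 0
    · simp [Set.indicator, hu, limitGradient]
    · simp only [Set.indicator, Set.mem_ofPred_eq, hu, ne_eq, not_false_eq_true, if_true]
      exact ((((hx.pow 2).const_mul 2).const_add 1).mul ((hgx hu).norm.pow 2)).const_mul _
  · rw [lipEnergy, ← integral_const_mul (1 / s), ← integral_const_mul (1 / 2)]
    have h3 : ∀ a b c : ℝ, a - b + c + b = a + c := fun a b c => by ring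
    rw [h3, ← integral_add ((H.lipC n).integrable_energy.const_mul (1 / 2))
      (((H.lipC n).integrable_mul_abs_rpow hh hs).const_mul _)]
    refine integral_mono (hint n) (((H.lipC n).integrable_energy.const_mul (1 / 2)).add
      (((H.lipC n).integrable_mul_abs_rpow hh hs).const_mul _)) fun x => ?_
    refine add_le_add ?_ le_rfl
    exact Set.indicator_le_self' (fun y _ => by positivity) x

/-- The gradient part of the first variation of the energy at the limit. -/
def gradientVariation (u φ : EuclideanSpace ℝ (Fin N) → ℝ)
    (W : EuclideanSpace ℝ (Fin N) → EuclideanSpace ℝ (Fin N)) : ℝ :=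
  (∫ x, inner ℝ (limitGradient u W x) (gradient φ x)) + (∫ x, u x * inner ℝ (W x) (gradient φ x))
    + ∫ x, φ x * inner ℝ (W x) (limitGradient u W x)

theorem exists_integral_energy_add_le (H : IsMinimizingLimit k h q s m M un u W) (hN : 3 ≤ N)
    {φ : EuclideanSpace ℝ (Fin N) → ℝ} (hφ : IsTestFunction φ) :
    ∃ R : ℝ, ∀ n, ∀ t : ℝ, |t| ≤ 1 →
      1 / 2 * (∫ x, (1 + 2 * (un n x + t * φ x) ^ 2) *
        ‖gradient (fun y => un n y + t * φ y) x‖ ^ 2) ≤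
      1 / 2 * (∫ x, (1 + 2 * un n x ^ 2) * ‖gradient (un n) x‖ ^ 2)
      + t * ((∫ x, inner ℝ (gradient (un n) x) (gradient φ x))
        + (∫ x, un n x * inner ℝ (sqGradient (un n) x) (gradient φ x))
        + ∫ x, φ x * inner ℝ (sqGradient (un n) x) (gradient (un n) x)) + t ^ 2 * R := by
  have hL := hφ.isLipC
  have hp := critExp_pos hN
  obtain ⟨B, hB0, hB⟩ := hL.exists_bound
  obtain ⟨C, hC0, hC⟩ := exists_rpow_mul_le (a := 2) (p := critExp N) two_pos hp one_pos
  have hr : 0 < critExp N / (critExp N - 2) := div_pos (by linarith) (by linarith)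
  have hc1 : Continuous fun x => ‖gradient φ x‖ ^ 2 := hφ.continuous_gradient.norm.pow 2
  have hc2 : HasCompactSupport fun x => ‖gradient φ x‖ ^ 2 :=
    hφ.hasCompactSupport_norm_gradient.comp_left (g := fun t : ℝ => t ^ 2) (zero_pow two_ne_zero)
  have hi0 : Integrable (fun x => |‖gradient φ x‖ ^ 2| ^ (critExp N / (critExp N - 2))) volume :=
    integrable_abs_rpow_of_hasCompactSupport hc1 hc2 hr
  have hi1 : Integrable (fun x => (1 + φ x ^ 2) * ‖gradient φ x‖ ^ 2) volume :=
    hL.integrable_comp hL (F := fun a b _ _ => (1 + a ^ 2) * ‖b‖ ^ 2) (by fun_prop) (by simp)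
  -- The integral of the quadratic remainder, with ∫ un²|∇φ|² bounded through the critical norm and
  -- ∫ φ²|∇un|² through sup |φ|. The constant depends neither on n nor on t.
  refine ⟨4 * ((∫ x, (1 + φ x ^ 2) * ‖gradient φ x‖ ^ 2)
    + (M + C * ∫ x, |‖gradient φ x‖ ^ 2| ^ (critExp N / (critExp N - 2))) + B ^ 2 * M),
    fun n t ht => ?_⟩
  have hn := H.lipC n
  have hi2 : Integrable (fun x => un n x ^ 2 * ‖gradient φ x‖ ^ 2) volume :=
    hn.integrable_comp hL (F := fun a _ _ d => a ^ 2 * ‖d‖ ^ 2) (by fun_prop) (by simp)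
  have hi3 : Integrable (fun x => φ x ^ 2 * ‖gradient (un n) x‖ ^ 2) volume :=
    hn.integrable_comp hL (F := fun _ b c _ => c ^ 2 * ‖b‖ ^ 2) (by fun_prop) (by simp)
  have hj1 : Integrable (fun x => inner ℝ (gradient (un n) x) (gradient φ x)) volume :=
    hn.integrable_comp hL (F := fun _ b _ d => inner ℝ b d) (by fun_prop) (by simp)
  have hj2 : Integrable (fun x => un n x * inner ℝ (sqGradient (un n) x) (gradient φ x)) volume :=
    hn.integrable_comp hL (F := fun a b _ d => a * inner ℝ ((2 * a) • b) d) (by fun_prop) (by simp)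
  have hj3 : Integrable (fun x => φ x * inner ℝ (sqGradient (un n) x) (gradient (un n) x))
      volume :=
    hn.integrable_comp hL (F := fun a b c _ => c * inner ℝ ((2 * a) • b) b) (by fun_prop) (by simp)
  have hb2 : ∫ x, un n x ^ 2 * ‖gradient φ x‖ ^ 2
      ≤ M + C * ∫ x, |‖gradient φ x‖ ^ 2| ^ (critExp N / (critExp N - 2)) := by
    calc _ ≤ ∫ x, |un n x| ^ critExp N
          + C * |‖gradient φ x‖ ^ 2| ^ (critExp N / (critExp N - 2)) := by
          refine integral_mono hi2 ((hn.integrable_abs_rpow (by linarith)).add (hi0.const_mul C))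
            fun x => ?_
          have := hC |un n x| |‖gradient φ x‖ ^ 2| (abs_nonneg _) (abs_nonneg _)
          rw [Real.rpow_two, sq_abs, abs_of_nonneg (by positivity : 0 ≤ ‖gradient φ x‖ ^ 2),
            one_mul] at this
          simpa using this
      _ ≤ _ := by
          rw [integral_add (hn.integrable_abs_rpow (by linarith)) (hi0.const_mul C),
            integral_const_mul]
          gcongr
          exact H.bound_critExp n
  have hb3 : ∫ x, φ x ^ 2 * ‖gradient (un n) x‖ ^ 2 ≤ B ^ 2 * M := by
    calc _ ≤ ∫ x, B ^ 2 * ‖gradient (un n) x‖ ^ 2 := by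
          refine integral_mono hi3 (hn.integrable_gradient_sq.const_mul _) fun x => ?_
          have : φ x ^ 2 ≤ B ^ 2 := sq_le_sq' (abs_le.1 (hB x)).1 (abs_le.1 (hB x)).2
          simp only
          gcongr
      _ ≤ _ := by
          rw [integral_const_mul]
          gcongr
          exact H.bound_gradient n
  have hJ' : Integrable (fun x => inner ℝ (gradient (un n) x) (gradient φ x)
      + un n x * inner ℝ (sqGradient (un n) x) (gradient φ x)) volume := hj1.add hj2
  have hJ : Integrable (fun x => inner ℝ (gradient (un n) x) (gradient φ x)
      + un n x * inner ℝ (sqGradient (un n) x) (gradient φ x)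
      + φ x * inner ℝ (sqGradient (un n) x) (gradient (un n) x)) volume := hJ'.add hj3
  have hI' : Integrable (fun x => (1 + φ x ^ 2) * ‖gradient φ x‖ ^ 2
      + un n x ^ 2 * ‖gradient φ x‖ ^ 2) volume := hi1.add hi2
  have hI : Integrable (fun x => (1 + φ x ^ 2) * ‖gradient φ x‖ ^ 2
      + un n x ^ 2 * ‖gradient φ x‖ ^ 2 + φ x ^ 2 * ‖gradient (un n) x‖ ^ 2) volume := hI'.add hi3
  have hE : Integrable (fun x => 1 / 2 * ((1 + 2 * un n x ^ 2) * ‖gradient (un n) x‖ ^ 2)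
      + t * (inner ℝ (gradient (un n) x) (gradient φ x)
        + un n x * inner ℝ (sqGradient (un n) x) (gradient φ x)
        + φ x * inner ℝ (sqGradient (un n) x) (gradient (un n) x))) volume :=
    (hn.integrable_energy.const_mul _).add (hJ.const_mul t)
  have hmono : ∫ x, 1 / 2 * ((1 + 2 * (un n x + t * φ x) ^ 2) *
        ‖gradient (fun y => un n y + t * φ y) x‖ ^ 2) ≤
      ∫ x, 1 / 2 * ((1 + 2 * un n x ^ 2) * ‖gradient (un n) x‖ ^ 2)
      + t * (inner ℝ (gradient (un n) x) (gradient φ x)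
        + un n x * inner ℝ (sqGradient (un n) x) (gradient φ x)
        + φ x * inner ℝ (sqGradient (un n) x) (gradient (un n) x))
      + t ^ 2 * (4 * ((1 + φ x ^ 2) * ‖gradient φ x‖ ^ 2 + un n x ^ 2 * ‖gradient φ x‖ ^ 2
        + φ x ^ 2 * ‖gradient (un n) x‖ ^ 2)) := by
    refine integral_mono_ae ((hn.add_const_mul hL t).integrable_energy.const_mul _)
      (hE.add ((hI.const_mul 4).const_mul (t ^ 2))) ?_
    filter_upwards [hn.ae_differentiableAt, hL.ae_differentiableAt] with x hx1 hx2
    rw [(hasGradientAt_add_const_mul hx1 hx2 t).gradient]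
    exact energy_density_add_le ht
  rw [integral_const_mul, integral_add hE ((hI.const_mul 4).const_mul (t ^ 2)),
    integral_add (hn.integrable_energy.const_mul _)
      (hJ.const_mul t), integral_const_mul, integral_const_mul, integral_const_mul,
      integral_const_mul, integral_add hJ' hj3, integral_add hj1 hj2,
      integral_add hI' hi3, integral_add hi1 hi2] at hmono
  refine hmono.trans ?_
  gcongr

/-- Limit of J(un + tφ) - m ≥ 0 as n → ∞ for fixed t. Since J(un) - m → 0, only the variation
remains, and minimality of u itself is never used. -/
theorem exists_variation_nonneg (H : IsMinimizingLimit k h q s m M un u W) (hN : 3 ≤ N)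
    (hq1 : 1 < q) (hq2 : q < 2) (hs : 1 < s) (hk : MemLp k ⊤ volume)
    (hkq : MemLp k (ENNReal.ofReal (conjExp N q)) volume)
    (hk0 : ∀ᵐ x, 0 ≤ k x) (hh : MemLp h ⊤ volume) (hh0 : ∀ᵐ x, 0 ≤ h x)
    {φ : EuclideanSpace ℝ (Fin N) → ℝ} (hφ : IsTestFunction φ) :
    ∃ R : ℝ, ∀ t : ℝ, |t| ≤ 1 → 0 ≤ t * gradientVariation u φ W + t ^ 2 * R
      - 1 / q * (∫ x, k x * (|u x + t * φ x| ^ q - |u x| ^ q))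
      + 1 / s * (∫ x, h x * (|u x + t * φ x| ^ s - |u x| ^ s)) := by
  obtain ⟨R, hR⟩ := H.exists_integral_energy_add_le hN hφ
  obtain ⟨M', hM'⟩ := H.exists_bound_k hN (by linarith) hq2 hkq hk0
  refine ⟨R, fun t ht => ?_⟩
  have hL := hφ.isLipC
  have hK := tendsto_integral_abs_rpow_sub hq1 H.lipC hL hk hk0 hM' H.ae_tendsto t
  have hH := tendsto_integral_abs_rpow_sub hs H.lipC hL hh hh0 H.bound_h H.ae_tendsto t
  have hA := ((H.tendsto_integral_inner_gradient hN hφ).add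
    (H.tendsto_integral_mul_inner hN hφ)).add (H.tendsto_integral_mul_inner_gradient hL)
  have hlim := ((((H.tendsto_lipEnergy.sub_const m).add (hA.const_mul t)).add_const (t ^ 2 * R)).sub
    (hK.const_mul (1 / q))).add (hH.const_mul (1 / s))
  rw [sub_self, zero_add] at hlim
  refine ge_of_tendsto' hlim fun n => ?_
  have hn := H.lipC n
  have h1 := H.le_lipEnergy _ (hn.add_const_mul hL t)
  have h2 := hR n t ht
  have e1 : ∀ (g : EuclideanSpace ℝ (Fin N) → ℝ) (p : ℝ), MemLp g ⊤ volume → 0 < p →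
      ∫ x, g x * (|un n x + t * φ x| ^ p - |un n x| ^ p)
        = (∫ x, g x * |un n x + t * φ x| ^ p) - ∫ x, g x * |un n x| ^ p := fun g p hg hp => by
    rw [← integral_sub ((hn.add_const_mul hL t).integrable_mul_abs_rpow hg hp)
      (hn.integrable_mul_abs_rpow hg hp)]
    congr 1 with x
    ring
  rw [e1 k q hk (by linarith), e1 h s hh (by linarith)]
  unfold lipEnergy at h1 ⊢
  linarith

end IsMinimizingLimit

/-! ### Uniqueness of weak gradients and their behaviour under test perturbations. -/

namespace HasWeakGradient

variable {u φ : EuclideanSpace ℝ (Fin N) → ℝ}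
  {G G' : EuclideanSpace ℝ (Fin N) → EuclideanSpace ℝ (Fin N)}

theorem locallyIntegrable_coord (hG : HasWeakGradient u G) (i : Fin N) :
    LocallyIntegrable (fun x => G x i) volume :=
  hG.locallyIntegrable_grad.mono ((continuous_coord i).comp_aestronglyMeasurable
    hG.locallyIntegrable_grad.aestronglyMeasurable) (Eventually.of_forall fun _ => abs_coord_le _ i)

theorem integrable_coord_mul (hG : HasWeakGradient u G) (hφ : IsTestFunction φ) (i : Fin N) :
    Integrable (fun x => G x i * φ x) volume :=
  (hG.locallyIntegrable_coord i).integrable_smul_right_of_hasCompactSupport hφ.continuous hφ.2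

/-- The fundamental lemma of the calculus of variations, coordinate by coordinate. It makes every
statement independent of the representative chosen in `weakGrad`. -/
theorem ae_eq (hG : HasWeakGradient u G) (hG' : HasWeakGradient u G') : G =ᵐ[volume] G' := by
  have h : ∀ i, ∀ᵐ x, G x i = G' x i := fun i => by
    refine ae_eq_of_integral_contDiff_smul_eq (hG.locallyIntegrable_coord i)
      (hG'.locallyIntegrable_coord i) fun φ hφ hφc => ?_
    have h1 := hG.integral_eq φ ⟨hφ, hφc⟩ i
    rw [hG'.integral_eq φ ⟨hφ, hφc⟩ i, neg_inj] at h1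
    simpa only [smul_eq_mul, mul_comm] using h1.symm
  filter_upwards [ae_all_iff.2 h] with x hx
  exact PiLp.ext hx

theorem weakGrad_ae_eq (hG : HasWeakGradient u G) : weakGrad u =ᵐ[volume] G := by
  have h : ∃ G, HasWeakGradient u G := ⟨G, hG⟩
  rw [weakGrad, dif_pos h]
  exact h.choose_spec.ae_eq hG

theorem add_const_mul (hG : HasWeakGradient u G) (hφ : IsTestFunction φ) (t : ℝ) :
    HasWeakGradient (fun x => u x + t * φ x) (fun x => G x + t • gradient φ x) := by
  have hφG := hasWeakGradient_of_lipschitz hφ.isLipC.lip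
  refine ⟨hG.locallyIntegrable.add (hφG.locallyIntegrable.smul t),
    hG.locallyIntegrable_grad.add (hφG.locallyIntegrable_grad.smul t), fun ψ hψ i => ?_⟩
  have hψ' := hψ.fderiv_apply (EuclideanSpace.single i 1)
  have h1 : Integrable (fun x => u x * fderiv ℝ ψ x (EuclideanSpace.single i 1)) volume :=
    hG.locallyIntegrable.integrable_smul_right_of_hasCompactSupport hψ'.continuous hψ'.2
  have h2 : Integrable (fun x => φ x * fderiv ℝ ψ x (EuclideanSpace.single i 1)) volume :=
    hφG.locallyIntegrable.integrable_smul_right_of_hasCompactSupport hψ'.continuous hψ'.2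
  have e1 : ∫ x, (u x + t * φ x) * fderiv ℝ ψ x (EuclideanSpace.single i 1)
      = (∫ x, u x * fderiv ℝ ψ x (EuclideanSpace.single i 1))
        + t * ∫ x, φ x * fderiv ℝ ψ x (EuclideanSpace.single i 1) := by
    rw [← integral_const_mul, ← integral_add h1 (h2.const_mul t)]
    congr 1 with x; ring
  have e2 : ∫ x, (G x + t • gradient φ x) i * ψ x
      = (∫ x, G x i * ψ x) + t * ∫ x, gradient φ x i * ψ x := by
    rw [← integral_const_mul, ← integral_add (hG.integrable_coord_mul hψ i)
      ((hφG.integrable_coord_mul hψ i).const_mul t)]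
    congr 1 with x
    simp only [PiLp.add_apply, PiLp.smul_apply, smul_eq_mul]; ring
  rw [e1, e2, hG.integral_eq ψ hψ i, hφG.integral_eq ψ hψ i]
  ring

end HasWeakGradient

/-! ### Differentiability of the three terms of the energy. -/

section SquareIntegrable

variable {α F : Type*} [MeasurableSpace α] {μ : Measure α} [NormedAddCommGroup F] {f g : α → F}

theorem integrable_norm_sq (hf : MemLp f 2 μ) : Integrable (fun x => ‖f x‖ ^ 2) μ :=
  (memLp_two_iff_integrable_sq_norm hf.1).1 hf

variable [InnerProductSpace ℝ F]

theorem integrable_inner (hf : MemLp f 2 μ) (hg : MemLp g 2 μ) :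
    Integrable (fun x => inner ℝ (f x) (g x)) μ := by
  refine ((integrable_norm_sq hf).add (integrable_norm_sq hg)).mono' (hf.1.inner hg.1)
    (Eventually.of_forall fun x => ?_)
  have h1 := abs_real_inner_le_norm (f x) (g x)
  rw [Real.norm_eq_abs, Pi.add_apply]
  nlinarith [sq_nonneg (‖f x‖ - ‖g x‖), norm_nonneg (f x), norm_nonneg (g x)]

/-- The integral is a polynomial of degree four in t whose coefficients are integrals of inner
products, so no differentiation under the integral is needed. -/
theorem hasDerivAt_integral_norm_sq {Z₀ Z₁ Z₂ : α → F} (h₀ : MemLp Z₀ 2 μ) (h₁ : MemLp Z₁ 2 μ)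
    (h₂ : MemLp Z₂ 2 μ) :
    HasDerivAt (fun t : ℝ => ∫ x, ‖Z₀ x + t • Z₁ x + t ^ 2 • Z₂ x‖ ^ 2 ∂μ)
      (2 * ∫ x, inner ℝ (Z₀ x) (Z₁ x) ∂μ) 0 := by
  have i00 := integrable_norm_sq h₀
  have i11 := integrable_norm_sq h₁
  have i22 := integrable_norm_sq h₂
  have i01 := integrable_inner h₀ h₁
  have i02 := integrable_inner h₀ h₂
  have i12 := integrable_inner h₁ h₂
  have h : (fun t : ℝ => ∫ x, ‖Z₀ x + t • Z₁ x + t ^ 2 • Z₂ x‖ ^ 2 ∂μ) = fun t =>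
      (∫ x, ‖Z₀ x‖ ^ 2 ∂μ) + t * (2 * ∫ x, inner ℝ (Z₀ x) (Z₁ x) ∂μ)
      + t ^ 2 * ((∫ x, ‖Z₁ x‖ ^ 2 ∂μ) + 2 * (∫ x, inner ℝ (Z₀ x) (Z₂ x) ∂μ)
        + t * (2 * ∫ x, inner ℝ (Z₁ x) (Z₂ x) ∂μ) + t ^ 2 * ∫ x, ‖Z₂ x‖ ^ 2 ∂μ) := by
    ext t
    have e : ∀ x, ‖Z₀ x + t • Z₁ x + t ^ 2 • Z₂ x‖ ^ 2 = ‖Z₀ x‖ ^ 2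
        + 2 * t * inner ℝ (Z₀ x) (Z₁ x) + t ^ 2 * ‖Z₁ x‖ ^ 2 + 2 * t ^ 2 * inner ℝ (Z₀ x) (Z₂ x)
        + 2 * t ^ 3 * inner ℝ (Z₁ x) (Z₂ x) + t ^ 4 * ‖Z₂ x‖ ^ 2 := fun x => by
      rw [norm_add_sq_real, norm_add_sq_real, inner_add_left, inner_smul_right, inner_smul_right,
        real_inner_smul_left, inner_smul_right, norm_smul, norm_smul, mul_pow, mul_pow,
        Real.norm_eq_abs, Real.norm_eq_abs, sq_abs, sq_abs]
      ring
    simp only [e]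
    rw [integral_add (by fun_prop) (by fun_prop), integral_add (by fun_prop) (by fun_prop),
      integral_add (by fun_prop) (by fun_prop), integral_add (by fun_prop) (by fun_prop),
      integral_add (by fun_prop) (by fun_prop)]
    simp only [integral_const_mul]
    ring
  rw [h]
  generalize 2 * ∫ x, inner ℝ (Z₀ x) (Z₁ x) ∂μ = A
  have h1 := (hasDerivAt_id' (0 : ℝ)).mul_const A
  have h2 : HasDerivAt (fun t : ℝ => t ^ 2) 0 0 := by simpa using hasDerivAt_pow 2 (0 : ℝ)
  have h3 : DifferentiableAt ℝ (fun t : ℝ => (∫ x, ‖Z₁ x‖ ^ 2 ∂μ)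
    + 2 * (∫ x, inner ℝ (Z₀ x) (Z₂ x) ∂μ)
    + t * (2 * ∫ x, inner ℝ (Z₁ x) (Z₂ x) ∂μ) + t ^ 2 * ∫ x, ‖Z₂ x‖ ^ 2 ∂μ) 0 := by fun_prop
  have h4 := (h1.const_add (∫ x, ‖Z₀ x‖ ^ 2 ∂μ)).add (h2.mul h3.hasDerivAt)
  exact h4.congr_deriv (by simp)

end SquareIntegrable

/-- `|u + t φ|^p` is integrable against `g` when `|u|^p` is. -/
theorem integrable_mul_abs_add_rpow {g u φ : EuclideanSpace ℝ (Fin N) → ℝ} {p : ℝ} (hp : 1 < p)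
    (hgm : AEStronglyMeasurable g volume) (hg0 : ∀ᵐ x, 0 ≤ g x) (hu : Measurable u)
    (hφm : Measurable φ) (hgu : Integrable (fun x => g x * |u x| ^ p) volume)
    (hgφ : Integrable (fun x => g x * |φ x| ^ p) volume) (t : ℝ) :
    Integrable (fun x => g x * |u x + t * φ x| ^ p) volume := by
  refine ((hgu.add (hgφ.const_mul (|t| ^ p))).const_mul (2 ^ p)).mono'
    (hgm.mul ((hu.add (hφm.const_mul t)).abs.pow_const p).aestronglyMeasurable) ?_
  filter_upwards [hg0] with x hx
  have h1 := add_rpow_le_two_rpow_mul (p := p) (by linarith) (abs_nonneg (u x))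
    (abs_nonneg (t * φ x))
  have h2 : |u x + t * φ x| ^ p ≤ (|u x| + |t * φ x|) ^ p := by
    have := abs_add_le (u x) (t * φ x)
    gcongr
  rw [Real.norm_eq_abs, abs_of_nonneg (by positivity), Pi.add_apply]
  calc g x * |u x + t * φ x| ^ p ≤ g x * (2 ^ p * (|u x| ^ p + |t * φ x| ^ p)) := by
        gcongr; exact h2.trans h1
    _ = _ := by rw [abs_mul, Real.mul_rpow (abs_nonneg _) (abs_nonneg _)]; ring

/-- Differentiation under the integral: for |t| < 1 the t-derivative is bounded by p 2^p g(|u|^p +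
|φ|^p). -/
theorem hasDerivAt_integral_abs_rpow {g u φ : EuclideanSpace ℝ (Fin N) → ℝ} {p : ℝ} (hp : 1 < p)
    (hgm : AEStronglyMeasurable g volume) (hg0 : ∀ᵐ x, 0 ≤ g x) (hu : Measurable u)
    (hφm : Measurable φ) (hgu : Integrable (fun x => g x * |u x| ^ p) volume)
    (hgφ : Integrable (fun x => g x * |φ x| ^ p) volume) :
    Integrable (fun x => g x * (|u x| ^ (p - 2) * u x) * φ x) volume ∧
    HasDerivAt (fun t : ℝ => ∫ x, g x * |u x + t * φ x| ^ p)
      (p * ∫ x, g x * (|u x| ^ (p - 2) * u x) * φ x) 0 := by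
  have hp0 : 0 < p := by linarith
  have h := hasDerivAt_integral_of_dominated_loc_of_deriv_le (μ := volume) (x₀ := (0 : ℝ))
    (s := Metric.ball 0 1) (F := fun t x => g x * |u x + t * φ x| ^ p)
    (F' := fun t x => g x * (p * |u x + t * φ x| ^ (p - 2) * (u x + t * φ x) * φ x))
    (bound := fun x => p * 2 ^ p * (g x * |u x| ^ p + g x * |φ x| ^ p))
    (Metric.ball_mem_nhds _ one_pos) (Eventually.of_forall fun t => ?_)
    (integrable_mul_abs_add_rpow hp hgm hg0 hu hφm hgu hgφ 0) ?_ ?_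
    ((hgu.add hgφ).const_mul _) (Eventually.of_forall fun x t _ => ?_)
  · simp only [zero_mul, add_zero] at h
    have e : ∀ x, g x * (p * |u x| ^ (p - 2) * u x * φ x)
        = p * (g x * (|u x| ^ (p - 2) * u x) * φ x) := fun x => by ring
    simp only [e, integral_const_mul] at h
    refine ⟨?_, h.2⟩
    have h1 := h.1.const_mul p⁻¹
    simpa only [inv_mul_cancel_left₀ hp0.ne'] using h1
  · exact hgm.mul ((hu.add (hφm.const_mul t)).abs.pow_const p).aestronglyMeasurable
  · have hm := hu.add (hφm.const_mul 0)
    exact hgm.mul ((((hm.abs.pow_const (p - 2)).const_mul p).mul hm).mul hφm).aestronglyMeasurable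
  · filter_upwards [hg0] with x hx t ht
    rw [mem_ball_zero_iff, Real.norm_eq_abs] at ht
    set y := u x + t * φ x with hy
    have hyb : |y| ≤ |u x| + |φ x| := by
      refine (abs_add_le _ _).trans ?_
      rw [abs_mul]
      nlinarith [abs_nonneg (φ x)]
    have h1 : |(|y| ^ (p - 2) * y)| ≤ (|u x| + |φ x|) ^ (p - 1) := by
      rcases eq_or_ne y 0 with h0 | h0
      · rw [h0]; simp only [mul_zero, abs_zero]; positivity
      · have hy0 : 0 < |y| := abs_pos.2 h0
        rw [abs_mul, abs_of_nonneg (by positivity : 0 ≤ |y| ^ (p - 2)),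
          ← Real.rpow_add_one hy0.ne', show p - 2 + 1 = p - 1 by ring]
        exact Real.rpow_le_rpow hy0.le hyb (by linarith)
    have h2 : (|u x| + |φ x|) ^ (p - 1) * |φ x| ≤ (|u x| + |φ x|) ^ p := by
      calc (|u x| + |φ x|) ^ (p - 1) * |φ x|
          ≤ (|u x| + |φ x|) ^ (p - 1) * (|u x| + |φ x|) ^ (1 : ℝ) := by
            rw [Real.rpow_one]; gcongr; linarith [abs_nonneg (u x)]
        _ = _ := by
            rw [← Real.rpow_add_of_nonneg (by positivity) (by linarith) zero_le_one]; ring_nf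
    have h3 := add_rpow_le_two_rpow_mul hp0.le (abs_nonneg (u x)) (abs_nonneg (φ x))
    rw [Real.norm_eq_abs, abs_mul, abs_of_nonneg hx]
    calc g x * |p * |y| ^ (p - 2) * y * φ x|
        = p * g x * (|(|y| ^ (p - 2) * y)| * |φ x|) := by
          rw [show p * |y| ^ (p - 2) * y * φ x = p * ((|y| ^ (p - 2) * y) * φ x) by ring, abs_mul,
            abs_of_pos hp0, abs_mul (_ * y)]; ring
      _ ≤ p * g x * ((|u x| + |φ x|) ^ (p - 1) * |φ x|) := by gcongr
      _ ≤ p * g x * (2 ^ p * (|u x| ^ p + |φ x| ^ p)) :=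
        mul_le_mul_of_nonneg_left (h2.trans h3) (by positivity)
      _ = _ := by ring
  · have h1 := (hasDerivAt_abs_rpow (u x + t * φ x) hp).comp t
      (((hasDerivAt_id' t).mul_const (φ x)).const_add (u x))
    have h2 := h1.const_mul (g x)
    simpa only [one_mul, Function.comp_def] using h2

theorem IsLipC.memLp_top {φ : EuclideanSpace ℝ (Fin N) → ℝ} (hφ : IsLipC φ) : MemLp φ ⊤ volume :=
  hφ.memLp ⊤

/-! ### The Euler-Lagrange equation for the limit. -/

namespace IsMinimizingLimit

variable {k h : EuclideanSpace ℝ (Fin N) → ℝ} {q s m M : ℝ}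
  {un : ℕ → EuclideanSpace ℝ (Fin N) → ℝ} {u : EuclideanSpace ℝ (Fin N) → ℝ}
  {W : EuclideanSpace ℝ (Fin N) → EuclideanSpace ℝ (Fin N)}
  {φ : EuclideanSpace ℝ (Fin N) → ℝ}

theorem memLp_smul_limitGradient (H : IsMinimizingLimit k h q s m M un u W) :
    MemLp (fun x => u x • limitGradient u W x) 2 volume := by
  refine (H.memLp.const_smul (1 / 2 : ℝ)).ae_eq ?_
  filter_upwards [H.ae_eq_smul_limitGradient] with x hx
  rw [Pi.smul_apply]
  conv_lhs => rw [hx]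
  rw [smul_smul]
  congr 1; ring

theorem memLp_smul_gradient (H : IsMinimizingLimit k h q s m M un u W) (hN : 3 ≤ N)
    (hφ : IsTestFunction φ) : MemLp (fun x => u x • gradient φ x) 2 volume := by
  have hp := critExp_pos hN
  have hm : AEStronglyMeasurable (fun x => u x • gradient φ x) volume :=
    (H.measurable.smul (measurable_gradient φ)).aestronglyMeasurable
  rw [memLp_two_iff_integrable_sq_norm hm]
  obtain ⟨C, hC0, hC⟩ := exists_rpow_mul_le (a := 2) (p := critExp N) two_pos hp one_pos
  have hr : 0 < critExp N / (critExp N - 2) := div_pos (by linarith) (by linarith)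
  have hc1 : Continuous fun x => ‖gradient φ x‖ ^ 2 := hφ.continuous_gradient.norm.pow 2
  have hc2 : HasCompactSupport fun x => ‖gradient φ x‖ ^ 2 :=
    hφ.hasCompactSupport_norm_gradient.comp_left (g := fun t : ℝ => t ^ 2) (zero_pow two_ne_zero)
  refine ((H.integrable_abs_rpow_critExp hN).add
    ((integrable_abs_rpow_of_hasCompactSupport hc1 hc2 hr).const_mul C)).mono'
    (hm.norm.pow 2) (Eventually.of_forall fun x => ?_)
  have h1 := hC |u x| |‖gradient φ x‖ ^ 2| (abs_nonneg _) (abs_nonneg _)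
  rw [one_mul, Real.rpow_two, sq_abs] at h1
  rw [norm_smul, mul_pow, Real.norm_eq_abs, Real.norm_eq_abs, abs_mul, abs_pow, abs_abs, sq_abs]
  exact h1

theorem memLp_variation (H : IsMinimizingLimit k h q s m M un u W) (hN : 3 ≤ N)
    (hφ : IsTestFunction φ) :
    MemLp (fun x => φ x • limitGradient u W x + u x • gradient φ x) 2 volume :=
  (H.memLp_limitGradient.smul hφ.isLipC.memLp_top).add (H.memLp_smul_gradient hN hφ)

theorem memLp_smul_gradient_self (hφ : IsTestFunction φ) :
    MemLp (fun x => φ x • gradient φ x) 2 volume :=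
  hφ.isLipC.memLp_gradient.smul hφ.isLipC.memLp_top

/-- The gradient density is |∇v|² + 2|v∇v|². Along u + tφ both vectors are polynomials in t with L²
coefficients; the zero coefficient of t² gives the first one the same shape as the second. -/
theorem energy_density_eq (u v : ℝ) (g p : EuclideanSpace ℝ (Fin N)) (t : ℝ) :
    (1 + 2 * (u + t * v) ^ 2) * ‖g + t • p‖ ^ 2 =
      ‖g + t • p + t ^ 2 • (0 : EuclideanSpace ℝ (Fin N))‖ ^ 2
      + 2 * ‖u • g + t • (v • g + u • p) + t ^ 2 • (v • p)‖ ^ 2 := by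
  have : u • g + t • (v • g + u • p) + t ^ 2 • (v • p) = (u + t * v) • (g + t • p) := by module
  rw [this, norm_smul, mul_pow, Real.norm_eq_abs, sq_abs, smul_zero, add_zero]
  ring

theorem weakGrad_add_ae_eq (H : IsMinimizingLimit k h q s m M un u W) (hN : 3 ≤ N)
    (hφ : IsTestFunction φ) (t : ℝ) :
    weakGrad (fun x => u x + t * φ x) =ᵐ[volume] fun x => limitGradient u W x + t • gradient φ x :=
  ((H.hasWeakGradient hN).add_const_mul hφ t).weakGrad_ae_eq

theorem integrable_energy_terms (H : IsMinimizingLimit k h q s m M un u W) (hN : 3 ≤ N)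
    (hφ : IsTestFunction φ) (t : ℝ) :
    Integrable (fun x => ‖limitGradient u W x + t • gradient φ x
      + t ^ 2 • (0 : EuclideanSpace ℝ (Fin N))‖ ^ 2) volume ∧
    Integrable (fun x => 2 * ‖u x • limitGradient u W x
      + t • (φ x • limitGradient u W x + u x • gradient φ x) + t ^ 2 • (φ x • gradient φ x)‖ ^ 2)
      volume := by
  have h1 := (H.memLp_limitGradient.add (hφ.isLipC.memLp_gradient.const_smul t))
  have h2 := ((H.memLp_smul_limitGradient.add ((H.memLp_variation hN hφ).const_smul t)).add
    ((memLp_smul_gradient_self hφ).const_smul (t ^ 2)))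
  refine ⟨?_, (integrable_norm_sq h2).const_mul 2⟩
  simpa using integrable_norm_sq h1

theorem hasFiniteEnergy_add (H : IsMinimizingLimit k h q s m M un u W) (hN : 3 ≤ N)
    (hq1 : 1 < q) (hq2 : q < 2) (hs : 1 < s) (hk : MemLp k ⊤ volume)
    (hkq : MemLp k (ENNReal.ofReal (conjExp N q)) volume)
    (hk0 : ∀ᵐ x, 0 ≤ k x) (hh : MemLp h ⊤ volume) (hh0 : ∀ᵐ x, 0 ≤ h x)
    (hφ : IsTestFunction φ) (t : ℝ) : HasFiniteEnergy k h q s (fun x => u x + t * φ x) := by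
  have hL := hφ.isLipC
  have hw := H.weakGrad_add_ae_eq hN hφ t
  refine ⟨⟨(H.memLp_critExp hN).add ((hL.memLp _).const_mul t),
    ⟨_, (H.hasWeakGradient hN).add_const_mul hφ t⟩, ?_⟩, ?_, ?_, ?_⟩
  · exact (H.memLp_limitGradient.add (hL.memLp_gradient.const_smul t)).ae_eq hw.symm
  · obtain ⟨h1, h2⟩ := H.integrable_energy_terms hN hφ t
    refine (h1.add h2).congr ?_
    filter_upwards [hw] with x hx
    rw [hx, energy_density_eq]; rfl
  · exact integrable_mul_abs_add_rpow hq1 hk.1 hk0 H.measurable hL.continuous.measurable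
      (H.tendsto_integral_k hN (by linarith) hq2 hkq hk0).1
      (hL.integrable_mul_abs_rpow hk (by linarith)) t
  · exact integrable_mul_abs_add_rpow hs hh.1 hh0 H.measurable hL.continuous.measurable
      (H.integrable_h (by linarith) hh hh0) (hL.integrable_mul_abs_rpow hh (by linarith)) t

theorem integrable_gradientVariation (H : IsMinimizingLimit k h q s m M un u W) (hN : 3 ≤ N)
    (hφ : IsTestFunction φ) :
    Integrable (fun x => inner ℝ (limitGradient u W x) (gradient φ x)) volume ∧
    Integrable (fun x => u x * inner ℝ (W x) (gradient φ x)) volume ∧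
    Integrable (fun x => φ x * inner ℝ (W x) (limitGradient u W x)) volume := by
  refine ⟨integrable_inner H.memLp_limitGradient hφ.isLipC.memLp_gradient, ?_, ?_⟩
  · have h1 := integrable_inner H.memLp (H.memLp_smul_gradient hN hφ)
    simpa only [inner_smul_right] using h1
  · exact (integrable_inner H.memLp H.memLp_limitGradient).smul_of_top_right hφ.isLipC.memLp_top

theorem gradientVariation_eq (H : IsMinimizingLimit k h q s m M un u W) (hN : 3 ≤ N)
    (hφ : IsTestFunction φ) :
    gradientVariation u φ W = (∫ x, inner ℝ (limitGradient u W x) (gradient φ x))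
      + 2 * ∫ x, inner ℝ (u x • limitGradient u W x)
        (φ x • limitGradient u W x + u x • gradient φ x) := by
  obtain ⟨-, h2, h3⟩ := H.integrable_gradientVariation hN hφ
  rw [gradientVariation, add_assoc, ← integral_add h2 h3, ← integral_const_mul]
  congr 1
  refine integral_congr_ae ?_
  filter_upwards [H.ae_eq_smul_limitGradient] with x hx
  generalize limitGradient u W x = g at hx ⊢
  rw [hx]
  simp only [inner_add_right, real_inner_smul_left, inner_smul_right]
  ring

theorem hasDerivAt_integral_energy (H : IsMinimizingLimit k h q s m M un u W) (hN : 3 ≤ N)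
    (hφ : IsTestFunction φ) :
    HasDerivAt (fun t : ℝ => 1 / 2 * ∫ x, (1 + 2 * (u x + t * φ x) ^ 2)
      * ‖weakGrad (fun y => u y + t * φ y) x‖ ^ 2) (gradientVariation u φ W) 0 := by
  have e : ∀ t : ℝ, ∫ x, (1 + 2 * (u x + t * φ x) ^ 2)
      * ‖weakGrad (fun y => u y + t * φ y) x‖ ^ 2 = (∫ x, ‖limitGradient u W x + t • gradient φ x
      + t ^ 2 • (0 : EuclideanSpace ℝ (Fin N))‖ ^ 2) + 2 * ∫ x, ‖u x • limitGradient u W x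
      + t • (φ x • limitGradient u W x + u x • gradient φ x) + t ^ 2 • (φ x • gradient φ x)‖ ^ 2 :=
    fun t => by
      obtain ⟨h1, h2⟩ := H.integrable_energy_terms hN hφ t
      rw [← integral_const_mul, ← integral_add h1 h2]
      refine integral_congr_ae ?_
      filter_upwards [H.weakGrad_add_ae_eq hN hφ t] with x hx
      rw [hx, energy_density_eq]
  simp only [e]
  have h1 := hasDerivAt_integral_norm_sq H.memLp_limitGradient hφ.isLipC.memLp_gradient
    (MemLp.zero' (ε := EuclideanSpace ℝ (Fin N)))
  have h2 := hasDerivAt_integral_norm_sq H.memLp_smul_limitGradient (H.memLp_variation hN hφ)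
    (memLp_smul_gradient_self hφ)
  refine ((h1.add (h2.const_mul 2)).const_mul (1 / 2)).congr_deriv ?_
  rw [H.gradientVariation_eq hN hφ]
  ring

/-- The Euler-Lagrange equation for the limit of the minimising sequence. -/
theorem gradientVariation_eq_integral (H : IsMinimizingLimit k h q s m M un u W) (hN : 3 ≤ N)
    (hq1 : 1 < q) (hq2 : q < 2) (hs : 1 < s) (hk : MemLp k ⊤ volume)
    (hkq : MemLp k (ENNReal.ofReal (conjExp N q)) volume)
    (hk0 : ∀ᵐ x, 0 ≤ k x) (hh : MemLp h ⊤ volume) (hh0 : ∀ᵐ x, 0 ≤ h x)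
    (hφ : IsTestFunction φ) :
    gradientVariation u φ W = (∫ x, k x * (|u x| ^ (q - 2) * u x) * φ x)
      - ∫ x, h x * (|u x| ^ (s - 2) * u x) * φ x := by
  have hq0 : 0 < q := by linarith
  have hs0 : 0 < s := by linarith
  have hL := hφ.isLipC
  have hku := (H.tendsto_integral_k hN hq0 hq2 hkq hk0).1
  have hhu := H.integrable_h hs0 hh hh0
  have hkφ := hL.integrable_mul_abs_rpow hk hq0
  have hhφ := hL.integrable_mul_abs_rpow hh hs0
  have hφm := hL.continuous.measurable
  obtain ⟨R, hR⟩ := H.exists_variation_nonneg hN hq1 hq2 hs hk hkq hk0 hh hh0 hφ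
  have hK := (hasDerivAt_integral_abs_rpow hq1 hk.1 hk0 H.measurable hφm hku hkφ).2
  have hH := (hasDerivAt_integral_abs_rpow hs hh.1 hh0 H.measurable hφm hhu hhφ).2
  set A := gradientVariation u φ W
  have h1 : HasDerivAt (fun t : ℝ => t * A + t ^ 2 * R
      - 1 / q * ((∫ x, k x * |u x + t * φ x| ^ q) - ∫ x, k x * |u x| ^ q)
      + 1 / s * ((∫ x, h x * |u x + t * φ x| ^ s) - ∫ x, h x * |u x| ^ s))
      (A - (∫ x, k x * (|u x| ^ (q - 2) * u x) * φ x)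
        + ∫ x, h x * (|u x| ^ (s - 2) * u x) * φ x) 0 := by
    have h2 : HasDerivAt (fun t : ℝ => t ^ 2) 0 0 := by simpa using hasDerivAt_pow 2 (0 : ℝ)
    refine (((((hasDerivAt_id' (0 : ℝ)).mul_const A).add (h2.mul_const R)).sub
      ((hK.sub_const _).const_mul (1 / q))).add ((hH.sub_const _).const_mul (1 / s))).congr_deriv ?_
    field_simp
    ring
  -- The function vanishes at t = 0 and is nonnegative for |t| < 1, so its derivative there is 0;
  -- the remainder t²R does not contribute to that derivative.
  have hmin : IsLocalMin (fun t : ℝ => t * A + t ^ 2 * R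
      - 1 / q * ((∫ x, k x * |u x + t * φ x| ^ q) - ∫ x, k x * |u x| ^ q)
      + 1 / s * ((∫ x, h x * |u x + t * φ x| ^ s) - ∫ x, h x * |u x| ^ s)) 0 := by
    filter_upwards [Metric.ball_mem_nhds (0 : ℝ) one_pos] with t ht
    rw [mem_ball_zero_iff, Real.norm_eq_abs] at ht
    have h2 := hR t ht.le
    have e1 : ∀ (g : EuclideanSpace ℝ (Fin N) → ℝ) (p : ℝ),
        Integrable (fun x => g x * |u x| ^ p) volume →
        Integrable (fun x => g x * |u x + t * φ x| ^ p) volume →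
        ∫ x, g x * (|u x + t * φ x| ^ p - |u x| ^ p)
          = (∫ x, g x * |u x + t * φ x| ^ p) - ∫ x, g x * |u x| ^ p := fun g p hg hp => by
      rw [← integral_sub hp hg]
      congr 1 with x
      ring
    rw [e1 k q hku (integrable_mul_abs_add_rpow hq1 hk.1 hk0 H.measurable hφm hku hkφ t),
      e1 h s hhu (integrable_mul_abs_add_rpow hs hh.1 hh0 H.measurable hφm hhu hhφ t)] at h2
    simpa using h2
  have := hmin.hasDerivAt_eq_zero h1
  linarith

theorem isWeakSolution (H : IsMinimizingLimit k h q s m M un u W) (hN : 3 ≤ N)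
    (hq1 : 1 < q) (hq2 : q < 2) (hs : 1 < s) (hk : MemLp k ⊤ volume)
    (hkq : MemLp k (ENNReal.ofReal (conjExp N q)) volume)
    (hk0 : ∀ᵐ x, 0 ≤ k x) (hh : MemLp h ⊤ volume) (hh0 : ∀ᵐ x, 0 ≤ h x) :
    IsWeakSolution k h q s u := by
  have hq0 : 0 < q := by linarith
  have hs0 : 0 < s := by linarith
  have hku := (H.tendsto_integral_k hN hq0 hq2 hkq hk0).1
  have hhu := H.integrable_h hs0 hh hh0
  have hw := (H.hasWeakGradient hN).weakGrad_ae_eq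
  have hK := fun {φ : EuclideanSpace ℝ (Fin N) → ℝ} (hφ : IsTestFunction φ) =>
    hasDerivAt_integral_abs_rpow hq1 hk.1 hk0 H.measurable hφ.continuous.measurable hku
      (hφ.isLipC.integrable_mul_abs_rpow hk hq0)
  have hH := fun {φ : EuclideanSpace ℝ (Fin N) → ℝ} (hφ : IsTestFunction φ) =>
    hasDerivAt_integral_abs_rpow hs hh.1 hh0 H.measurable hφ.continuous.measurable hhu
      (hφ.isLipC.integrable_mul_abs_rpow hh hs0)
  have hEL := fun {φ : EuclideanSpace ℝ (Fin N) → ℝ} (hφ : IsTestFunction φ) =>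
    H.gradientVariation_eq_integral hN hq1 hq2 hs hk hkq hk0 hh hh0 hφ
  -- Substituting W = 2u∇u turns the three terms of `gradientVariation` into the integrand of the
  -- weak form.
  have hl : ∀ φ : EuclideanSpace ℝ (Fin N) → ℝ,
      (fun x => inner ℝ (limitGradient u W x) (gradient φ x)
        + u x * inner ℝ (W x) (gradient φ x) + φ x * inner ℝ (W x) (limitGradient u W x))
      =ᵐ[volume] fun x => (1 + 2 * u x ^ 2) * inner ℝ (weakGrad u x) (gradient φ x)
        + 2 * u x * ‖weakGrad u x‖ ^ 2 * φ x := fun φ => by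
    filter_upwards [hw, H.ae_eq_smul_limitGradient] with x hx hWx
    rw [hx]
    generalize limitGradient u W x = g at hWx ⊢
    rw [hWx, real_inner_smul_left, real_inner_smul_left, real_inner_self_eq_norm_sq]
    ring
  have hr : ∀ φ : EuclideanSpace ℝ (Fin N) → ℝ, ∀ x,
      (k x * (|u x| ^ (q - 2) * u x) - h x * (|u x| ^ (s - 2) * u x)) * φ x
        = k x * (|u x| ^ (q - 2) * u x) * φ x - h x * (|u x| ^ (s - 2) * u x) * φ x :=
    fun φ x => by ring
  have hzero : IsTestFunction (fun _ : EuclideanSpace ℝ (Fin N) => (0 : ℝ)) :=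
    ⟨contDiff_const, HasCompactSupport.zero⟩
  refine ⟨?_, fun φ hφ t => H.hasFiniteEnergy_add hN hq1 hq2 hs hk hkq hk0 hh hh0 hφ t,
    fun φ hφ => ?_, fun φ hφ => ?_, fun φ hφ => ?_, fun φ hφ => ?_⟩
  · simpa using H.hasFiniteEnergy_add hN hq1 hq2 hs hk hkq hk0 hh hh0 hzero 0
  · refine (((H.hasDerivAt_integral_energy hN hφ).sub ((hK hφ).2.const_mul (1 / q))).add
      ((hH hφ).2.const_mul (1 / s))).congr_deriv ?_
    rw [hEL hφ]
    field_simp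
    ring
  · obtain ⟨h1, h2, h3⟩ := H.integrable_gradientVariation hN hφ
    exact ((h1.add h2).add h3).congr (hl φ)
  · simp only [hr]
    exact (hK hφ).1.sub (hH hφ).1
  · obtain ⟨h1, h2, h3⟩ := H.integrable_gradientVariation hN hφ
    have h12 : Integrable (fun x => inner ℝ (limitGradient u W x) (gradient φ x)
        + u x * inner ℝ (W x) (gradient φ x)) volume := h1.add h2
    rw [← integral_congr_ae (hl φ), integral_add h12 h3, integral_add h1 h2]
    simp only [hr]
    rw [integral_sub (hK hφ).1 (hH hφ).1]
    exact hEL hφ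

theorem energy_le_infimum (H : IsMinimizingLimit k h q s m M un u W) (hN : 3 ≤ N) (hq0 : 0 < q)
    (hq2 : q < 2) (hs : 0 < s) (hkq : MemLp k (ENNReal.ofReal (conjExp N q)) volume)
    (hk0 : ∀ᵐ x, 0 ≤ k x) (hh : MemLp h ⊤ volume) (hh0 : ∀ᵐ x, 0 ≤ h x) :
    energy k h q s u ≤ m := by
  have e : ∫ x, (1 + 2 * u x ^ 2) * ‖weakGrad u x‖ ^ 2
      = ∫ x, (1 + 2 * u x ^ 2) * ‖limitGradient u W x‖ ^ 2 := by
    refine integral_congr_ae ?_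
    filter_upwards [(H.hasWeakGradient hN).weakGrad_ae_eq] with x hx
    rw [hx]
  rw [energy, e]
  exact H.energy_le hN hq0 hq2 hs hkq hk0 hh hh0

end IsMinimizingLimit

end QuasilinearSchrodinger

end

/-! ### The existence theorem. -/

theorem theorem2 (N : ℕ) (hN : 3 ≤ N) (q s : ℝ) (hq1 : 1 < q) (hq2 : q < 2) (hs : 2 < s)
    (k h : EuclideanSpace ℝ (Fin N) → ℝ)
    (hk_Lq0 : MemLp k (ENNReal.ofReal (QuasilinearSchrodinger.conjExp N q)) volume)
    (hk_Linf : MemLp k ⊤ volume)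
    (hk_nonneg : ∀ᵐ x ∂(volume : Measure (EuclideanSpace ℝ (Fin N))), 0 ≤ k x)
    (hk_ne : ¬ ∀ᵐ x ∂(volume : Measure (EuclideanSpace ℝ (Fin N))), k x = 0)
    (hh_L1 : MemLp h 1 volume)
    (hh_Linf : MemLp h ⊤ volume)
    (hh_nonneg : ∀ᵐ x ∂(volume : Measure (EuclideanSpace ℝ (Fin N))), 0 ≤ h x) :
    ∃ u : EuclideanSpace ℝ (Fin N) → ℝ,
      QuasilinearSchrodinger.IsWeakSolution k h q s u ∧
      (∀ᵐ x ∂(volume : Measure (EuclideanSpace ℝ (Fin N))), 0 ≤ u x) ∧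
      QuasilinearSchrodinger.energy k h q s u < 0 := by
  obtain ⟨m, hm, M, un, u, W, H⟩ := QuasilinearSchrodinger.exists_minimizingLimit hN
    (by linarith) hq2 hs hk_Linf hk_Lq0 hk_nonneg hh_Linf hh_nonneg
    (QuasilinearSchrodinger.exists_lipEnergy_neg hq1 hq2 hs hk_Linf hk_nonneg hk_ne hh_nonneg)
  exact ⟨u, H.isWeakSolution hN hq1 hq2 (by linarith) hk_Linf hk_Lq0 hk_nonneg hh_Linf hh_nonneg,
    Filter.Eventually.of_forall H.limit_nonneg,
    (H.energy_le_infimum hN (by linarith) hq2 (by linarith) hk_Lq0 hk_nonneg hh_Linf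
      hh_nonneg).trans_lt hm⟩
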